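/- **Definitions.** XML documents are finite unranked ordered trees whose nodes carry labels from a finite set $\Sigma$. Regular expressions over $\Sigma$ are built from $\epsilon$ and the symbols of $\Sigma$ with concatenation, $|$, ${}^*$, ${}^?$, ${}^+$ and the $(m+l)$-ary operator $\#$, where $(e_1,\dots,e_m)\#(f_1,\dots,f_l)$ denotes $e_1\cdots e_m f_1^?\cdots f_l^?\mid e_1^?\cdots e_m^? f_1\cdots f_l$; the size of an expression is its number of constants and operators. A DTD $D=(\Sigma,r,P)$ consists of a finite set $\Sigma$ of labels, a root label $r\in\Sigma$ and a regular expression $P(a)$ for each $a\in\Sigma$; its size $|D|$ is the sum of the sizes of all $P(a)$. A tree conforms to $D$ if its root is labelled $r$ and, for every node, the word of labels of its children belongs to $L(P(a))$, where $a$ is the label of the node. As usual, every DTD is assumed to have no useless symbols: each $a\in\Sigma$ labels some node of some tree conforming to $D$. A regular expression is $\mathrm{DC}^{?+\#}$ if it is a (possibly empty) concatenation of expressions, each of which is a symbol, or of the form $f^*$ or $f^+$ with $f$ arbitrary, or of the form $f^?$ or $(f_1,\dots,f_m)\#(g_1,\dots,g_l)$ with $\mathrm{DC}^{?+\#}$ arguments.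 An expression $e$ is RW if $e=e_1\cdots e_n$ where each $e_i$ is $\mathrm{DC}^{?+\#}$ or consists only of symbols that appear once in $e$. $D$ is an MRW-DTD if every content model $e=P(a)$ is RW and every symbol that appears in $e$ outside the scope of all ${}^*$ and ${}^+$ appears only once in $e$. The class $\mathcal X(\downarrow,\rightarrow^+,\leftarrow^+,[\,]_\wedge)$ consists of the expressions $p::=\chi::l\mid p/p\mid p[p]$ with $\chi\in\{\downarrow,\rightarrow^+,\leftarrow^+\}$ (child, following sibling, preceding sibling) and $l\in\Sigma$; $|p|$ is the number of subexpressions $\chi::l$. Over a tree, $\chi::l$ relates a node $v$ to each node $v'$ with label $l$ that is, respectively, a child, a following sibling or a preceding sibling of $v$; $p/p'$ is the composition of relations; and $p[p']$ relates $v$ to $v'$ if $p$ does and $p'$ relates $v'$ to some node. The expression $p$ is satisfiable under $D$ if, in some tree conforming to $D$, $p$ relates the root to some node. **Theorem.** Satisfiability of expressions in $\mathcal X(\downarrow,\rightarrow^+,\leftarrow^+,[\,]_\wedge)$ under MRW-DTDs is decidable in polynomial time. That is, there are an algorithm and a polynomial $f$ such that, for every MRW-DTD $D$ without useless symbols and every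 $p\in\mathcal X(\downarrow,\rightarrow^+,\leftarrow^+,[\,]_\wedge)$ over the labels of $D$, the algorithm on input $(D,p)$ halts after at most $f(|D|+|p|)$ steps and accepts if and only if $p$ is satisfiable under $D$. -/

import Mathlib

/-! ### XML documents: finite unranked ordered labelled trees -/

namespace XPathSat

inductive XmlTree (α : Type) : Type
  | node (label : α) (children : List (XmlTree α)) : XmlTree α

namespace XmlTree

variable {α : Type}

def rootLabel : XmlTree α → α
  | node a _ => a

/-- The subtree at an address.  An address is the list of child indices (from `0`) on the way
down from the root; addresses at which there is a subtree are the nodes of the tree, equivalently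
the paths that start at the root. The root has address `[]`. -/
def subtree? : XmlTree α → List ℕ → Option (XmlTree α)
  | t, [] => some t
  | node _ ts, i :: w => (ts[i]?).bind fun t => subtree? t w

/-- The label of the node at an address, `none` if there is no such node. -/
def label? (t : XmlTree α) (w : List ℕ) : Option α :=
  (t.subtree? w).map rootLabel

end XmlTree

/-! ### Regular expressions and DTDs -/

/-- Regular expressions with constants `ε` and symbols and with the operators concatenation,
disjunction, `*`, `?`, `+` and the `(m + l)`-ary operator `#`. -/
inductive RegEx (α : Type) : Type
  | eps : RegEx α
  | sym (a : α) : RegEx α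
  | cat (e f : RegEx α) : RegEx α
  | alt (e f : RegEx α) : RegEx α
  | star (e : RegEx α) : RegEx α
  | opt (e : RegEx α) : RegEx α
  | plus (e : RegEx α) : RegEx α
  | hash (es fs : List (RegEx α)) : RegEx α

namespace RegEx

variable {α : Type}

mutual
/-- The string language of a regular expression. -/
def lang : RegEx α → Language α
  | eps => 1
  | sym a => {[a]}
  | cat e f => lang e * lang f
  | alt e f => lang e + lang f
  | star e => KStar.kstar (lang e)
  | opt e => 1 + lang e
  | plus e => lang e * KStar.kstar (lang e)
  | hash es fs => langCat es * langOptCat fs + langOptCat es * langCat fs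
/-- The language of `e₁ e₂ ⋯ eₘ`. -/
def langCat : List (RegEx α) → Language α
  | [] => 1
  | e :: es => lang e * langCat es
/-- The language of `e₁? e₂? ⋯ eₘ?`. -/
def langOptCat : List (RegEx α) → Language α
  | [] => 1
  | e :: es => (1 + lang e) * langOptCat es
end

mutual
/-- The number of constants and operators. -/
def size : RegEx α → ℕ
  | eps => 1
  | sym _ => 1
  | cat e f => size e + size f + 1
  | alt e f => size e + size f + 1
  | star e => size e + 1
  | opt e => size e + 1
  | plus e => size e + 1
  | hash es fs => sizeList es + sizeList fs + 1
def sizeList : List (RegEx α) → ℕ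
  | [] => 0
  | e :: es => size e + sizeList es
end

mutual
/-- The occurrences of symbols, from left to right. -/
def symbols : RegEx α → List α
  | eps => []
  | sym a => [a]
  | cat e f => symbols e ++ symbols f
  | alt e f => symbols e ++ symbols f
  | star e => symbols e
  | opt e => symbols e
  | plus e => symbols e
  | hash es fs => symbolsList es ++ symbolsList fs
def symbolsList : List (RegEx α) → List α
  | [] => []
  | e :: es => symbols e ++ symbolsList es
end

mutual
/-- The occurrences of symbols outside the scope of any `*` and `+`. -/
def outerSymbols : RegEx α → List α
  | eps => []
  | sym a => [a]
  | cat e f => outerSymbols e ++ outerSymbols f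
  | alt e f => outerSymbols e ++ outerSymbols f
  | star _ => []
  | opt e => outerSymbols e
  | plus _ => []
  | hash es fs => outerSymbolsList es ++ outerSymbolsList fs
def outerSymbolsList : List (RegEx α) → List α
  | [] => []
  | e :: es => outerSymbols e ++ outerSymbolsList es
end

mutual
/-- `e` is `DC^{?+#}`: a concatenation of symbols, expressions `f*` and `f+` with `f` arbitrary,
and expressions `f?` and `(f₁,…,fₘ)#(g₁,…,gₗ)` with `DC^{?+#}` arguments (`ε` counts as the empty
concatenation). -/
def IsDC : RegEx α → Prop
  | eps => True
  | sym _ => True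
  | cat e f => IsDC e ∧ IsDC f
  | alt _ _ => False
  | star _ => True
  | opt e => IsDC e
  | plus _ => True
  | hash es fs => IsDCList es ∧ IsDCList fs
def IsDCList : List (RegEx α) → Prop
  | [] => True
  | e :: es => IsDC e ∧ IsDCList es
end

/-- The factors `e₁, …, eₙ` of the top-level concatenation `e = e₁ ⋯ eₙ`. -/
def factors : RegEx α → List (RegEx α)
  | cat e f => factors e ++ factors f
  | e => [e]

/-- `e` is RW: every factor is `DC^{?+#}` or consists only of symbols that appear once in `e`. -/
def IsRW [DecidableEq α] (e : RegEx α) : Prop :=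
  ∀ f ∈ e.factors, f.IsDC ∨ ∀ a ∈ f.symbols, e.symbols.count a = 1

/-- `e` is MRW: it is RW, and each symbol that appears outside the scope of any `*` and `+`
appears only once in `e`. -/
def IsMRW [DecidableEq α] (e : RegEx α) : Prop :=
  e.IsRW ∧ ∀ a ∈ e.outerSymbols, e.symbols.count a = 1

end RegEx

/-- A DTD; the finite set of labels is `{0, …, numLabels - 1}`. -/
structure DTD where
  numLabels : ℕ
  root : Fin numLabels
  content : Fin numLabels → RegEx (Fin numLabels)

namespace DTD

/-- A tree conforms to `D`. -/
def Conforms (D : DTD) (t : XmlTree (Fin D.numLabels)) : Prop :=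
  t.rootLabel = D.root ∧
    ∀ w a ts, t.subtree? w = some (XmlTree.node a ts) →
      ts.map XmlTree.rootLabel ∈ (D.content a).lang

/-- Every label occurs in some tree that conforms to `D`. -/
def NoUselessSymbols (D : DTD) : Prop :=
  ∀ a, ∃ t, D.Conforms t ∧ ∃ w, t.label? w = some a

def IsMRW (D : DTD) : Prop :=
  ∀ a, (D.content a).IsMRW

/-- The sum of the sizes of the content models. -/
def size (D : DTD) : ℕ :=
  ∑ a, (D.content a).size

end DTD

/-! ### XPath expressions with child and sibling axes and qualifiers without disjunction -/

inductive Axis : Type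
  | child
  | followingSibling
  | precedingSibling

/-- `p ::= χ::l | p/p | p[p]`, where `χ` is one of the axes `↓`, `→⁺`, `←⁺`. -/
inductive XPath (α : Type) : Type
  | step (χ : Axis) (l : α) : XPath α
  | comp (p q : XPath α) : XPath α
  | filter (p q : XPath α) : XPath α

/-- Axes as binary relations on addresses. -/
def Axis.Rel : Axis → List ℕ → List ℕ → Prop
  | child, w, w' => ∃ i, w' = w ++ [i]
  | followingSibling, w, w' => ∃ u i j, w = u ++ [i] ∧ w' = u ++ [j] ∧ i < j
  | precedingSibling, w, w' => ∃ u i j, w = u ++ [i] ∧ w' = u ++ [j] ∧ j < i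

namespace XPath

variable {α : Type}

/-- `T ⊨ p(w, w')`. -/
def Holds (t : XmlTree α) : XPath α → List ℕ → List ℕ → Prop
  | step χ l, w, w' => (t.subtree? w).isSome ∧ χ.Rel w w' ∧ t.label? w' = some l
  | comp p q, w, w' => ∃ w'', Holds t p w w'' ∧ Holds t q w'' w'
  | filter p q, w, w' => Holds t p w w' ∧ ∃ w'', Holds t q w' w''

/-- The number of atomic subexpressions. -/
def size : XPath α → ℕ
  | step _ _ => 1
  | comp p q => size p + size q
  | filter p q => size p + size q

/-- Some tree that conforms to `D` satisfies `p` (from its root). -/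
def Satisfiable (D : DTD) (p : XPath (Fin D.numLabels)) : Prop :=
  ∃ t, D.Conforms t ∧ ∃ w, p.Holds t [] w

end XPath

/-! ### Programs with a step count

A first-order functional language over binary trees (S-expressions), with `cons`, `hd`, `tl`, a
test for `nil` and mutually recursive functions of one argument. Values are shared and never
compared or copied as a whole, so that an evaluation of cost `t` is simulated by a Turing machine in
time polynomial in `t` and the size of the argument, and conversely; the functions computed
in polynomial time are the usual ones. -/

inductive Data : Type
  | nil : Data
  | cons (x y : Data) : Data

namespace Data

def hd : Data → Data
  | nil => nil
  | cons x _ => x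

def tl : Data → Data
  | nil => nil
  | cons _ y => y

def ofNat : ℕ → Data
  | 0 => nil
  | n + 1 => cons nil (ofNat n)

def ofList : List Data → Data
  | [] => nil
  | x :: xs => cons x (ofList xs)

end Data

/-- Function bodies: `arg` is the argument of the function, and `call i e` calls the `i`-th
function of the program on the value of `e`. -/
inductive Exp : Type
  | arg : Exp
  | nil : Exp
  | cons (e f : Exp) : Exp
  | hd (e : Exp) : Exp
  | tl (e : Exp) : Exp
  | ite (c e f : Exp) : Exp
  | call (i : ℕ) (e : Exp) : Exp

/-- A program is the list of the bodies of its functions. -/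
abbrev Prog : Type := List Exp

/-- `Eval P x e v t`: with argument `x`, the expression `e` evaluates (call by value) to `v` in `t`
steps. There is exactly one rule for each situation, and each rule application is a step. -/
inductive Eval (P : Prog) : Data → Exp → Data → ℕ → Prop
  | arg {x : Data} : Eval P x Exp.arg x 1
  | nil {x : Data} : Eval P x Exp.nil Data.nil 1
  | cons {x : Data} {e f : Exp} {v w : Data} {s t : ℕ} :
      Eval P x e v s → Eval P x f w t → Eval P x (Exp.cons e f) (Data.cons v w) (s + t + 1)
  | hd {x : Data} {e : Exp} {v : Data} {s : ℕ} :
      Eval P x e v s → Eval P x (Exp.hd e) v.hd (s + 1)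
  | tl {x : Data} {e : Exp} {v : Data} {s : ℕ} :
      Eval P x e v s → Eval P x (Exp.tl e) v.tl (s + 1)
  | iteTrue {x : Data} {c e f : Exp} {y z v : Data} {s t : ℕ} :
      Eval P x c (Data.cons y z) s → Eval P x e v t → Eval P x (Exp.ite c e f) v (s + t + 1)
  | iteFalse {x : Data} {c e f : Exp} {v : Data} {s t : ℕ} :
      Eval P x c Data.nil s → Eval P x f v t → Eval P x (Exp.ite c e f) v (s + t + 1)
  | call {x : Data} {i : ℕ} {e body : Exp} {y v : Data} {s t : ℕ} :
      Eval P x e y s → P[i]? = some body → Eval P y body v t →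
        Eval P x (Exp.call i e) v (s + t + 1)

/-- Evaluation is deterministic, in its value and in its number of steps. -/
theorem Eval.deterministic {P : Prog} {x : Data} {e : Exp} {v v' : Data} {t t' : ℕ}
    (h : Eval P x e v t) (h' : Eval P x e v' t') : v = v' ∧ t = t' := by
  induction h generalizing v' t' with
  | arg => cases h'; exact ⟨rfl, rfl⟩
  | nil => cases h'; exact ⟨rfl, rfl⟩
  | cons _ _ ih1 ih2 =>
    cases h' with
    | cons a b =>
      obtain ⟨rfl, rfl⟩ := ih1 a
      obtain ⟨rfl, rfl⟩ := ih2 b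
      exact ⟨rfl, rfl⟩
  | hd _ ih => cases h' with | hd a => obtain ⟨rfl, rfl⟩ := ih a; exact ⟨rfl, rfl⟩
  | tl _ ih => cases h' with | tl a => obtain ⟨rfl, rfl⟩ := ih a; exact ⟨rfl, rfl⟩
  | iteTrue _ _ ih1 ih2 =>
    cases h' with
    | iteTrue a b =>
      obtain ⟨_, rfl⟩ := ih1 a
      obtain ⟨rfl, rfl⟩ := ih2 b
      exact ⟨rfl, rfl⟩
    | iteFalse a b => cases (ih1 a).1
  | iteFalse _ _ ih1 ih2 =>
    cases h' with
    | iteTrue a b => cases (ih1 a).1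
    | iteFalse a b =>
      obtain ⟨_, rfl⟩ := ih1 a
      obtain ⟨rfl, rfl⟩ := ih2 b
      exact ⟨rfl, rfl⟩
  | call _ hb _ ih1 ih2 =>
    cases h' with
    | call a hb' b =>
      obtain ⟨rfl, rfl⟩ := ih1 a
      obtain rfl := Option.some.inj (hb.symm.trans hb')
      obtain ⟨rfl, rfl⟩ := ih2 b
      exact ⟨rfl, rfl⟩

/-- `P` halts on input `x` after `t` steps with output `v`; the main function is the `0`-th one. -/
def Prog.Outputs (P : Prog) (x v : Data) (t : ℕ) : Prop :=
  Eval P x (Exp.call 0 Exp.arg) v t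

/-- The decision problem with instances `{x | Inst x}` and question `Yes x` is decidable in
polynomial time: one program halts on the encoding of every instance within a number of
steps that is polynomial in the size of the instance, and accepts (by a non-`nil` output) exactly
when the answer is yes. -/
def PolyTimeDecidable {ι : Type} (encode : ι → Data) (size : ι → ℕ) (Inst Yes : ι → Prop) : Prop :=
  ∃ (P : Prog) (q : Polynomial ℕ), ∀ x, Inst x →
    ∃ (v : Data) (t : ℕ), P.Outputs (encode x) v t ∧ t ≤ q.eval (size x) ∧ (v ≠ Data.nil ↔ Yes x)

/-! ### Instances of the satisfiability problem and their encoding -/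

mutual
def RegEx.encode {n : ℕ} : RegEx (Fin n) → Data
  | RegEx.eps => Data.cons (Data.ofNat 0) Data.nil
  | RegEx.sym a => Data.cons (Data.ofNat 1) (Data.ofNat a)
  | RegEx.cat e f => Data.cons (Data.ofNat 2) (Data.cons e.encode f.encode)
  | RegEx.alt e f => Data.cons (Data.ofNat 3) (Data.cons e.encode f.encode)
  | RegEx.star e => Data.cons (Data.ofNat 4) e.encode
  | RegEx.opt e => Data.cons (Data.ofNat 5) e.encode
  | RegEx.plus e => Data.cons (Data.ofNat 6) e.encode
  | RegEx.hash es fs =>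
      Data.cons (Data.ofNat 7) (Data.cons (RegEx.encodeList es) (RegEx.encodeList fs))
def RegEx.encodeList {n : ℕ} : List (RegEx (Fin n)) → Data
  | [] => Data.nil
  | e :: es => Data.cons e.encode (RegEx.encodeList es)
end

/-- The root label and the list of the content models of the labels `0, 1, 2, …`. -/
def DTD.encode (D : DTD) : Data :=
  Data.cons (Data.ofNat D.root) (Data.ofList (List.ofFn fun a => (D.content a).encode))

def Axis.encode : Axis → Data
  | child => Data.ofNat 0
  | followingSibling => Data.ofNat 1
  | precedingSibling => Data.ofNat 2

def XPath.encode {n : ℕ} : XPath (Fin n) → Data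
  | step χ l => Data.cons (Data.ofNat 0) (Data.cons χ.encode (Data.ofNat l))
  | comp p q => Data.cons (Data.ofNat 1) (Data.cons p.encode q.encode)
  | filter p q => Data.cons (Data.ofNat 2) (Data.cons p.encode q.encode)

/-- A DTD together with an XPath expression over its labels. -/
structure SatInput where
  dtd : DTD
  query : XPath (Fin dtd.numLabels)

namespace SatInput

def encode (I : SatInput) : Data :=
  Data.cons I.dtd.encode I.query.encode

/-- The sum `|D| + |p|`. Labels are encoded in unary and are smaller than `|D|`, so that the length
of the encoding is polynomially related to this number. -/
def size (I : SatInput) : ℕ :=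
  I.dtd.size + I.query.size

end SatInput

end XPathSat

/-!
Satisfiability is decided by a search in polynomial time, which rests on a local criterion.

*Patterns.* A query without disjunction is a tree pattern, in which nodes carry labels and edges
carry axes (`XPath.toPat`). It is satisfiable if and only if the pattern has no siblings of its root
and can be realized at the root label (`satisfiable_iff`), where `DTD.Realizes D a E` says that in
some valid tree with root label `a` the child edges among the edges `E` hold at the root.

*Content models.* Outside the scope of `*` and `+`, the content model is read as a sequence of atoms
(`RegEx.atoms`): a symbol can be used at most once, and an expression `f*` or `f+` provides arbitrary
subwords over its symbols. Thus a word is a subword of a word of `e` as soon as it splits along the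
atoms (`Traces`) and contains no two symbols from different sides of a disjunction
(`RegEx.exists_sublist_of_traces`, `RegEx.conflict`). For MRW expressions these conditions are also
necessary: factors that are not `DC^{?+#}`, which are the only ones with disjunctions outside `*` and
`+`, have symbols that appear once (`RegEx.IsRW.not_mem_and_mem`). For the same reason, a symbol that
appears outside `*` and `+` labels at most one child (`RegEx.count_le_one`).

*The local criterion.* Let `a` be a label with content model `e`. The offspring of a pattern node are
the pattern nodes that must be placed at its children. They can be placed only if each tree of
sibling edges among them can be mapped to the atoms in the right order, which is computed bottom up
(`Pat.feasible`), and if no two of their labels are in conflict. Pattern nodes with the same label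
outside `*` and `+` are placed at the same child, so they are merged; all others can be placed at
different children. Then `E` can be realized at `a` if and only if these tests succeed and each of
the merged nodes can be realized at its own label. The `only if` part is `fits_of_realizes`. For the
`if` part, `realizes_of_fits`, the offspring are placed at atoms and, within an atom `f*` or `f+`, at
integer heights; sorting by these positions gives a subword of a word of `e`, and the missing
children are provided by valid trees, which exist for all labels because there are no useless
symbols.

*The search.* The criterion turns a list of pairs `(a, E)` into another one whose encoding is smaller
(`search`). Hence the search takes linearly many steps.

*Polynomial time.* `PolyTime f` says that a program computes `f` in polynomially many steps with
values of polynomial size. This class of functions contains those given by expressions without calls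
and is closed under composition, pairing and recursion with a bounded number of calls and bounded
values (`PolyTime.recursion`); from there on it is propagated by `fun_prop`. Finally, the encoding of
an instance has quadratic size (`SatInput.sz_le`).
-/

/-! ### Running programs with cost bounds -/

namespace XPathSat

/-- The number of nodes of the tree, where shared parts count repeatedly. -/
def Data.size : Data → ℕ
  | Data.nil => 1
  | Data.cons x y => x.size + y.size + 1

theorem Data.size_pos (x : Data) : 0 < x.size := by cases x <;> simp [Data.size]

theorem Data.size_hd_le (x : Data) : x.hd.size ≤ x.size := by
  cases x <;> simp [Data.size, Data.hd]; omega

theorem Data.size_tl_le (x : Data) : x.tl.size ≤ x.size := by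
  cases x <;> simp [Data.size, Data.tl]; omega

/-- `e` evaluates to `v` in at most `T` steps. -/
def Runs (P : Prog) (x : Data) (e : Exp) (v : Data) (T : ℕ) : Prop :=
  ∃ t ≤ T, Eval P x e v t

namespace Runs

variable {P : Prog} {x y v w : Data} {e f c : Exp} {s t : ℕ}

theorem mono (h : Runs P x e v s) (hst : s ≤ t) : Runs P x e v t :=
  let ⟨a, ha, h⟩ := h
  ⟨a, ha.trans hst, h⟩

theorem arg : Runs P x Exp.arg x 1 := ⟨1, le_rfl, Eval.arg⟩

theorem nil : Runs P x Exp.nil Data.nil 1 := ⟨1, le_rfl, Eval.nil⟩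

theorem cons (h : Runs P x e v s) (h' : Runs P x f w t) :
    Runs P x (Exp.cons e f) (Data.cons v w) (s + t + 1) :=
  let ⟨a, ha, h⟩ := h
  let ⟨b, hb, h'⟩ := h'
  ⟨a + b + 1, by omega, Eval.cons h h'⟩

theorem hd (h : Runs P x e v s) : Runs P x (Exp.hd e) v.hd (s + 1) :=
  let ⟨a, ha, h⟩ := h
  ⟨a + 1, by omega, Eval.hd h⟩

theorem tl (h : Runs P x e v s) : Runs P x (Exp.tl e) v.tl (s + 1) :=
  let ⟨a, ha, h⟩ := h
  ⟨a + 1, by omega, Eval.tl h⟩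

theorem iteTrue {y z : Data} (h : Runs P x c (Data.cons y z) s) (h' : Runs P x e v t) :
    Runs P x (Exp.ite c e f) v (s + t + 1) :=
  let ⟨a, ha, h⟩ := h
  let ⟨b, hb, h'⟩ := h'
  ⟨a + b + 1, by omega, Eval.iteTrue h h'⟩

theorem iteFalse (h : Runs P x c Data.nil s) (h' : Runs P x f v t) :
    Runs P x (Exp.ite c e f) v (s + t + 1) :=
  let ⟨a, ha, h⟩ := h
  let ⟨b, hb, h'⟩ := h'
  ⟨a + b + 1, by omega, Eval.iteFalse h h'⟩

theorem call {i : ℕ} {body : Exp} (h : Runs P x e y s) (hb : P[i]? = some body)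
    (h' : Runs P y body v t) : Runs P x (Exp.call i e) v (s + t + 1) :=
  let ⟨a, ha, h⟩ := h
  let ⟨b, hb', h'⟩ := h'
  ⟨a + b + 1, by omega, Eval.call h hb h'⟩

/-- Calling a function on the value of `e`, given a run of the function on its argument. -/
theorem app {i : ℕ} (h : Runs P x e y s) (h' : Runs P y (Exp.call i Exp.arg) v t) :
    Runs P x (Exp.call i e) v (s + t) := by
  obtain ⟨b, hb', h'⟩ := h'
  cases h' with
  | call h1 h2 h3 =>
    cases h1
    exact (call h h2 ⟨_, le_rfl, h3⟩).mono (by omega)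

end Runs

/-- Renumbering of the called functions. -/
def Exp.shift (k : ℕ) : Exp → Exp
  | Exp.arg => Exp.arg
  | Exp.nil => Exp.nil
  | Exp.cons e f => Exp.cons (e.shift k) (f.shift k)
  | Exp.hd e => Exp.hd (e.shift k)
  | Exp.tl e => Exp.tl (e.shift k)
  | Exp.ite c e f => Exp.ite (c.shift k) (e.shift k) (f.shift k)
  | Exp.call i e => Exp.call (k + i) (e.shift k)

/-- A program still works as a part of a larger one, with its calls renumbered. -/
theorem Eval.link {P : Prog} {x v : Data} {e : Exp} {t : ℕ} (h : Eval P x e v t) (Q T : Prog) :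
    Eval (Q ++ (P.map (Exp.shift Q.length) ++ T)) x (e.shift Q.length) v t := by
  induction h with
  | arg => exact Eval.arg
  | nil => exact Eval.nil
  | cons _ _ h1 h2 => exact Eval.cons h1 h2
  | hd _ h1 => exact Eval.hd h1
  | tl _ h1 => exact Eval.tl h1
  | iteTrue _ _ h1 h2 => exact Eval.iteTrue h1 h2
  | iteFalse _ _ h1 h2 => exact Eval.iteFalse h1 h2
  | @call x i e body y v s t _ hb _ h1 h2 =>
    refine Eval.call h1 ?_ h2
    have hi : i < P.length := (List.getElem?_eq_some_iff.1 hb).1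
    rw [List.getElem?_append_right (by omega), Nat.add_sub_cancel_left,
      List.getElem?_append_left (by simpa using hi), List.getElem?_map, hb]
    rfl

/-! ### Functions computable in polynomial time -/

/-- Types whose elements are encoded as binary trees. -/
class Enc (α : Type) where
  enc : α → Data

/-- The size of the encoding. -/
def sz {α : Type} [Enc α] (a : α) : ℕ := (Enc.enc a).size

theorem sz_pos {α : Type} [Enc α] (a : α) : 0 < sz a := Data.size_pos _

theorem eval_mono (q : Polynomial ℕ) {m n : ℕ} (h : m ≤ n) : q.eval m ≤ q.eval n := by
  induction q using Polynomial.induction_on' with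
  | add p q hp hq => simpa using add_le_add hp hq
  | monomial k a => simpa using Nat.mul_le_mul_left a (Nat.pow_le_pow_left h k)

/-- `f` is computed by a program in polynomial time, and the size of its values is polynomially
bounded in the size of the arguments (the number of steps does not bound the size of a value as a
tree, because values are shared). -/
@[fun_prop]
def PolyTime {α β : Type} [Enc α] [Enc β] (f : α → β) : Prop :=
  ∃ q : Polynomial ℕ, (∀ a, sz (f a) ≤ q.eval (sz a)) ∧
    ∃ P : Prog, ∀ a, Runs P (Enc.enc a) (Exp.call 0 Exp.arg) (Enc.enc (f a)) (q.eval (sz a))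

variable {α β γ δ : Type} [Enc α] [Enc β] [Enc γ] [Enc δ]

/-- Two polynomial time functions as the functions `i` and `j` of a program whose first `n`
functions are arbitrary. -/
theorem PolyTime.link {f : α → β} {g : γ → δ} (hf : PolyTime f) (hg : PolyTime g) (n : ℕ) :
    ∃ (R : Prog) (i j : ℕ) (q : Polynomial ℕ), (∀ a, sz (f a) ≤ q.eval (sz a)) ∧
      (∀ c, sz (g c) ≤ q.eval (sz c)) ∧ ∀ Q : Prog, Q.length = n →
        (∀ a, Runs (Q ++ R) (Enc.enc a) (Exp.call i Exp.arg) (Enc.enc (f a)) (q.eval (sz a))) ∧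
        ∀ c, Runs (Q ++ R) (Enc.enc c) (Exp.call j Exp.arg) (Enc.enc (g c)) (q.eval (sz c)) := by
  obtain ⟨qf, hf1, Pf, hf2⟩ := hf
  obtain ⟨qg, hg1, Pg, hg2⟩ := hg
  refine ⟨Pf.map (Exp.shift n) ++ (Pg.map (Exp.shift (n + Pf.length)) ++ []), n, n + Pf.length,
    qf + qg, fun a => ?_, fun a => ?_, fun Q hQ => ⟨fun a => ?_, fun a => ?_⟩⟩
  · have := hf1 a
    simp; omega
  · have := hg1 a
    simp; omega
  · obtain ⟨t, ht, h⟩ := hf2 a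
    have := h.link Q (Pg.map (Exp.shift (n + Pf.length)) ++ [])
    rw [hQ] at this
    exact ⟨t, by simp; omega, by simpa [Exp.shift] using this⟩
  · obtain ⟨t, ht, h⟩ := hg2 a
    have := h.link (Q ++ Pf.map (Exp.shift n)) []
    rw [List.length_append, hQ, List.length_map] at this
    exact ⟨t, by simp; omega, by simpa [Exp.shift] using this⟩

namespace Exp

/-- No calls occur in the expression. -/
def callFree : Exp → Bool
  | arg => true
  | nil => true
  | cons e f => e.callFree && f.callFree
  | hd e => e.callFree
  | tl e => e.callFree
  | ite c e f => c.callFree && e.callFree && f.callFree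
  | call _ _ => false

/-- The value of a call-free expression (calls get the value `nil`). -/
def val (x : Data) : Exp → Data
  | arg => x
  | nil => Data.nil
  | cons e f => Data.cons (e.val x) (f.val x)
  | hd e => (e.val x).hd
  | tl e => (e.val x).tl
  | ite c e f => match c.val x with
    | Data.nil => f.val x
    | Data.cons _ _ => e.val x
  | call _ _ => Data.nil

/-- The number of nodes of the expression; it bounds the number of steps of an evaluation without
calls. -/
def len : Exp → ℕ
  | arg => 1
  | nil => 1
  | cons e f => e.len + f.len + 1
  | hd e => e.len + 1
  | tl e => e.len + 1
  | ite c e f => c.len + e.len + f.len + 1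
  | call _ e => e.len + 1

theorem runs_val (P : Prog) (x : Data) :
    ∀ e : Exp, e.callFree = true → Runs P x e (e.val x) e.len
  | arg, _ => Runs.arg
  | nil, _ => Runs.nil
  | cons e f, h => by
    simp only [callFree, Bool.and_eq_true] at h
    exact (runs_val P x e h.1).cons (runs_val P x f h.2)
  | hd e, h => (runs_val P x e h).hd
  | tl e, h => (runs_val P x e h).tl
  | ite c e f, h => by
    simp only [callFree, Bool.and_eq_true] at h
    have hc := runs_val P x c h.1.1
    have he := runs_val P x e h.1.2
    have hf := runs_val P x f h.2
    simp only [val, len]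
    cases hv : c.val x with
    | nil =>
      rw [hv] at hc
      exact (hc.iteFalse hf).mono (by omega)
    | cons y z =>
      rw [hv] at hc
      exact (hc.iteTrue he).mono (by omega)
  | call _ _, h => by simp [callFree] at h

theorem size_val_le (x : Data) : ∀ e : Exp, (e.val x).size ≤ e.len * (x.size + 1)
  | arg => by simp [val, len]
  | nil => by simp [val, len, Data.size]
  | cons e f => by
    have := size_val_le x e
    have := size_val_le x f
    simp only [val, len, Data.size, add_mul]; omega
  | hd e => by
    have := size_val_le x e
    have := (e.val x).size_hd_le
    simp only [val, len, add_mul]; omega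
  | tl e => by
    have := size_val_le x e
    have := (e.val x).size_tl_le
    simp only [val, len, add_mul]; omega
  | ite c e f => by
    have := size_val_le x e
    have := size_val_le x f
    simp only [val, len, add_mul]
    split <;> omega
  | call _ _ => by
    simp only [val, len, Data.size, add_mul]; omega

/-- A constant as an expression. -/
def quote : Data → Exp
  | Data.nil => nil
  | Data.cons x y => cons (quote x) (quote y)

@[simp]
theorem callFree_quote : ∀ d, (quote d).callFree = true
  | Data.nil => rfl
  | Data.cons x y => by simp [quote, callFree, callFree_quote x, callFree_quote y]

@[simp]
theorem val_quote (x : Data) : ∀ d, (quote d).val x = d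
  | Data.nil => rfl
  | Data.cons y z => by simp [quote, val, val_quote x y, val_quote x z]

end Exp

/-- Functions given by a call-free expression. -/
theorem PolyTime.of_exp {f : α → β} (e : Exp) (he : e.callFree = true)
    (h : ∀ a, e.val (Enc.enc a) = Enc.enc (f a)) : PolyTime f := by
  refine ⟨Polynomial.C e.len * (Polynomial.X + 1) + 2, fun a => ?_, [e], fun a => ?_⟩
  · have := Exp.size_val_le (Enc.enc a) e
    rw [h] at this
    simp only [sz, Polynomial.eval_add, Polynomial.eval_mul, Polynomial.eval_C, Polynomial.eval_X,
      Polynomial.eval_one, Polynomial.eval_ofNat]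
    omega
  · have h1 := Exp.runs_val [e] (Enc.enc a) e he
    rw [h] at h1
    refine (Runs.call Runs.arg rfl h1).mono ?_
    simp only [sz, Polynomial.eval_add, Polynomial.eval_mul, Polynomial.eval_C, Polynomial.eval_X,
      Polynomial.eval_one, Polynomial.eval_ofNat]
    nlinarith

instance : Enc Bool := ⟨fun b => if b then Data.cons Data.nil Data.nil else Data.nil⟩

instance : Enc ℕ := ⟨Data.ofNat⟩

instance : Enc (α × β) := ⟨fun p => Data.cons (Enc.enc p.1) (Enc.enc p.2)⟩

instance : Enc (List α) := ⟨fun l => Data.ofList (l.map Enc.enc)⟩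

theorem enc_pair (a : α) (b : β) : Enc.enc (a, b) = Data.cons (Enc.enc a) (Enc.enc b) := rfl

theorem enc_nil : Enc.enc ([] : List α) = Data.nil := rfl

theorem enc_cons (a : α) (l : List α) :
    Enc.enc (a :: l) = Data.cons (Enc.enc a) (Enc.enc l) := rfl

theorem enc_succ (n : ℕ) : Enc.enc (n + 1) = Data.cons Data.nil (Enc.enc n) := rfl

theorem enc_true : Enc.enc true = Data.cons Data.nil Data.nil := rfl

theorem enc_false : Enc.enc false = Data.nil := rfl

theorem sz_pair (a : α) (b : β) : sz (a, b) = sz a + sz b + 1 := rfl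

theorem sz_nil : sz ([] : List α) = 1 := rfl

theorem sz_cons (a : α) (l : List α) : sz (a :: l) = sz a + sz l + 1 := rfl

theorem sz_succ (n : ℕ) : sz (n + 1) = sz n + 2 := by
  simp [sz, enc_succ, Data.size]; omega

theorem sz_nat (n : ℕ) : sz n = 2 * n + 1 := by
  induction n with
  | zero => rfl
  | succ n ih => rw [sz_succ, ih]; omega

theorem sz_bool_le (b : Bool) : sz b ≤ 3 := by
  cases b <;> simp [sz, enc_true, enc_false, Data.size]

namespace PolyTime

@[fun_prop]
theorem id' : PolyTime (fun a : α => a) := of_exp Exp.arg rfl fun _ => rfl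

@[fun_prop]
theorem const (b : β) : PolyTime (fun _ : α => b) :=
  of_exp (Exp.quote (Enc.enc b)) (by simp) (by simp)

@[fun_prop]
theorem comp {f : β → γ} {g : α → β} (hf : PolyTime f) (hg : PolyTime g) :
    PolyTime (fun a => f (g a)) := by
  obtain ⟨R, i, j, q, hf1, hg1, h⟩ := hf.link hg 1
  refine ⟨q + q.comp q + 2, fun a => ?_, Exp.call i (Exp.call j Exp.arg) :: R, fun a => ?_⟩
  · have := hf1 (g a)
    have := eval_mono q (hg1 a)
    simp; omega
  · obtain ⟨hf2, hg2⟩ := h [Exp.call i (Exp.call j Exp.arg)] rfl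
    refine (Runs.call Runs.arg rfl ((hg2 a).app (hf2 _))).mono ?_
    have := eval_mono q (hg1 a)
    simp; omega

@[fun_prop]
theorem pair {f : α → β} {g : α → γ} (hf : PolyTime f) (hg : PolyTime g) :
    PolyTime (fun a => (f a, g a)) := by
  obtain ⟨R, i, j, q, hf1, hg1, h⟩ := hf.link hg 1
  refine ⟨2 * q + 3, fun a => ?_,
    Exp.cons (Exp.call i Exp.arg) (Exp.call j Exp.arg) :: R, fun a => ?_⟩
  · have := hf1 a
    have := hg1 a
    simp [sz_pair]; omega
  · obtain ⟨hf2, hg2⟩ := h [Exp.cons (Exp.call i Exp.arg) (Exp.call j Exp.arg)] rfl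
    refine (Runs.call Runs.arg rfl ((hf2 a).cons (hg2 a))).mono ?_
    simp; omega

@[fun_prop]
theorem fst {f : α → β × γ} (hf : PolyTime f) : PolyTime (fun a => (f a).1) :=
  comp (f := Prod.fst) (of_exp (Exp.hd Exp.arg) rfl fun _ => rfl) hf

@[fun_prop]
theorem snd {f : α → β × γ} (hf : PolyTime f) : PolyTime (fun a => (f a).2) :=
  comp (f := Prod.snd) (of_exp (Exp.tl Exp.arg) rfl fun _ => rfl) hf

@[fun_prop]
theorem cond {b : α → Bool} {f g : α → β} (hb : PolyTime b) (hf : PolyTime f) (hg : PolyTime g) :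
    PolyTime (fun a => bif b a then f a else g a) := by
  refine comp (f := fun p : Bool × β × β => bif p.1 then p.2.1 else p.2.2)
    (of_exp (Exp.ite (Exp.hd Exp.arg) (Exp.hd (Exp.tl Exp.arg)) (Exp.tl (Exp.tl Exp.arg))) rfl ?_)
    (hb.pair (hf.pair hg))
  rintro ⟨_ | _, x, y⟩ <;> rfl

@[fun_prop]
theorem and {f g : α → Bool} (hf : PolyTime f) (hg : PolyTime g) :
    PolyTime (fun a => f a && g a) := by
  have h : PolyTime (fun a => bif f a then g a else false) := by fun_prop
  refine (congrArg PolyTime (funext fun a => ?_)).mp h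
  cases f a <;> rfl

@[fun_prop]
theorem or {f g : α → Bool} (hf : PolyTime f) (hg : PolyTime g) :
    PolyTime (fun a => f a || g a) := by
  have h : PolyTime (fun a => bif f a then true else g a) := by fun_prop
  refine (congrArg PolyTime (funext fun a => ?_)).mp h
  cases f a <;> rfl

@[fun_prop]
theorem not {f : α → Bool} (hf : PolyTime f) : PolyTime (fun a => !f a) := by
  have h : PolyTime (fun a => bif f a then false else true) := by fun_prop
  refine (congrArg PolyTime (funext fun a => ?_)).mp h
  cases f a <;> rfl

theorem of_eq {f g : α → β} (hf : PolyTime f) (h : ∀ a, f a = g a) : PolyTime g :=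
  (funext h : f = g) ▸ hf

end PolyTime

theorem sz_map_le {l : List α} {f : α → β} {B : ℕ} (h : ∀ a ∈ l, sz (f a) ≤ B) :
    sz (l.map f) ≤ sz l * (B + 1) := by
  induction l with
  | nil => simp [sz_nil]
  | cons a l ih =>
    have h1 := ih fun b hb => h b (by simp [hb])
    have h2 := h a (by simp)
    have h3 := sz_pos a
    rw [List.map_cons, sz_cons, sz_cons]
    nlinarith

/-- Recursion: to evaluate `F` at `a`, a step computes a list of smaller arguments, and the values
of `F` at these arguments are combined. The measure `μ` bounds the number of recursive calls. The
bound on the size of the values is a hypothesis, because iteration could make them grow. -/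
theorem PolyTime.recursion {step : α → δ × List α} {comb : δ × List β → β} {F : α → β}
    (hs : PolyTime step) (hc : PolyTime comb)
    (hF : ∀ a, F a = comb ((step a).1, (step a).2.map F)) (μ : α → ℕ)
    (hμ : ∀ a, ((step a).2.map μ).sum < μ a) (p : Polynomial ℕ) (hp : ∀ a, μ a ≤ p.eval (sz a))
    (hsz : ∀ a, ∀ b ∈ (step a).2, sz b ≤ sz a) (r : Polynomial ℕ)
    (hr : ∀ a, sz (F a) ≤ r.eval (sz a)) : PolyTime F := by
  obtain ⟨R, i, j, q, hs1, hc1, h⟩ := hs.link hc 3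
  -- function `0` is `F`, function `1` combines the result of a step, and function `2` is `List.map F`
  let Q : Prog := [Exp.call 1 (Exp.call i Exp.arg),
    Exp.call j (Exp.cons (Exp.hd Exp.arg) (Exp.call 2 (Exp.tl Exp.arg))),
    Exp.ite Exp.arg (Exp.cons (Exp.call 0 (Exp.hd Exp.arg)) (Exp.call 2 (Exp.tl Exp.arg))) Exp.nil]
  obtain ⟨hs2, hc2⟩ := h Q rfl
  -- `K` bounds the cost of a call without the costs of its recursive calls
  let K : Polynomial ℕ := 11 * q + q.comp (q + q * (r + 1) + 1) + 12
  have key : ∀ B m a, μ a ≤ m → sz a ≤ B →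
      Runs (Q ++ R) (Enc.enc a) (Exp.call 0 Exp.arg) (Enc.enc (F a)) (K.eval B * μ a) := by
    intro B m
    induction m with
    | zero =>
      intro a ha
      have := hμ a
      omega
    | succ m ih =>
      intro a ha haB
      have hlist : ∀ l : List α, (l.map μ).sum ≤ m → (∀ b ∈ l, sz b ≤ B) →
          Runs (Q ++ R) (Enc.enc l) (Exp.call 2 Exp.arg) (Enc.enc (l.map F))
            (K.eval B * (l.map μ).sum + 10 * sz l) := by
        intro l
        induction l with
        | nil =>
          intro _ _
          refine (Runs.call Runs.arg rfl (Runs.iteFalse Runs.arg Runs.nil)).mono ?_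
          simp [sz_nil]
        | cons b l ihl =>
          intro hm hB
          rw [List.map_cons, List.sum_cons] at hm
          have h1 := ih b (by omega) (hB b (by simp))
          have h2 := ihl (by omega) fun c hc => hB c (by simp [hc])
          refine (Runs.call Runs.arg rfl (Runs.iteTrue Runs.arg
            (Runs.cons (Runs.app (Runs.hd Runs.arg) h1) (Runs.app (Runs.tl Runs.arg) h2)))).mono ?_
          have := sz_pos b
          rw [List.map_cons, List.sum_cons, sz_cons]
          nlinarith
      have hstep := hs1 a
      have hq := eval_mono q haB
      have hl := hlist (step a).2 (by have := hμ a; omega) fun b hb => (hsz a b hb).trans haB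
      have h1 : sz (step a).1 + sz (step a).2 ≤ q.eval B := by
        have : sz (step a) = sz (step a).1 + sz (step a).2 + 1 := sz_pair _ _
        omega
      have h2 : sz ((step a).2.map F) ≤ q.eval B * (r.eval B + 1) :=
        (sz_map_le fun b hb => (hr b).trans (eval_mono r ((hsz a b hb).trans haB))).trans
          (Nat.mul_le_mul_right _ (by omega))
      have h3 : sz ((step a).1, (step a).2.map F) ≤ q.eval B + q.eval B * (r.eval B + 1) + 1 := by
        rw [sz_pair]
        omega
      have h4 := eval_mono q h3
      have hbody := Runs.app (Runs.cons (x := Enc.enc (step a)) (Runs.hd Runs.arg)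
        (Runs.app (Runs.tl Runs.arg) hl)) (hc2 ((step a).1, (step a).2.map F))
      rw [← hF a] at hbody
      refine (Runs.call Runs.arg rfl (Runs.call (hs2 a) rfl hbody)).mono ?_
      have h5 : K.eval B = 11 * q.eval B
          + q.eval (q.eval B + q.eval B * (r.eval B + 1) + 1) + 12 := by
        simp [K, Polynomial.eval_comp]
      have h6 : K.eval B * (((step a).2.map μ).sum + 1) ≤ K.eval B * μ a :=
        Nat.mul_le_mul_left _ (hμ a)
      rw [mul_add, mul_one] at h6
      omega
  clear_value K
  refine ⟨r + K * p, fun a => ?_, Q ++ R, fun a => (key (sz a) (μ a) a le_rfl le_rfl).mono ?_⟩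
  · have := hr a
    simp only [Polynomial.eval_add]
    omega
  · have := Nat.mul_le_mul_left (K.eval (sz a)) (hp a)
    rw [Polynomial.eval_add, Polynomial.eval_mul]
    omega

end XPathSat

/-! ### Polynomial time functions on numbers and lists -/

namespace XPathSat

variable {α β γ δ : Type} [Enc α] [Enc β] [Enc γ] [Enc δ]

namespace PolyTime

@[fun_prop]
theorem listCons {f : γ → α} {g : γ → List α} (hf : PolyTime f) (hg : PolyTime g) :
    PolyTime (fun c => f c :: g c) :=
  comp (f := fun p : α × List α => p.1 :: p.2) (of_exp Exp.arg rfl fun _ => rfl) (hf.pair hg)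

@[fun_prop]
theorem isEmpty {g : γ → List α} (hg : PolyTime g) : PolyTime (fun c => (g c).isEmpty) :=
  comp (of_exp (Exp.ite Exp.arg Exp.nil (Exp.quote (Enc.enc true))) rfl
    fun l => by cases l <;> rfl) hg

@[fun_prop]
theorem headI [Inhabited α] {g : γ → List α} (hg : PolyTime g) :
    PolyTime (fun c => (g c).headI) :=
  comp (of_exp (Exp.ite Exp.arg (Exp.hd Exp.arg) (Exp.quote (Enc.enc (default : α))))
    (by simp [Exp.callFree]) fun l => by cases l <;> simp [Exp.val, enc_nil, enc_cons, Data.hd]) hg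

@[fun_prop]
theorem tail {g : γ → List α} (hg : PolyTime g) : PolyTime (fun c => (g c).tail) :=
  comp (of_exp (Exp.tl Exp.arg) rfl fun l => by cases l <;> rfl) hg

/-- Recursion over a list with a parameter. -/
theorem listRec [Inhabited α] [Inhabited β] {F : γ → List α → β} {g : γ → β}
    {h : γ × α × List α × β → β} (hg : PolyTime g) (hh : PolyTime h)
    (h_nil : ∀ c, F c [] = g c) (h_cons : ∀ c a l, F c (a :: l) = h (c, a, l, F c l))
    (r : Polynomial ℕ) (hr : ∀ c l, sz (F c l) ≤ r.eval (sz (c, l))) :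
    PolyTime (fun p : γ × List α => F p.1 p.2) := by
  refine recursion
    (step := fun p : γ × List α => (p, bif p.2.isEmpty then [] else [(p.1, p.2.tail)]))
    (comb := fun p : (γ × List α) × List β => bif p.1.2.isEmpty then g p.1.1
      else h (p.1.1, p.1.2.headI, p.1.2.tail, p.2.headI))
    (by fun_prop) (by fun_prop) ?_ (fun p => sz p.2) ?_ Polynomial.X ?_ ?_ r fun p => hr _ _
  · rintro ⟨c, _ | ⟨a, l⟩⟩ <;> simp [h_nil, h_cons]
  · rintro ⟨c, _ | ⟨a, l⟩⟩ <;> simp [sz_nil, sz_cons]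
  · rintro ⟨c, l⟩
    simp [sz_pair]; omega
  · rintro ⟨c, _ | ⟨a, l⟩⟩
    · simp
    · simp [sz_cons, sz_pair]; omega

@[fun_prop]
theorem natEq {f g : γ → ℕ} (hf : PolyTime f) (hg : PolyTime g) :
    PolyTime (fun c => decide (f c = g c)) := by
  refine comp (f := fun p : ℕ × ℕ => decide (p.1 = p.2)) ?_ (hf.pair hg)
  refine recursion
    (step := fun p : ℕ × ℕ => (p, match p with | (a + 1, b + 1) => [(a, b)] | _ => []))
    (comb := fun p : (ℕ × ℕ) × List Bool => match p with
      | ((0, 0), _) => true | ((_ + 1, _ + 1), b :: _) => b | _ => false)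
    (of_exp (Exp.cons Exp.arg (Exp.ite (Exp.hd Exp.arg) (Exp.ite (Exp.tl Exp.arg)
      (Exp.cons (Exp.cons (Exp.tl (Exp.hd Exp.arg)) (Exp.tl (Exp.tl Exp.arg))) Exp.nil)
      Exp.nil) Exp.nil)) rfl ?_)
    (of_exp (Exp.ite (Exp.hd (Exp.hd Exp.arg))
      (Exp.ite (Exp.tl (Exp.hd Exp.arg)) (Exp.hd (Exp.tl Exp.arg)) Exp.nil)
      (Exp.ite (Exp.tl (Exp.hd Exp.arg)) Exp.nil (Exp.quote (Enc.enc true)))) rfl ?_)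
    ?_ (fun p => sz p.1) ?_ Polynomial.X ?_ ?_ 3 fun _ => (sz_bool_le _).trans (by simp)
  · rintro ⟨_ | a, _ | b⟩ <;> rfl
  · rintro ⟨⟨_ | a, _ | b⟩, _ | ⟨_ | _, l⟩⟩ <;> rfl
  · rintro ⟨_ | a, _ | b⟩ <;> simp
  · rintro ⟨_ | a, _ | b⟩ <;> simp [sz_nat]
  · rintro ⟨a, b⟩
    simp [sz_pair]; omega
  · rintro ⟨_ | a, _ | b⟩ <;> simp [sz_pair, sz_nat]; omega

@[fun_prop]
theorem natLt {f g : γ → ℕ} (hf : PolyTime f) (hg : PolyTime g) :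
    PolyTime (fun c => decide (f c < g c)) := by
  refine comp (f := fun p : ℕ × ℕ => decide (p.1 < p.2)) ?_ (hf.pair hg)
  refine recursion
    (step := fun p : ℕ × ℕ => (p, match p with | (a + 1, b + 1) => [(a, b)] | _ => []))
    (comb := fun p : (ℕ × ℕ) × List Bool => match p with
      | ((0, _ + 1), _) => true | ((_ + 1, _ + 1), b :: _) => b | _ => false)
    (of_exp (Exp.cons Exp.arg (Exp.ite (Exp.hd Exp.arg) (Exp.ite (Exp.tl Exp.arg)
      (Exp.cons (Exp.cons (Exp.tl (Exp.hd Exp.arg)) (Exp.tl (Exp.tl Exp.arg))) Exp.nil)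
      Exp.nil) Exp.nil)) rfl ?_)
    (of_exp (Exp.ite (Exp.tl (Exp.hd Exp.arg))
      (Exp.ite (Exp.hd (Exp.hd Exp.arg)) (Exp.hd (Exp.tl Exp.arg)) (Exp.quote (Enc.enc true)))
      Exp.nil) rfl ?_)
    ?_ (fun p => sz p.1) ?_ Polynomial.X ?_ ?_ 3 fun _ => (sz_bool_le _).trans (by simp)
  · rintro ⟨_ | a, _ | b⟩ <;> rfl
  · rintro ⟨⟨_ | a, _ | b⟩, _ | ⟨_ | _, l⟩⟩ <;> rfl
  · rintro ⟨_ | a, _ | b⟩ <;> simp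
  · rintro ⟨_ | a, _ | b⟩ <;> simp [sz_nat]
  · rintro ⟨a, b⟩
    simp [sz_pair]; omega
  · rintro ⟨_ | a, _ | b⟩ <;> simp [sz_pair, sz_nat]; omega

@[fun_prop]
theorem natSucc {f : γ → ℕ} (hf : PolyTime f) : PolyTime (fun c => f c + 1) :=
  comp (f := fun n : ℕ => n + 1) (of_exp (Exp.cons Exp.nil Exp.arg) rfl fun _ => rfl) hf

@[fun_prop]
theorem any [Inhabited α] {p : γ → α → Bool} {l : γ → List α}
    (hp : PolyTime (fun x : γ × α => p x.1 x.2)) (hl : PolyTime l) :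
    PolyTime (fun c => (l c).any (fun a => p c a)) := by
  refine comp (f := fun x : γ × List α => x.2.any (p x.1)) ?_ ((id' (α := γ)).pair hl)
  refine listRec (F := fun c l => l.any (p c)) (g := fun _ => false)
    (h := fun x => p x.1 x.2.1 || x.2.2.2) (by fun_prop) ?_ (fun _ => rfl) (fun _ _ _ => rfl) 3
    fun _ _ => (sz_bool_le _).trans (by simp)
  exact or (comp hp (by fun_prop : PolyTime fun x : γ × α × List α × Bool => (x.1, x.2.1)))
    (by fun_prop)

@[fun_prop]
theorem all [Inhabited α] {p : γ → α → Bool} {l : γ → List α}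
    (hp : PolyTime (fun x : γ × α => p x.1 x.2)) (hl : PolyTime l) :
    PolyTime (fun c => (l c).all (fun a => p c a)) := by
  refine of_eq (not (any (p := fun c a => !p c a) (not hp) hl)) fun c => ?_
  rw [Bool.eq_iff_iff]
  simp

theorem _root_.XPathSat.sz_filter_le (p : α → Bool) (l : List α) : sz (l.filter p) ≤ sz l := by
  induction l with
  | nil => simp
  | cons a l ih =>
    rw [List.filter_cons]
    split <;> simp only [sz_cons] <;> omega

@[fun_prop]
theorem filter [Inhabited α] {p : γ → α → Bool} {l : γ → List α}
    (hp : PolyTime (fun x : γ × α => p x.1 x.2)) (hl : PolyTime l) :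
    PolyTime (fun c => (l c).filter (fun a => p c a)) := by
  refine comp (f := fun x : γ × List α => x.2.filter (p x.1)) ?_ ((id' (α := γ)).pair hl)
  refine listRec (F := fun c l => l.filter (p c)) (g := fun _ => [])
    (h := fun x => bif p x.1 x.2.1 then x.2.1 :: x.2.2.2 else x.2.2.2) (by fun_prop) ?_
    (fun _ => rfl) (fun c a l => ?_) Polynomial.X
    fun c l => (sz_filter_le _ _).trans (by simp [sz_pair]; omega)
  · exact cond (comp hp (by fun_prop : PolyTime fun x : γ × α × List α × List α => (x.1, x.2.1)))
      (by fun_prop) (by fun_prop)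
  · rw [List.filter_cons]
    cases p c a <;> rfl

@[fun_prop]
theorem contains {f : γ → ℕ} {l : γ → List ℕ} (hf : PolyTime f) (hl : PolyTime l) :
    PolyTime (fun c => decide (f c ∈ l c)) := by
  have : PolyTime (fun c => (l c).any fun a => decide (f c = a)) := by fun_prop
  refine this.of_eq fun c => ?_
  rw [Bool.eq_iff_iff]
  simp

theorem _root_.XPathSat.sz_append (l l' : List α) : sz (l ++ l') + 1 = sz l + sz l' := by
  induction l with
  | nil => simp [sz_nil]; omega
  | cons a l ih =>
    simp only [List.cons_append, sz_cons]
    omega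

@[fun_prop]
theorem append [Inhabited α] {l l' : γ → List α} (hl : PolyTime l) (hl' : PolyTime l') :
    PolyTime (fun c => l c ++ l' c) := by
  refine comp (f := fun x : List α × List α => x.2 ++ x.1) ?_ (hl'.pair hl)
  refine listRec (F := fun c l => l ++ c) (g := fun c => c) (h := fun x => x.2.1 :: x.2.2.2)
    (by fun_prop) (by fun_prop) (fun _ => rfl) (fun _ _ _ => rfl) Polynomial.X fun c l => ?_
  have := sz_append l c
  simp [sz_pair]; omega

theorem _root_.XPathSat.sz_le_of_mem {a : α} {l : List α} (h : a ∈ l) : sz a ≤ sz l := by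
  induction l with
  | nil => simp at h
  | cons b l ih =>
    rw [sz_cons]
    rcases List.mem_cons.1 h with rfl | h
    · omega
    · have := ih h
      omega

@[fun_prop]
theorem map [Inhabited α] [Inhabited β] {f : γ → α → β} {l : γ → List α}
    (hf : PolyTime (fun x : γ × α => f x.1 x.2)) (hl : PolyTime l) :
    PolyTime (fun c => (l c).map (fun a => f c a)) := by
  refine comp (f := fun x : γ × List α => x.2.map (f x.1)) ?_ ((id' (α := γ)).pair hl)
  obtain ⟨q, hq, -⟩ := id hf
  refine listRec (F := fun c l => l.map (f c)) (g := fun _ => [])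
    (h := fun x => f x.1 x.2.1 :: x.2.2.2) (by fun_prop) ?_ (fun _ => rfl) (fun _ _ _ => rfl)
    (Polynomial.X * (q + 1)) fun c l => ?_
  · exact listCons
      (comp hf (by fun_prop : PolyTime fun x : γ × α × List α × List β => (x.1, x.2.1)))
      (by fun_prop)
  · refine (sz_map_le (B := q.eval (sz (c, l))) fun a ha =>
      (hq (c, a)).trans (eval_mono q ?_)).trans ?_
    · have := sz_le_of_mem ha
      simp only [sz_pair]
      omega
    · simp only [Polynomial.eval_mul, Polynomial.eval_X, Polynomial.eval_add, Polynomial.eval_one]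
      refine Nat.mul_le_mul_right _ ?_
      rw [sz_pair]
      omega

theorem _root_.XPathSat.sz_flatten_le (l : List (List α)) : sz l.flatten ≤ sz l := by
  induction l with
  | nil => simp [sz_nil]
  | cons a l ih =>
    have := sz_append a l.flatten
    simp only [List.flatten_cons, sz_cons]
    omega

@[fun_prop]
theorem flatten [Inhabited α] {l : γ → List (List α)} (hl : PolyTime l) :
    PolyTime (fun c => (l c).flatten) := by
  refine comp (f := fun x : Bool × List (List α) => x.2.flatten) ?_ ((const false).pair hl)
  refine listRec (F := fun _ l => l.flatten) (g := fun _ => []) (h := fun x => x.2.1 ++ x.2.2.2)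
    (by fun_prop) (by fun_prop) (fun _ => rfl) (fun _ _ _ => rfl) Polynomial.X fun c l => ?_
  have := sz_flatten_le l
  simp [sz_pair]; omega

/-- The entry with number `i` of a list, by recursion on both. -/
@[fun_prop]
theorem getD [Inhabited α] {l : γ → List α} {i : γ → ℕ} {d : α} (hl : PolyTime l)
    (hi : PolyTime i) : PolyTime (fun c => (l c).getD (i c) d) := by
  refine comp (f := fun x : List α × ℕ => x.1.getD x.2 d) ?_ (hl.pair hi)
  refine recursion
    (step := fun p : List α × ℕ => (p.1, match p with | (_ :: l, n + 1) => [(l, n)] | _ => []))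
    (comb := fun p : List α × List α => match p with
      | ([], _) => d | (a :: _, []) => a | (_ :: _, b :: _) => b)
    (of_exp (Exp.cons (Exp.hd Exp.arg) (Exp.ite (Exp.hd Exp.arg) (Exp.ite (Exp.tl Exp.arg)
      (Exp.cons (Exp.cons (Exp.tl (Exp.hd Exp.arg)) (Exp.tl (Exp.tl Exp.arg))) Exp.nil)
      Exp.nil) Exp.nil)) rfl ?_)
    (of_exp (Exp.ite (Exp.hd Exp.arg)
      (Exp.ite (Exp.tl Exp.arg) (Exp.hd (Exp.tl Exp.arg)) (Exp.hd (Exp.hd Exp.arg)))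
      (Exp.quote (Enc.enc d))) (by simp [Exp.callFree]) ?_)
    ?_ (fun p => sz p.1) ?_ Polynomial.X ?_ ?_
    (Polynomial.X + Polynomial.C (sz d)) ?_
  · rintro ⟨_ | ⟨a, l⟩, _ | n⟩ <;> rfl
  · rintro ⟨_ | ⟨a, l⟩, _ | ⟨b, l'⟩⟩
    · simp [Exp.val, enc_pair, enc_nil, Data.hd]
    · simp [Exp.val, enc_pair, enc_nil, Data.hd]
    · rfl
    · rfl
  · rintro ⟨_ | ⟨a, l⟩, _ | n⟩ <;> simp
  · rintro ⟨_ | ⟨a, l⟩, _ | n⟩ <;> simp [sz_nil, sz_cons]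
  · rintro ⟨a, b⟩
    simp [sz_pair]; omega
  · rintro ⟨_ | ⟨a, l⟩, _ | n⟩ <;> simp [sz_pair, sz_nat, sz_cons]; omega
  · rintro ⟨l, n⟩
    have : sz (l.getD n d) ≤ sz l + sz d := by
      induction l generalizing n with
      | nil => simp
      | cons a l ih =>
        cases n with
        | zero => simp [sz_cons]; omega
        | succ n =>
          have := ih n
          simp only [List.getD_cons_succ, sz_cons]
          omega
    simp only [sz_pair, Polynomial.eval_add, Polynomial.eval_X, Polynomial.eval_C]
    omega

end PolyTime

end XPathSat

/-! ### Regular expressions: symbols, atoms and conflicts -/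

namespace XPathSat

namespace RegEx

variable {n : ℕ}

/-- The labels that occur in `e`, as numbers. -/
def labels (e : RegEx (Fin n)) : List ℕ := e.symbols.map Fin.val

/-- The labels that occur in `e` outside the scope of any `*` and `+`, as numbers. -/
def outerLabels (e : RegEx (Fin n)) : List ℕ := e.outerSymbols.map Fin.val

mutual
/-- The atoms of `e` from left to right: the occurrences of symbols outside the scope of any `*` and
`+`, with the flag `false`, and the maximal subexpressions `f*` and `f+`, with the flag `true`; each
of them with the list of its labels. -/
def atoms : RegEx (Fin n) → List (Bool × List ℕ)
  | eps => []
  | sym a => [(false, [a.val])]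
  | cat e f => atoms e ++ atoms f
  | alt e f => atoms e ++ atoms f
  | star e => [(true, e.labels)]
  | opt e => atoms e
  | plus e => [(true, e.labels)]
  | hash es fs => atomsList es ++ atomsList fs
def atomsList : List (RegEx (Fin n)) → List (Bool × List ℕ)
  | [] => []
  | e :: es => atoms e ++ atomsList es
end

mutual
/-- The labels `l` and `l'` occur in the first and second argument, respectively, of a disjunction
outside the scope of any `*` and `+`. The operator `#` causes no conflicts: the first alternative of
`(e₁,…,eₘ)#(f₁,…,fₗ)` already has words with symbols of all arguments. -/
def conflict (l l' : ℕ) : RegEx (Fin n) → Bool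
  | eps => false
  | sym _ => false
  | cat e f => conflict l l' e || conflict l l' f
  | alt e f => (decide (l ∈ e.labels) && decide (l' ∈ f.labels)) ||
      (conflict l l' e || conflict l l' f)
  | star _ => false
  | opt e => conflict l l' e
  | plus _ => false
  | hash es fs => conflictList l l' es || conflictList l l' fs
def conflictList (l l' : ℕ) : List (RegEx (Fin n)) → Bool
  | [] => false
  | e :: es => conflict l l' e || conflictList l l' es
end

/-- The arguments of the outermost operator. -/
def children : RegEx (Fin n) → List (RegEx (Fin n))
  | eps => []
  | sym _ => []
  | cat e f => [e, f]
  | alt e f => [e, f]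
  | star e => [e]
  | opt e => [e]
  | plus e => [e]
  | hash es fs => es ++ fs

end RegEx

/-- Regular expressions over the labels below some number. -/
abbrev AnyRegEx : Type := Σ n, RegEx (Fin n)

instance : Enc AnyRegEx := ⟨fun e => e.2.encode⟩

instance : Inhabited AnyRegEx := ⟨⟨0, RegEx.eps⟩⟩

namespace AnyRegEx

theorem enc_list {n : ℕ} : ∀ es : List (RegEx (Fin n)),
    Enc.enc (es.map (Sigma.mk n) : List AnyRegEx) = RegEx.encodeList es
  | [] => rfl
  | e :: es => by
    rw [List.map_cons, enc_cons, enc_list es, RegEx.encodeList]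
    rfl

/-- The number of the constructor. -/
def kind (e : AnyRegEx) : ℕ :=
  match e.2 with
  | RegEx.eps => 0
  | RegEx.sym _ => 1
  | RegEx.cat _ _ => 2
  | RegEx.alt _ _ => 3
  | RegEx.star _ => 4
  | RegEx.opt _ => 5
  | RegEx.plus _ => 6
  | RegEx.hash _ _ => 7

/-- The label of a symbol. -/
def label (e : AnyRegEx) : ℕ :=
  match e.2 with
  | RegEx.sym a => a
  | _ => 0

/-- The two lists of arguments of the operator `#`. -/
def hashArgs (e : AnyRegEx) : List AnyRegEx × List AnyRegEx :=
  match e.2 with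
  | RegEx.hash es fs => (es.map (Sigma.mk e.1), fs.map (Sigma.mk e.1))
  | _ => ([], [])

def children (e : AnyRegEx) : List AnyRegEx := e.2.children.map (Sigma.mk e.1)

/-- The arguments of the operators other than `#`. -/
def args (e : AnyRegEx) : List AnyRegEx :=
  match e.2 with
  | RegEx.hash _ _ => []
  | _ => e.children

end AnyRegEx

/-- Case distinction on the value of `e` as a number, with a case for each of its first values; the
last case is for all larger values. -/
def Exp.natCases (e : Exp) : List Exp → Exp
  | [] => Exp.nil
  | [f] => f
  | f :: fs => Exp.ite e (natCases (Exp.tl e) fs) f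

namespace PolyTime

variable {α β γ δ : Type} [Enc α] [Enc β] [Enc γ] [Enc δ]

@[fun_prop]
theorem regExKind {f : γ → AnyRegEx} (hf : PolyTime f) : PolyTime (fun c => (f c).kind) := by
  refine comp (f := AnyRegEx.kind) (of_exp (Exp.hd Exp.arg) rfl ?_) hf
  rintro ⟨n, _ | _ | _ | _ | _ | _ | _ | _⟩ <;> rfl

@[fun_prop]
theorem regExLabel {f : γ → AnyRegEx} (hf : PolyTime f) : PolyTime (fun c => (f c).label) := by
  refine comp (f := AnyRegEx.label) (of_exp
    (Exp.natCases (Exp.hd Exp.arg) [Exp.nil, Exp.tl Exp.arg, Exp.nil]) rfl ?_) hf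
  rintro ⟨n, _ | _ | _ | _ | _ | _ | _ | _⟩ <;> rfl

@[fun_prop]
theorem regExHashArgs {f : γ → AnyRegEx} (hf : PolyTime f) :
    PolyTime (fun c => (f c).hashArgs) := by
  refine comp (f := AnyRegEx.hashArgs) (of_exp
    (Exp.natCases (Exp.hd Exp.arg) (List.replicate 7 (Exp.cons Exp.nil Exp.nil) ++
      [Exp.tl Exp.arg])) rfl ?_) hf
  rintro ⟨n, _ | _ | _ | _ | _ | _ | _ | ⟨es, fs⟩⟩
  any_goals rfl
  exact (congrArg₂ Data.cons (AnyRegEx.enc_list es) (AnyRegEx.enc_list fs)).symm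

@[fun_prop]
theorem regExArgs {f : γ → AnyRegEx} (hf : PolyTime f) : PolyTime (fun c => (f c).args) := by
  refine comp (f := AnyRegEx.args) (of_exp
    (Exp.natCases (Exp.hd Exp.arg) ([Exp.nil, Exp.nil] ++
      List.replicate 2 (Exp.cons (Exp.hd (Exp.tl Exp.arg))
        (Exp.cons (Exp.tl (Exp.tl Exp.arg)) Exp.nil)) ++
      List.replicate 3 (Exp.cons (Exp.tl Exp.arg) Exp.nil) ++ [Exp.nil])) rfl ?_) hf
  rintro ⟨n, _ | _ | _ | _ | _ | _ | _ | ⟨es, fs⟩⟩ <;> rfl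

@[fun_prop]
theorem regExChildren {f : γ → AnyRegEx} (hf : PolyTime f) :
    PolyTime (fun c => (f c).children) := by
  have : PolyTime (fun c => (f c).args ++ ((f c).hashArgs.1 ++ (f c).hashArgs.2)) := by fun_prop
  refine this.of_eq fun c => ?_
  rcases f c with ⟨n, _ | _ | _ | _ | _ | _ | _ | ⟨es, fs⟩⟩
  all_goals simp [AnyRegEx.args, AnyRegEx.hashArgs, AnyRegEx.children, RegEx.children]

end PolyTime

namespace AnyRegEx

theorem sum_sz_lt {α : Type} [Enc α] (l : List α) : (l.map sz).sum < sz l := by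
  induction l with
  | nil => simp [sz_nil]
  | cons a l ih =>
    simp only [List.map_cons, List.sum_cons, sz_cons]
    omega

theorem sum_sz_children_lt (e : AnyRegEx) : (e.children.map sz).sum < sz e := by
  rcases e with ⟨n, e⟩
  cases e with
  | hash es fs =>
    have h1 := sum_sz_lt (es.map (Sigma.mk n) : List AnyRegEx)
    have h2 := sum_sz_lt (fs.map (Sigma.mk n) : List AnyRegEx)
    have h3 : sz (⟨n, RegEx.hash es fs⟩ : AnyRegEx) = sz (es.map (Sigma.mk n) : List AnyRegEx) +
        sz (fs.map (Sigma.mk n) : List AnyRegEx) + 17 := by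
      simp only [sz, enc_list]
      simp [Enc.enc, RegEx.encode, Data.size, Data.ofNat]
      omega
    simp only [children, RegEx.children, List.map_append, List.sum_append]
    omega
  | _ =>
    simp [children, RegEx.children, sz, Enc.enc, RegEx.encode, Data.size, Data.ofNat] <;> omega

theorem sz_children_lt {e f : AnyRegEx} (h : f ∈ e.children) : sz f < sz e :=
  (List.single_le_sum (by simp) _ (List.mem_map_of_mem h)).trans_lt e.sum_sz_children_lt

theorem induction {p : AnyRegEx → Prop} (h : ∀ e : AnyRegEx, (∀ f ∈ e.children, p f) → p e)
    (e : AnyRegEx) : p e := by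
  induction hn : sz e using Nat.strong_induction_on generalizing e with
  | _ n ih =>
    subst hn
    exact h e fun f hf => ih _ (sz_children_lt hf) f rfl

end AnyRegEx

namespace PolyTime

variable {α β γ δ : Type} [Enc α] [Enc β] [Enc γ] [Enc δ]

/-- Recursion over a regular expression with a parameter. -/
theorem regExRec [Inhabited γ] {F : γ → AnyRegEx → β} {h : γ × AnyRegEx × List β → β}
    (hh : PolyTime h)
    (hF : ∀ c e, F c e = h (c, e, e.children.map (F c)))
    (r : Polynomial ℕ) (hr : ∀ c e, sz (F c e) ≤ r.eval (sz (c, e))) :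
    PolyTime (fun p : γ × AnyRegEx => F p.1 p.2) := by
  refine recursion
    (step := fun p : γ × AnyRegEx => (p, p.2.children.map fun f => (p.1, f)))
    (comb := fun p : (γ × AnyRegEx) × List β => h (p.1.1, p.1.2, p.2))
    (by fun_prop) (by fun_prop) ?_ (fun p => sz p.2) ?_ Polynomial.X ?_ ?_ r fun p => hr _ _
  · rintro ⟨c, e⟩
    simp only [hF c e, List.map_map]
    rfl
  · rintro ⟨c, e⟩
    simpa [Function.comp_def] using e.sum_sz_children_lt
  · rintro ⟨c, e⟩
    simp [sz_pair]; omega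
  · rintro ⟨c, e⟩ x hx
    obtain ⟨f, hf, rfl⟩ := List.mem_map.1 hx
    have := AnyRegEx.sz_children_lt hf
    simp only [sz_pair] at *
    omega

theorem _root_.XPathSat.sz_flatten_map_le {l : List α} {F : α → List β}
    (h : ∀ a ∈ l, sz (F a) ≤ 2 * sz a) : sz (l.map F).flatten ≤ 2 * (l.map sz).sum + 1 := by
  induction l with
  | nil => simp [sz_nil]
  | cons a l ih =>
    have h1 := ih fun b hb => h b (by simp [hb])
    have h2 := h a (by simp)
    have h3 := sz_append (F a) (l.map F).flatten
    simp only [List.map_cons, List.flatten_cons, List.sum_cons]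
    omega

/-- Recursion for functions that are given by `g` at expressions with the property `p`, and that
concatenate their values at the arguments of the outermost operator of the other expressions. -/
theorem regExFlatten [Inhabited β] {F : AnyRegEx → List β} {p : AnyRegEx → Bool}
    {g : AnyRegEx → List β} (hp : PolyTime p) (hg : PolyTime g)
    (hF : ∀ e, F e = bif p e then g e else (e.children.map F).flatten)
    (hr : ∀ e, p e = true → sz (g e) ≤ 2 * sz e) : (∀ e, sz (F e) ≤ 2 * sz e) ∧ PolyTime F := by
  have hb : ∀ e, sz (F e) ≤ 2 * sz e := fun e => by
    induction e using AnyRegEx.induction with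
    | h e ih =>
      rw [hF]
      cases hpe : p e with
      | true => exact hr e hpe
      | false =>
        have := e.sum_sz_children_lt
        exact (sz_flatten_map_le ih).trans (by omega)
  refine ⟨hb, ?_⟩
  refine comp (f := fun x : Bool × AnyRegEx => F x.2)
    (regExRec (F := fun _ => F)
      (h := fun x => bif p x.2.1 then g x.2.1 else x.2.2.flatten) (by fun_prop) (fun _ e => hF e)
      (2 * Polynomial.X) fun c e => ?_) ((const false).pair id')
  have := hb e
  simp [sz_pair]; omega

theorem regExLabels_aux : (∀ e : AnyRegEx, sz e.2.labels ≤ 2 * sz e) ∧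
    PolyTime (fun e : AnyRegEx => e.2.labels) := by
  refine regExFlatten (p := fun e => decide (e.kind = 1)) (g := fun e => [e.label])
    (by fun_prop) (by fun_prop) ?_ ?_
  · have hl : ∀ (n : ℕ) (es : List (RegEx (Fin n))), (RegEx.symbolsList es).map Fin.val =
        (es.map fun e => e.labels).flatten := by
      intro n es
      induction es with
      | nil => rfl
      | cons e es ih => simp [RegEx.symbolsList, ih, RegEx.labels]
    rintro ⟨n, e⟩
    cases e <;> simp [AnyRegEx.kind, AnyRegEx.label, AnyRegEx.children, RegEx.children,
      RegEx.labels, RegEx.symbols, hl, Function.comp_def]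
  · rintro ⟨n, _ | a | _ | _ | _ | _ | _ | _⟩ h <;> simp [AnyRegEx.kind] at h
    simp [AnyRegEx.label, sz, Enc.enc, RegEx.encode, Data.size, Data.ofNat, Data.ofList]
    omega

@[fun_prop]
theorem regExLabels {f : γ → AnyRegEx} (hf : PolyTime f) : PolyTime (fun c => (f c).2.labels) :=
  comp (f := fun e : AnyRegEx => e.2.labels) regExLabels_aux.2 hf

@[fun_prop]
theorem regExOuterLabels {f : γ → AnyRegEx} (hf : PolyTime f) :
    PolyTime (fun c => (f c).2.outerLabels) := by
  refine comp (f := fun e : AnyRegEx => e.2.outerLabels) ?_ hf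
  refine (regExFlatten
    (p := fun e => decide (e.kind = 1) || (decide (e.kind = 4) || decide (e.kind = 6)))
    (g := fun e => bif decide (e.kind = 1) then [e.label] else [])
    (by fun_prop) (by fun_prop) ?_ ?_).2
  · have hl : ∀ (n : ℕ) (es : List (RegEx (Fin n))), (RegEx.outerSymbolsList es).map Fin.val =
        (es.map fun e => e.outerLabels).flatten := by
      intro n es
      induction es with
      | nil => rfl
      | cons e es ih => simp [RegEx.outerSymbolsList, ih, RegEx.outerLabels]
    rintro ⟨n, e⟩
    cases e <;> simp [AnyRegEx.kind, AnyRegEx.label, AnyRegEx.children, RegEx.children,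
      RegEx.outerLabels, RegEx.outerSymbols, hl, Function.comp_def]
  · rintro ⟨n, _ | a | _ | _ | _ | _ | _ | _⟩ h <;> simp [AnyRegEx.kind] at h
    · simp [AnyRegEx.label, AnyRegEx.kind, sz, Enc.enc, RegEx.encode, Data.size, Data.ofNat,
        Data.ofList]
      omega
    all_goals exact Nat.le_mul_of_pos_left _ two_pos |>.trans' (sz_pos _)

@[fun_prop]
theorem regExAtoms {f : γ → AnyRegEx} (hf : PolyTime f) : PolyTime (fun c => (f c).2.atoms) := by
  refine comp (f := fun e : AnyRegEx => e.2.atoms) ?_ hf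
  refine (regExFlatten
    (p := fun e => decide (e.kind = 1) || (decide (e.kind = 4) || decide (e.kind = 6)))
    (g := fun e => bif decide (e.kind = 1) then [(false, [e.label])] else [(true, e.2.labels)])
    (by fun_prop) (by fun_prop) ?_ ?_).2
  · have hl : ∀ (n : ℕ) (es : List (RegEx (Fin n))), RegEx.atomsList es =
        (es.map fun e => e.atoms).flatten := by
      intro n es
      induction es with
      | nil => rfl
      | cons e es ih => simp [RegEx.atomsList, ih]
    rintro ⟨n, e⟩
    cases e <;> simp [AnyRegEx.kind, AnyRegEx.label, AnyRegEx.children, RegEx.children,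
      RegEx.atoms, hl, RegEx.labels, RegEx.symbols, Function.comp_def]
  · rintro ⟨n, _ | a | _ | _ | e | _ | e | _⟩ h <;> simp [AnyRegEx.kind] at h
    · simp [AnyRegEx.label, AnyRegEx.kind, sz, Enc.enc, RegEx.encode, Data.size, Data.ofNat,
        Data.ofList]
      omega
    all_goals
      have h1 := regExLabels_aux.1 ⟨n, e⟩
      simp only [AnyRegEx.kind, RegEx.labels, RegEx.symbols] at *
      simp [sz, Enc.enc, RegEx.encode, Data.size, Data.ofNat, Data.ofList] at *
      omega

@[fun_prop]
theorem regExConflict {f : γ → AnyRegEx} {l l' : γ → ℕ} (hf : PolyTime f) (hl : PolyTime l)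
    (hl' : PolyTime l') : PolyTime (fun c => (f c).2.conflict (l c) (l' c)) := by
  refine comp (f := fun x : (ℕ × ℕ) × AnyRegEx => x.2.2.conflict x.1.1 x.1.2)
    (g := fun c => ((l c, l' c), f c)) ?_ (by fun_prop)
  refine regExRec (F := fun (c : ℕ × ℕ) e => e.2.conflict c.1 c.2)
    (h := fun x : (ℕ × ℕ) × AnyRegEx × List Bool =>
      bif decide (x.2.1.kind = 4) || decide (x.2.1.kind = 6) then false else
      (decide (x.2.1.kind = 3) && (decide (x.1.1 ∈ x.2.1.children.headI.2.labels) &&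
        decide (x.1.2 ∈ x.2.1.children.tail.headI.2.labels))) ||
        x.2.2.any fun b => b) (by fun_prop) ?_ 3 fun _ _ => (sz_bool_le _).trans (by simp)
  have hl : ∀ (l l' n : ℕ) (es : List (RegEx (Fin n))), RegEx.conflictList l l' es =
      (es.map fun e => e.conflict l l').any fun b => b := by
    intro l l' n es
    induction es with
    | nil => rfl
    | cons e es ih => simp [RegEx.conflictList, ih]
  rintro ⟨l, l'⟩ ⟨n, e⟩
  cases e <;> simp [AnyRegEx.kind, AnyRegEx.children, RegEx.children,
    RegEx.conflict, hl, Function.comp_def]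
  rfl

end PolyTime

end XPathSat

/-! ### Tree patterns and the decision procedure -/

namespace XPathSat

namespace Axis

def isChild : Axis → Bool
  | child => true
  | _ => false

def isFollowing : Axis → Bool
  | followingSibling => true
  | _ => false

end Axis

/-- Tree patterns, in the first-child next-sibling representation: a pattern stands for the set of
edges that leave a pattern node. `edge χ l E R` is an edge with axis `χ` to a pattern node with
label `l` and the edges `E`, together with the further edges `R`. -/
inductive Pat : Type
  | nil : Pat
  | edge (χ : Axis) (l : ℕ) (E R : Pat) : Pat

/-- The pattern of a query, with the edges `k` attached to the target of the query, and with the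
further edges `r` at the source. -/
def XPath.toPat {n : ℕ} : XPath (Fin n) → Pat → Pat → Pat
  | step χ l, k, r => Pat.edge χ l k r
  | comp p q, k, r => toPat p (toPat q k Pat.nil) r
  | filter p q, k, r => toPat p (toPat q Pat.nil k) r

/-- An atom of a content model with its number: a place for the children of a node. The numbers
decrease from left to right. -/
abbrev Slot : Type := ℕ × Bool × List ℕ

def numberSlots : List (Bool × List ℕ) → List Slot
  | [] => []
  | s :: l => (l.length, s) :: numberSlots l

/-- A sibling at slot `p` may precede a sibling at slot `q`: the slot `p` is to the left of `q`, or
both are the same slot, for any number of siblings. -/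
def Slot.before (p q : Slot) : Bool :=
  decide (q.1 < p.1) || (decide (p.1 = q.1) && p.2.1)

namespace Pat

def append : Pat → Pat → Pat
  | nil, E' => E'
  | edge χ l E R, E' => edge χ l E (append R E')

/-- The child edges among the edges of a pattern node. -/
def down : Pat → Pat
  | nil => nil
  | edge χ l E R => bif χ.isChild then edge χ l E (down R) else down R

/-- The pattern nodes that are reached by sibling edges, with their labels and child edges. -/
def siblings : Pat → List (ℕ × Pat)
  | nil => []
  | edge χ l E R => bif χ.isChild then siblings R else (l, down E) :: (siblings E ++ siblings R)

/-- The pattern nodes that are reached by a child edge and then sibling edges, with their labels and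
child edges. -/
def offspring : Pat → List (ℕ × Pat)
  | nil => []
  | edge χ l E R => bif χ.isChild then (l, down E) :: (siblings E ++ offspring R) else offspring R

/-- The slots at which a pattern node can be placed so that its sibling edges, and the sibling edges
of the nodes that are reached by them, can be satisfied. -/
def feasible (S : List Slot) : Pat → List Slot
  | nil => S
  | edge χ l E R => bif χ.isChild then feasible S R else
      (feasible S R).filter fun p => (feasible S E).any fun q => decide (l ∈ q.2.2) &&
        (bif χ.isFollowing then p.before q else q.before p)

/-- Each of the trees of sibling edges below the child edges can be placed in the slots. -/
def placeable (S : List Slot) : Pat → Bool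
  | nil => true
  | edge χ l E R => bif χ.isChild then
      ((feasible S E).any fun q => decide (l ∈ q.2.2)) && placeable S R else placeable S R

end Pat

/-- Adds a pattern node to a list of pattern nodes; nodes with the same label in `o` are merged. -/
def mergeNode (o : List ℕ) (x : ℕ × Pat) : List (ℕ × Pat) → List (ℕ × Pat)
  | [] => [x]
  | y :: c => bif decide (x.1 = y.1) && decide (x.1 ∈ o) then (y.1, x.2.append y.2) :: c
      else y :: mergeNode o x c

/-- Merges the pattern nodes that have the same label in `o`. -/
def mergeNodes (o : List ℕ) : List (ℕ × Pat) → List (ℕ × Pat)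
  | [] => []
  | x :: g => mergeNode o x (mergeNodes o g)

/-- The labels and the sibling edges of the offspring of a pattern node with edges `E` are
compatible with the content model `e`. -/
def fits {n : ℕ} (e : RegEx (Fin n)) (E : Pat) : Bool :=
  E.placeable (numberSlots e.atoms) &&
    E.offspring.all fun x => E.offspring.all fun y => !e.conflict x.1 y.1

instance : Enc Axis := ⟨Axis.encode⟩

def Pat.encode : Pat → Data
  | nil => Data.nil
  | edge χ l E R => Data.cons (Enc.enc (χ, l)) (Data.cons E.encode R.encode)

instance : Enc Pat := ⟨Pat.encode⟩

theorem enc_edge (χ : Axis) (l : ℕ) (E R : Pat) :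
    Enc.enc (Pat.edge χ l E R) = Enc.enc ((χ, l), (E, R)) := rfl

theorem sz_patNil : sz Pat.nil = 1 := rfl

theorem sz_edge (χ : Axis) (l : ℕ) (E R : Pat) :
    sz (Pat.edge χ l E R) = sz χ + sz l + sz E + sz R + 3 := by
  rw [sz, enc_edge]
  change sz ((χ, l), (E, R)) = _
  simp only [sz_pair]
  omega

theorem Pat.sz_append (E E' : Pat) : sz (E.append E') + 1 = sz E + sz E' := by
  induction E with
  | nil => simp only [append, sz_patNil]; omega
  | edge χ l E R _ ih => simp only [append, sz_edge]; omega

theorem Pat.sz_siblings_add_sz_down_le (E : Pat) : sz E.siblings + sz E.down ≤ sz E + 1 := by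
  induction E with
  | nil => simp only [siblings, down, sz_patNil, sz_nil]; omega
  | edge χ l E R h1 h2 =>
    have := sz_pos χ
    have := XPathSat.sz_append E.siblings R.siblings
    simp only [siblings, down]
    cases χ.isChild <;> simp only [cond_true, cond_false, sz_edge, sz_cons, sz_pair] <;> omega

theorem Pat.sz_offspring_le (E : Pat) : sz E.offspring ≤ sz E := by
  induction E with
  | nil => simp only [offspring, sz_patNil, sz_nil]; omega
  | edge χ l E R h1 h2 =>
    have := sz_pos χ
    have := E.sz_siblings_add_sz_down_le
    have := XPathSat.sz_append E.siblings R.offspring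
    simp only [offspring]
    cases χ.isChild <;> simp only [cond_true, cond_false, sz_edge, sz_cons, sz_pair] <;> omega

theorem sz_mergeNode_le (o : List ℕ) (x : ℕ × Pat) (c : List (ℕ × Pat)) :
    sz (mergeNode o x c) ≤ sz x + sz c + 1 := by
  induction c with
  | nil => simp only [mergeNode, sz_cons]; omega
  | cons y c ih =>
    rcases x with ⟨l, E⟩
    rcases y with ⟨l', E'⟩
    have := E.sz_append E'
    simp only [mergeNode]
    cases decide (l = l') && decide (l ∈ o) <;>
      simp only [cond_true, cond_false, sz_cons, sz_pair] at * <;> omega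

theorem sz_mergeNodes_le (o : List ℕ) (g : List (ℕ × Pat)) : sz (mergeNodes o g) ≤ sz g := by
  induction g with
  | nil => simp [mergeNodes]
  | cons x g ih =>
    have := sz_mergeNode_le o x (mergeNodes o g)
    simp only [mergeNodes, sz_cons]
    omega

/-- The decision procedure for lists of pairs `(a, E)`: for each of them, there is a tree with root
label `a` in which the child edges of `E` are satisfied at the root. The content models are the
entries of `T`. -/
def search (T : List AnyRegEx) (W : List (ℕ × Pat)) : Bool :=
  match W with
  | [] => true
  | (a, E) :: W' => fits (T.getD a default).2 E &&
      search T (mergeNodes (T.getD a default).2.outerLabels E.offspring ++ W')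
termination_by sz W
decreasing_by
  have h1 := sz_mergeNodes_le (T.getD a default).2.outerLabels E.offspring
  have h2 := E.sz_offspring_le
  have h3 := sz_append (mergeNodes (T.getD a default).2.outerLabels E.offspring) W'
  have h4 := sz_cons (a, E) W'
  have h5 := sz_pair a E
  omega

/-! ### The decision procedure runs in polynomial time -/

instance : Inhabited Pat := ⟨Pat.nil⟩

instance : Inhabited Axis := ⟨Axis.child⟩

/-! The following functions make the fields of a pattern available to programs. -/

def Pat.isNil : Pat → Bool
  | nil => true
  | _ => false

def Pat.head : Pat → Axis × ℕ
  | nil => default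
  | edge χ l _ _ => (χ, l)

def Pat.inner : Pat → Pat
  | nil => nil
  | edge _ _ E _ => E

def Pat.rest : Pat → Pat
  | nil => nil
  | edge _ _ _ R => R

namespace PolyTime

variable {α β γ δ : Type} [Enc α] [Enc β] [Enc γ] [Enc δ]

@[fun_prop]
theorem axisIsChild {f : γ → Axis} (hf : PolyTime f) : PolyTime (fun c => (f c).isChild) := by
  refine comp (of_exp (Exp.ite Exp.arg Exp.nil (Exp.quote (Enc.enc true))) rfl ?_) hf
  rintro (_ | _ | _) <;> rfl

@[fun_prop]
theorem axisIsFollowing {f : γ → Axis} (hf : PolyTime f) :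
    PolyTime (fun c => (f c).isFollowing) := by
  refine comp (of_exp (Exp.natCases Exp.arg [Exp.nil, Exp.quote (Enc.enc true), Exp.nil]) rfl ?_) hf
  rintro (_ | _ | _) <;> rfl

@[fun_prop]
theorem patIsNil {f : γ → Pat} (hf : PolyTime f) : PolyTime (fun c => (f c).isNil) := by
  refine comp (of_exp (Exp.ite Exp.arg Exp.nil (Exp.quote (Enc.enc true))) rfl ?_) hf
  rintro (_ | _) <;> rfl

@[fun_prop]
theorem patHead {f : γ → Pat} (hf : PolyTime f) : PolyTime (fun c => (f c).head) := by
  refine comp (of_exp (Exp.ite Exp.arg (Exp.hd Exp.arg) (Exp.cons Exp.nil Exp.nil)) rfl ?_) hf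
  rintro (_ | _) <;> rfl

@[fun_prop]
theorem patInner {f : γ → Pat} (hf : PolyTime f) : PolyTime (fun c => (f c).inner) := by
  refine comp (of_exp (Exp.hd (Exp.tl Exp.arg)) rfl ?_) hf
  rintro (_ | _) <;> rfl

@[fun_prop]
theorem patRest {f : γ → Pat} (hf : PolyTime f) : PolyTime (fun c => (f c).rest) := by
  refine comp (of_exp (Exp.tl (Exp.tl Exp.arg)) rfl ?_) hf
  rintro (_ | _) <;> rfl

@[fun_prop]
theorem patEdge {f : γ → Axis} {g : γ → ℕ} {h k : γ → Pat} (hf : PolyTime f) (hg : PolyTime g)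
    (hh : PolyTime h) (hk : PolyTime k) : PolyTime (fun c => Pat.edge (f c) (g c) (h c) (k c)) :=
  comp (f := fun x : (Axis × ℕ) × Pat × Pat => Pat.edge x.1.1 x.1.2 x.2.1 x.2.2)
    (of_exp Exp.arg rfl fun _ => rfl) (by fun_prop : PolyTime fun c => ((f c, g c), (h c, k c)))

/-- Recursion over a pattern with a parameter. -/
theorem patRec [Inhabited β] {F : γ → Pat → β} {g : γ → β}
    {h : γ × (Axis × ℕ) × (Pat × Pat) × β × β → β} (hg : PolyTime g) (hh : PolyTime h)
    (h_nil : ∀ c, F c Pat.nil = g c)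
    (h_edge : ∀ c χ l E R, F c (Pat.edge χ l E R) = h (c, (χ, l), (E, R), F c E, F c R))
    (r : Polynomial ℕ) (hr : ∀ c E, sz (F c E) ≤ r.eval (sz (c, E))) :
    PolyTime (fun p : γ × Pat => F p.1 p.2) := by
  refine recursion
    (step := fun p : γ × Pat => (p, bif p.2.isNil then [] else [(p.1, p.2.inner), (p.1, p.2.rest)]))
    (comb := fun p : (γ × Pat) × List β => bif p.1.2.isNil then g p.1.1
      else h (p.1.1, p.1.2.head, (p.1.2.inner, p.1.2.rest), p.2.headI, p.2.tail.headI))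
    (by fun_prop) (by fun_prop) ?_ (fun p => sz p.2) ?_ Polynomial.X ?_ ?_ r fun p => hr _ _
  · rintro ⟨c, _ | ⟨χ, l, E, R⟩⟩
    · simp [h_nil, Pat.isNil]
    · simp [h_edge, Pat.isNil, Pat.head, Pat.inner, Pat.rest]
  · rintro ⟨c, _ | ⟨χ, l, E, R⟩⟩
    · simp [sz_patNil, Pat.isNil]
    · simp [sz_edge, Pat.isNil, Pat.inner, Pat.rest]; omega
  · rintro ⟨c, E⟩
    simp [sz_pair]; omega
  · rintro ⟨c, _ | ⟨χ, l, E, R⟩⟩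
    · simp [Pat.isNil]
    · simp [sz_edge, sz_pair, Pat.isNil, Pat.inner, Pat.rest]; omega

@[fun_prop]
theorem patAppend {f g : γ → Pat} (hf : PolyTime f) (hg : PolyTime g) :
    PolyTime (fun c => (f c).append (g c)) := by
  refine comp (f := fun x : Pat × Pat => x.2.append x.1) ?_ (hg.pair hf)
  refine patRec (F := fun c E => E.append c) (g := fun c => c)
    (h := fun x => Pat.edge x.2.1.1 x.2.1.2 x.2.2.1.1 x.2.2.2.2) (by fun_prop) (by fun_prop)
    (fun _ => rfl) (fun _ _ _ _ _ => rfl) Polynomial.X fun c E => ?_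
  have := E.sz_append c
  simp [sz_pair]; omega

@[fun_prop]
theorem patDown {f : γ → Pat} (hf : PolyTime f) : PolyTime (fun c => (f c).down) := by
  refine comp (f := fun x : Bool × Pat => x.2.down) ?_ ((const false).pair hf)
  refine patRec (F := fun _ E => E.down) (g := fun _ => Pat.nil)
    (h := fun x => bif x.2.1.1.isChild then Pat.edge x.2.1.1 x.2.1.2 x.2.2.1.1 x.2.2.2.2
      else x.2.2.2.2) (by fun_prop) (by fun_prop)
    (fun _ => rfl) (fun _ _ _ _ _ => rfl) Polynomial.X fun c E => ?_
  have := E.sz_siblings_add_sz_down_le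
  have := sz_pos E.siblings
  simp [sz_pair]; omega

@[fun_prop]
theorem patSiblings {f : γ → Pat} (hf : PolyTime f) : PolyTime (fun c => (f c).siblings) := by
  refine comp (f := fun x : Bool × Pat => x.2.siblings) ?_ ((const false).pair hf)
  refine patRec (F := fun _ E => E.siblings) (g := fun _ => [])
    (h := fun x => bif x.2.1.1.isChild then x.2.2.2.2
      else (x.2.1.2, x.2.2.1.1.down) :: (x.2.2.2.1 ++ x.2.2.2.2)) (by fun_prop) (by fun_prop)
    (fun _ => rfl) (fun _ _ _ _ _ => rfl) Polynomial.X fun c E => ?_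
  have := E.sz_siblings_add_sz_down_le
  have := sz_pos E.down
  simp [sz_pair]; omega

@[fun_prop]
theorem patOffspring {f : γ → Pat} (hf : PolyTime f) : PolyTime (fun c => (f c).offspring) := by
  refine comp (f := fun x : Bool × Pat => x.2.offspring) ?_ ((const false).pair hf)
  refine patRec (F := fun _ E => E.offspring) (g := fun _ => [])
    (h := fun x => bif x.2.1.1.isChild then
      (x.2.1.2, x.2.2.1.1.down) :: (x.2.2.1.1.siblings ++ x.2.2.2.2) else x.2.2.2.2)
    (by fun_prop) (by fun_prop)
    (fun _ => rfl) (fun _ _ _ _ _ => rfl) Polynomial.X fun c E => ?_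
  have := E.sz_offspring_le
  simp [sz_pair]; omega

@[fun_prop]
theorem slotBefore {f g : γ → Slot} (hf : PolyTime f) (hg : PolyTime g) :
    PolyTime (fun c => (f c).before (g c)) := by
  unfold Slot.before
  fun_prop

@[fun_prop]
theorem patFeasible {S : γ → List Slot} {f : γ → Pat} (hS : PolyTime S) (hf : PolyTime f) :
    PolyTime (fun c => (f c).feasible (S c)) := by
  refine comp (f := fun x : List Slot × Pat => x.2.feasible x.1) ?_ (hS.pair hf)
  refine patRec (F := fun S E => E.feasible S) (g := fun S => S)
    (h := fun x => bif x.2.1.1.isChild then x.2.2.2.2 else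
      x.2.2.2.2.filter fun p => x.2.2.2.1.any fun q => decide (x.2.1.2 ∈ q.2.2) &&
        (bif x.2.1.1.isFollowing then p.before q else q.before p)) (by fun_prop) (by fun_prop)
    (fun _ => rfl) (fun _ _ _ _ _ => rfl) Polynomial.X fun S E => ?_
  have : sz (E.feasible S) ≤ sz S := by
    induction E with
    | nil => exact le_rfl
    | edge χ l E R _ ih =>
      rw [Pat.feasible]
      cases χ.isChild
      · exact (sz_filter_le _ _).trans ih
      · exact ih
  simp [sz_pair]; omega

@[fun_prop]
theorem patPlaceable {S : γ → List Slot} {f : γ → Pat} (hS : PolyTime S) (hf : PolyTime f) :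
    PolyTime (fun c => (f c).placeable (S c)) := by
  refine comp (f := fun x : List Slot × Pat => x.2.placeable x.1) ?_ (hS.pair hf)
  exact patRec (F := fun S E => E.placeable S) (g := fun S => true)
    (h := fun x => bif x.2.1.1.isChild then
      ((x.2.2.1.1.feasible x.1).any fun q => decide (x.2.1.2 ∈ q.2.2)) && x.2.2.2.2
      else x.2.2.2.2) (by fun_prop) (by fun_prop)
    (fun _ => rfl) (fun _ _ _ _ _ => rfl) 3 fun _ _ => (sz_bool_le _).trans (by simp)

@[fun_prop]
theorem length [Inhabited α] {l : γ → List α} (hl : PolyTime l) :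
    PolyTime (fun c => (l c).length) := by
  refine comp (f := fun x : Bool × List α => x.2.length) ?_ ((const false).pair hl)
  refine listRec (F := fun _ l => l.length) (g := fun _ => 0) (h := fun x => x.2.2.2 + 1)
    (by fun_prop) (by fun_prop) (fun _ => rfl) (fun _ _ _ => rfl) (2 * Polynomial.X) fun c l => ?_
  have : l.length < sz l := by
    induction l with
    | nil => simp [sz_nil]
    | cons a l ih => simp only [List.length_cons, sz_cons]; omega
  simp [sz_pair, sz_nat]; omega

@[fun_prop]
theorem slots {f : γ → List (Bool × List ℕ)} (hf : PolyTime f) :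
    PolyTime (fun c => numberSlots (f c)) := by
  refine comp (f := fun x : Bool × List (Bool × List ℕ) => numberSlots x.2) ?_
    ((const false).pair hf)
  obtain ⟨q, hq, -⟩ := length (id' (α := List (Bool × List ℕ)))
  refine listRec (F := fun _ l => numberSlots l) (g := fun _ => [])
    (h := fun x => (x.2.2.1.length, x.2.1) :: x.2.2.2)
    (by fun_prop) (by fun_prop) (fun _ => rfl) (fun _ _ _ => rfl)
    (Polynomial.X * (q + 2)) fun c l => ?_
  have : sz (numberSlots l) ≤ sz l * (q.eval (sz l) + 2) := by
    induction l with
    | nil => simp [sz_nil, numberSlots]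
    | cons a l ih =>
      have h1 := hq l
      have h2 := sz_cons a l
      have h3 := eval_mono q (by omega : sz l ≤ sz (a :: l))
      have h4 := sz_pair l.length a
      have h5 := sz_cons (l.length, a) (numberSlots l)
      have h6 := sz_pos a
      simp only [numberSlots] at *
      nlinarith
  have h2 := sz_pair c l
  have h3 := eval_mono q (by omega : sz l ≤ sz (c, l))
  simp only [Polynomial.eval_mul, Polynomial.eval_add, Polynomial.eval_X, Polynomial.eval_ofNat]
  exact this.trans (Nat.mul_le_mul (by omega) (by omega))

@[fun_prop]
theorem nodeMerge {o : γ → List ℕ} {f : γ → ℕ × Pat} {g : γ → List (ℕ × Pat)} (ho : PolyTime o)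
    (hf : PolyTime f) (hg : PolyTime g) : PolyTime (fun c => mergeNode (o c) (f c) (g c)) := by
  refine comp (f := fun x : (List ℕ × (ℕ × Pat)) × List (ℕ × Pat) => mergeNode x.1.1 x.1.2 x.2) ?_
    (PolyTime.pair (ho.pair hf) hg)
  refine listRec (F := fun (o : List ℕ × (ℕ × Pat)) g => mergeNode o.1 o.2 g) (g := fun o => [o.2])
    (h := fun x : (List ℕ × (ℕ × Pat)) × (ℕ × Pat) × List (ℕ × Pat) × List (ℕ × Pat) =>
      bif decide (x.1.2.1 = x.2.1.1) && decide (x.1.2.1 ∈ x.1.1) then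
      (x.2.1.1, x.1.2.2.append x.2.1.2) :: x.2.2.1 else x.2.1 :: x.2.2.2)
    (by fun_prop) (by fun_prop) (fun _ => rfl) (fun _ _ _ => rfl) (Polynomial.X) fun o g => ?_
  rcases o with ⟨o, x⟩
  have := sz_mergeNode_le o x g
  simp [sz_pair]; omega

@[fun_prop]
theorem nodesMerge {o : γ → List ℕ} {g : γ → List (ℕ × Pat)} (ho : PolyTime o)
    (hg : PolyTime g) : PolyTime (fun c => mergeNodes (o c) (g c)) := by
  refine comp (f := fun x : List ℕ × List (ℕ × Pat) => mergeNodes x.1 x.2) ?_ (ho.pair hg)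
  refine listRec (F := fun (o : List ℕ) g => mergeNodes o g) (g := fun _ => [])
    (h := fun x => mergeNode x.1 x.2.1 x.2.2.2)
    (by fun_prop) (by fun_prop) (fun _ => rfl) (fun _ _ _ => rfl) (Polynomial.X) fun o g => ?_
  have := sz_mergeNodes_le o g
  simp [sz_pair]; omega

@[fun_prop]
theorem patFits {f : γ → AnyRegEx} {g : γ → Pat} (hf : PolyTime f) (hg : PolyTime g) :
    PolyTime (fun c => fits (f c).2 (g c)) := by
  unfold fits
  fun_prop

/-- The size of the list of the open tasks decreases in each step. -/
theorem searchList : PolyTime (fun x : List AnyRegEx × List (ℕ × Pat) => search x.1 x.2) := by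
  refine recursion (step := fun x : List AnyRegEx × List (ℕ × Pat) =>
      bif x.2.isEmpty then (true, []) else
      bif fits (x.1.getD x.2.headI.1 default).2 x.2.headI.2 then
        (true, [(x.1, mergeNodes (x.1.getD x.2.headI.1 default).2.outerLabels
          x.2.headI.2.offspring ++ x.2.tail)]) else (false, []))
    (comb := fun x : Bool × List Bool => x.1 && x.2.all fun b => b)
    (by fun_prop) (by fun_prop) ?_ (fun x => sz x.2) ?_ Polynomial.X ?_ ?_ 3
    fun _ => (sz_bool_le _).trans (by simp)
  · rintro ⟨T, _ | ⟨⟨a, E⟩, W⟩⟩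
    · simp [search]
    · rw [search]
      simp only [List.isEmpty_cons, cond_false, List.headI_cons, List.tail_cons]
      cases fits (T.getD a default).2 E <;> simp
  · rintro ⟨T, _ | ⟨⟨a, E⟩, W⟩⟩
    · simp [sz_nil]
    · simp only [List.isEmpty_cons, cond_false, List.headI_cons, List.tail_cons]
      have h1 := sz_mergeNodes_le (T.getD a default).2.outerLabels E.offspring
      have h2 := E.sz_offspring_le
      have h3 := sz_append (mergeNodes (T.getD a default).2.outerLabels E.offspring) W
      have h4 := sz_cons (a, E) W
      have h5 := sz_pair a E
      cases fits (T.getD a default).2 E <;> simp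
      all_goals omega
  · rintro ⟨c, E⟩
    simp [sz_pair]; omega
  · rintro ⟨T, _ | ⟨⟨a, E⟩, W⟩⟩
    · simp
    · simp only [List.isEmpty_cons, cond_false, List.headI_cons, List.tail_cons]
      have h1 := sz_mergeNodes_le (T.getD a default).2.outerLabels E.offspring
      have h2 := E.sz_offspring_le
      have h3 := sz_append (mergeNodes (T.getD a default).2.outerLabels E.offspring) W
      have h4 := sz_cons (a, E) W
      have h5 := sz_pair a E
      cases fits (T.getD a default).2 E <;> simp [sz_pair]
      omega

end PolyTime

/-- Queries over the labels below some number. -/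
abbrev AnyXPath : Type := Σ n, XPath (Fin n)

instance : Enc AnyXPath := ⟨fun p => p.2.encode⟩

theorem XPath.sz_toPat {n : ℕ} (p : XPath (Fin n)) (k r : Pat) :
    sz (p.toPat k r) ≤ p.encode.size + sz k + sz r := by
  induction p generalizing k r with
  | step χ l =>
    have h1 : sz χ = χ.encode.size := rfl
    have h2 : sz (l : ℕ) = (Data.ofNat l).size := rfl
    simp only [toPat, sz_edge, encode, Data.size, Data.ofNat]
    omega
  | comp p q hp hq =>
    have h1 := hp (q.toPat k Pat.nil) r
    have h2 := hq k Pat.nil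
    simp only [toPat, sz_patNil, encode, Data.size, Data.ofNat] at *
    omega
  | filter p q hp hq =>
    have h1 := hp (q.toPat Pat.nil k) r
    have h2 := hq Pat.nil k
    simp only [toPat, sz_patNil, encode, Data.size, Data.ofNat] at *
    omega

/-- The body of a recursive function that computes `XPath.toPat` from the triple of its arguments. -/
def toPatBody : Exp :=
  let p := Exp.hd Exp.arg
  let k := Exp.hd (Exp.tl Exp.arg)
  let r := Exp.tl (Exp.tl Exp.arg)
  let p₁ := Exp.hd (Exp.tl p)
  let p₂ := Exp.tl (Exp.tl p)
  Exp.ite (Exp.hd p)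
    (Exp.ite (Exp.tl (Exp.hd p))
      (Exp.call 0 (Exp.cons p₁ (Exp.cons (Exp.call 0 (Exp.cons p₂ (Exp.cons Exp.nil k))) r)))
      (Exp.call 0 (Exp.cons p₁ (Exp.cons (Exp.call 0 (Exp.cons p₂ (Exp.cons k Exp.nil))) r))))
    (Exp.cons (Exp.tl p) (Exp.cons k r))

theorem runs_toPatBody {n : ℕ} (p : XPath (Fin n)) (k r : Pat) :
    Runs [toPatBody] (Data.cons p.encode (Data.cons (Enc.enc k) (Enc.enc r)))
      (Exp.call 0 Exp.arg) (Enc.enc (p.toPat k r)) (100 * p.encode.size) := by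
  have hv : ∀ (x : Data) (e : Exp), e.callFree = true → Runs [toPatBody] x e (e.val x) e.len :=
    Exp.runs_val [toPatBody]
  induction p generalizing k r with
  | step χ l =>
    have h : Runs [toPatBody] _ toPatBody _ _ :=
      (hv (Data.cons (XPath.step χ l).encode (Data.cons (Enc.enc k) (Enc.enc r)))
      (Exp.hd (Exp.hd Exp.arg)) rfl).iteFalse (hv _ (Exp.cons (Exp.tl (Exp.hd Exp.arg))
        (Exp.cons (Exp.hd (Exp.tl Exp.arg)) (Exp.tl (Exp.tl Exp.arg)))) rfl)
    refine (Runs.call Runs.arg rfl h).mono ?_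
    simp [Exp.len, XPath.encode, Data.size]
    omega
  | comp p q hp hq =>
    have h1 := Runs.app ((hv (Data.cons (XPath.comp p q).encode
      (Data.cons (Enc.enc k) (Enc.enc r))) (Exp.cons (Exp.tl (Exp.tl (Exp.hd Exp.arg)))
        (Exp.cons (Exp.hd (Exp.tl Exp.arg)) Exp.nil)) rfl)) (hq k Pat.nil)
    have h2 := Runs.app (((hv _ (Exp.hd (Exp.tl (Exp.hd Exp.arg))) rfl)).cons
      (h1.cons (hv _ (Exp.tl (Exp.tl Exp.arg)) rfl))) (hp (q.toPat k Pat.nil) r)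
    have h : Runs [toPatBody] _ toPatBody _ _ :=
      (hv (Data.cons (XPath.comp p q).encode (Data.cons (Enc.enc k) (Enc.enc r)))
      (Exp.hd (Exp.hd Exp.arg)) rfl).iteTrue
      ((hv _ (Exp.tl (Exp.hd (Exp.hd Exp.arg))) rfl).iteFalse h2)
    refine (Runs.call Runs.arg rfl h).mono ?_
    simp [Exp.len, XPath.encode, Data.size]
    omega
  | filter p q hp hq =>
    have h1 := Runs.app ((hv (Data.cons (XPath.filter p q).encode
      (Data.cons (Enc.enc k) (Enc.enc r))) (Exp.cons (Exp.tl (Exp.tl (Exp.hd Exp.arg)))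
        (Exp.cons Exp.nil (Exp.hd (Exp.tl Exp.arg)))) rfl)) (hq Pat.nil k)
    have h2 := Runs.app (((hv _ (Exp.hd (Exp.tl (Exp.hd Exp.arg))) rfl)).cons
      (h1.cons (hv _ (Exp.tl (Exp.tl Exp.arg)) rfl))) (hp (q.toPat Pat.nil k) r)
    have h : Runs [toPatBody] _ toPatBody _ _ :=
      (hv (Data.cons (XPath.filter p q).encode (Data.cons (Enc.enc k) (Enc.enc r)))
      (Exp.hd (Exp.hd Exp.arg)) rfl).iteTrue
      ((hv _ (Exp.tl (Exp.hd (Exp.hd Exp.arg))) rfl).iteTrue h2)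
    refine (Runs.call Runs.arg rfl h).mono ?_
    simp [Exp.len, XPath.encode, Data.size]
    omega

theorem PolyTime.toPat {γ : Type} [Enc γ] {f : γ → AnyXPath} (hf : PolyTime f) :
    PolyTime (fun c => (f c).2.toPat Pat.nil Pat.nil) := by
  have h : PolyTime (fun x : AnyXPath × Pat × Pat => x.1.2.toPat x.2.1 x.2.2) := by
    refine ⟨100 * Polynomial.X, fun x => ?_, [toPatBody], fun x => ?_⟩
    · have h1 := x.1.2.sz_toPat x.2.1 x.2.2
      have h2 := sz_pair x.1 (x.2.1, x.2.2)
      have h3 := sz_pair x.2.1 x.2.2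
      have h4 : sz x.1 = x.1.2.encode.size := rfl
      simp only [Polynomial.eval_mul, Polynomial.eval_X, Polynomial.eval_ofNat]
      rcases x with ⟨p, k, r⟩
      simp only at *
      omega
    · refine (runs_toPatBody x.1.2 x.2.1 x.2.2).mono ?_
      have h2 := sz_pair x.1 x.2
      have h4 : sz x.1 = x.1.2.encode.size := rfl
      simp only [Polynomial.eval_mul, Polynomial.eval_X, Polynomial.eval_ofNat]
      rcases x with ⟨p, k, r⟩
      simp only at *
      omega
  exact comp (f := fun x : AnyXPath × Pat × Pat => x.1.2.toPat x.2.1 x.2.2)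
    (g := fun c => (f c, (Pat.nil, Pat.nil))) h (by fun_prop)

/-! ### Instances and their sizes -/

namespace SatInput

instance : Enc SatInput := ⟨encode⟩

/-- The list of the content models. -/
def contents (I : SatInput) : List AnyRegEx :=
  List.ofFn fun a => ⟨I.dtd.numLabels, I.dtd.content a⟩

/-- The query as a pattern. -/
def pat (I : SatInput) : Pat := I.query.toPat Pat.nil Pat.nil

/-- The decision procedure. There are no siblings of the root. -/
def decide (I : SatInput) : Bool :=
  I.pat.siblings.isEmpty && search I.contents [((I.dtd.root : ℕ), I.pat)]

theorem polyTime_decide : PolyTime decide := by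
  have h1 : PolyTime contents := by
    refine PolyTime.of_exp (Exp.tl (Exp.hd Exp.arg)) rfl fun I => ?_
    change Data.ofList _ = Data.ofList _
    simp [contents, List.map_ofFn, Function.comp_def]
    rfl
  have h2 : PolyTime (fun I : SatInput => (I.dtd.root : ℕ)) :=
    PolyTime.of_exp (Exp.hd (Exp.hd Exp.arg)) rfl fun I => rfl
  have h3 : PolyTime pat := PolyTime.toPat (f := fun I : SatInput => ⟨_, I.query⟩)
    (PolyTime.of_exp (Exp.tl Exp.arg) rfl fun I => rfl)
  have h4 : PolyTime fun I : SatInput => (I.contents, [((I.dtd.root : ℕ), I.pat)]) := by fun_prop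
  exact PolyTime.and (by fun_prop) (PolyTime.searchList.comp h4)

end SatInput

mutual
theorem RegEx.size_encode_le {n : ℕ} : ∀ e : RegEx (Fin n),
    e.encode.size + 1 ≤ (2 * n + 20) * e.size
  | RegEx.eps => by
    simp [RegEx.encode, RegEx.size, Data.size, Data.ofNat]
  | RegEx.sym a => by
    have h : (Data.ofNat (a : ℕ)).size = 2 * a + 1 := sz_nat a
    have := a.isLt
    simp [RegEx.encode, RegEx.size, Data.size, Data.ofNat, h]; omega
  | RegEx.cat e f => by
    have := RegEx.size_encode_le e
    have := RegEx.size_encode_le f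
    simp only [RegEx.encode, RegEx.size, Data.size, Data.ofNat, mul_add]; omega
  | RegEx.alt e f => by
    have := RegEx.size_encode_le e
    have := RegEx.size_encode_le f
    simp only [RegEx.encode, RegEx.size, Data.size, Data.ofNat, mul_add]; omega
  | RegEx.star e => by
    have := RegEx.size_encode_le e
    simp only [RegEx.encode, RegEx.size, Data.size, Data.ofNat, mul_add]; omega
  | RegEx.opt e => by
    have := RegEx.size_encode_le e
    simp only [RegEx.encode, RegEx.size, Data.size, Data.ofNat, mul_add]; omega
  | RegEx.plus e => by
    have := RegEx.size_encode_le e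
    simp only [RegEx.encode, RegEx.size, Data.size, Data.ofNat, mul_add]; omega
  | RegEx.hash es fs => by
    have := RegEx.size_encodeList_le es
    have := RegEx.size_encodeList_le fs
    simp only [RegEx.encode, RegEx.size, Data.size, Data.ofNat, mul_add]; omega
theorem RegEx.size_encodeList_le {n : ℕ} : ∀ es : List (RegEx (Fin n)),
    (RegEx.encodeList es).size ≤ (2 * n + 20) * RegEx.sizeList es + 1
  | [] => by simp [RegEx.encodeList, Data.size]
  | e :: es => by
    have := RegEx.size_encode_le e
    have := RegEx.size_encodeList_le es
    simp only [RegEx.encodeList, RegEx.sizeList, Data.size, mul_add]; omega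
end

end XPathSat

/-! ### Words of regular expressions and their subwords -/

namespace XPathSat

/-- `w` is a concatenation of words over the labels of the atoms, one for each atom and in this
order; the word of an atom that is a symbol has length at most `1`. -/
def Traces : List (Bool × List ℕ) → List ℕ → Prop
  | [], w => w = []
  | s :: S, w => ∃ u v, w = u ++ v ∧ (∀ x ∈ u, x ∈ s.2) ∧ (s.1 = false → u.length ≤ 1) ∧ Traces S v

/-- The empty word is a subword of every word. -/
theorem traces_nil : ∀ S, Traces S []
  | [] => rfl
  | _ :: S => ⟨[], [], rfl, by simp, by simp, traces_nil S⟩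

theorem traces_append {S S' : List (Bool × List ℕ)} {w : List ℕ} :
    Traces (S ++ S') w ↔ ∃ u v, w = u ++ v ∧ Traces S u ∧ Traces S' v := by
  induction S generalizing w with
  | nil => simp [Traces]
  | cons s S ih =>
    constructor
    · rintro ⟨u, v, rfl, h1, h2, h3⟩
      obtain ⟨v, v', rfl, h4, h5⟩ := ih.1 h3
      exact ⟨u ++ v, v', by simp, ⟨u, v, rfl, h1, h2, h4⟩, h5⟩
    · rintro ⟨_, v', rfl, ⟨u, v, rfl, h1, h2, h4⟩, h5⟩
      exact ⟨u, v ++ v', by simp, h1, h2, ih.2 ⟨v, v', rfl, h4, h5⟩⟩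

theorem traces_singleton {s : Bool × List ℕ} {w : List ℕ} :
    Traces [s] w ↔ (∀ x ∈ w, x ∈ s.2) ∧ (s.1 = false → w.length ≤ 1) := by
  simp [Traces]

namespace RegEx

theorem induction_on_lists {α : Type} {p : RegEx α → Prop} (eps : p eps) (sym : ∀ a, p (sym a))
    (cat : ∀ e f, p e → p f → p (cat e f)) (alt : ∀ e f, p e → p f → p (alt e f))
    (star : ∀ e, p e → p (star e)) (opt : ∀ e, p e → p (opt e)) (plus : ∀ e, p e → p (plus e))
    (hash : ∀ es fs, (∀ e ∈ es, p e) → (∀ e ∈ fs, p e) → p (hash es fs)) (e : RegEx α) : p e :=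
  RegEx.rec (motive_1 := p) (motive_2 := fun es => ∀ e ∈ es, p e) eps sym cat alt star opt plus hash
    (by simp) (fun _ _ h1 h2 => List.forall_mem_cons.2 ⟨h1, h2⟩) e

variable {n : ℕ}

theorem langCat_le_langOptCat (es : List (RegEx (Fin n))) {w : List (Fin n)}
    (h : w ∈ langCat es) : w ∈ langOptCat es := by
  induction es generalizing w with
  | nil => exact h
  | cons e es ih =>
    rw [langCat, Language.mem_mul] at h
    obtain ⟨u, hu, v, hv, rfl⟩ := h
    rw [langOptCat, Language.mem_mul]
    exact ⟨u, by rw [Language.mem_add]; exact Or.inr hu, v, ih hv, rfl⟩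

/-- A word of a `#`-expression is a word of `e₁? ⋯ eₘ? f₁? ⋯ fₗ?`. -/
theorem mem_langOptCat_of_mem_hash {es fs : List (RegEx (Fin n))} {w : List (Fin n)}
    (h : w ∈ (hash es fs).lang) : ∃ u ∈ langOptCat es, ∃ v ∈ langOptCat fs, u ++ v = w := by
  rw [lang, Language.mem_add, Language.mem_mul, Language.mem_mul] at h
  rcases h with ⟨u, hu, v, hv, rfl⟩ | ⟨u, hu, v, hv, rfl⟩
  · exact ⟨u, langCat_le_langOptCat _ hu, v, hv, rfl⟩
  · exact ⟨u, hu, v, langCat_le_langOptCat _ hv, rfl⟩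

theorem mem_symbols_of_mem {e : RegEx (Fin n)} {w : List (Fin n)} (h : w ∈ e.lang) :
    ∀ a ∈ w, a ∈ e.symbols := by
  have hs : ∀ e : RegEx (Fin n), (∀ w ∈ e.lang, ∀ a ∈ w, a ∈ e.symbols) →
      ∀ w ∈ KStar.kstar e.lang, ∀ a ∈ w, a ∈ e.symbols := by
    intro e he w hw a ha
    obtain ⟨L, rfl, hL⟩ := Language.mem_kstar.1 hw
    obtain ⟨u, hu, ha⟩ := List.mem_flatten.1 ha
    exact he u (hL u hu) a ha
  have hl : ∀ es : List (RegEx (Fin n)), (∀ e ∈ es, ∀ w ∈ e.lang, ∀ a ∈ w, a ∈ e.symbols) →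
      ∀ w ∈ langOptCat es, ∀ a ∈ w, a ∈ symbolsList es := by
    intro es
    induction es with
    | nil => intro _ w hw a ha; simp_all [langOptCat, Language.mem_one]
    | cons e es ih =>
      intro he w hw a ha
      rw [langOptCat, Language.mem_mul] at hw
      obtain ⟨u, hu, v, hv, rfl⟩ := hw
      rw [symbolsList, List.mem_append]
      rcases List.mem_append.1 ha with ha | ha
      · rcases (Language.mem_add _ _ _).1 hu with hu | hu
        · rw [Language.mem_one] at hu
          simp [hu] at ha
        · exact Or.inl (he e (by simp) u hu a ha)
      · exact Or.inr (ih (fun f hf => he f (by simp [hf])) v hv a ha)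
  induction e using induction_on_lists generalizing w with
  | eps => simp_all [lang, Language.mem_one]
  | sym a =>
    rw [lang] at h
    obtain rfl := Set.mem_singleton_iff.1 h
    simp [symbols]
  | cat e f he hf =>
    rw [lang, Language.mem_mul] at h
    obtain ⟨u, hu, v, hv, rfl⟩ := h
    intro a ha
    rw [symbols, List.mem_append]
    exact (List.mem_append.1 ha).imp (he hu a) (hf hv a)
  | alt e f he hf =>
    intro a ha
    rw [symbols, List.mem_append]
    exact ((Language.mem_add _ _ _).1 h).imp (fun h => he h a ha) (fun h => hf h a ha)
  | star e he => exact hs e (fun w hw => he hw) w h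
  | opt e he =>
    rcases (Language.mem_add _ _ _).1 h with h | h
    · rw [Language.mem_one] at h
      simp [h]
    · exact he h
  | plus e he =>
    rw [lang, Language.mem_mul] at h
    obtain ⟨u, hu, v, hv, rfl⟩ := h
    intro a ha
    exact (List.mem_append.1 ha).elim (he hu a) (hs e (fun w hw => he hw) v hv a)
  | hash es fs he hf =>
    obtain ⟨u, hu, v, hv, rfl⟩ := mem_langOptCat_of_mem_hash h
    intro a ha
    rw [symbols, List.mem_append]
    exact (List.mem_append.1 ha).imp (hl es (fun e h w hw => he e h hw) u hu a)
      (hl fs (fun e h w hw => hf e h hw) v hv a)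

theorem mem_symbols_of_mem_langOptCat {es : List (RegEx (Fin n))} {w : List (Fin n)}
    (h : w ∈ langOptCat es) : ∀ a ∈ w, a ∈ symbolsList es := by
  induction es generalizing w with
  | nil => intro a ha; simp_all [langOptCat, Language.mem_one]
  | cons e es ih =>
    intro a ha
    rw [langOptCat, Language.mem_mul] at h
    obtain ⟨u, hu, v, hv, rfl⟩ := h
    rw [symbolsList, List.mem_append]
    rcases List.mem_append.1 ha with ha | ha
    · rcases (Language.mem_add _ _ _).1 hu with hu | hu
      · rw [Language.mem_one] at hu
        simp [hu] at ha
      · exact Or.inl (mem_symbols_of_mem hu a ha)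
    · exact Or.inr (ih hv a ha)

theorem mem_labels {e : RegEx (Fin n)} {a : Fin n} : (a : ℕ) ∈ e.labels ↔ a ∈ e.symbols := by
  simp [labels, Fin.val_inj]

theorem mem_outerLabels {e : RegEx (Fin n)} {a : Fin n} :
    (a : ℕ) ∈ e.outerLabels ↔ a ∈ e.outerSymbols := by
  simp [outerLabels, Fin.val_inj]

/-- The words of `e` are made of words of its atoms. -/
theorem traces_of_mem {e : RegEx (Fin n)} {w : List (Fin n)} (h : w ∈ e.lang) :
    Traces e.atoms (w.map Fin.val) := by
  have hl : ∀ es : List (RegEx (Fin n)),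
      (∀ e ∈ es, ∀ w ∈ e.lang, Traces e.atoms (w.map Fin.val)) →
      ∀ w ∈ langOptCat es, Traces (atomsList es) (w.map Fin.val) := by
    intro es
    induction es with
    | nil => intro _ w hw; simp_all [langOptCat, Language.mem_one, atomsList, Traces]
    | cons e es ih =>
      intro he w hw
      rw [langOptCat, Language.mem_mul] at hw
      obtain ⟨u, hu, v, hv, rfl⟩ := hw
      rw [atomsList, traces_append]
      refine ⟨_, _, List.map_append, ?_, ih (fun f hf => he f (by simp [hf])) v hv⟩
      rcases (Language.mem_add _ _ _).1 hu with hu | hu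
      · rw [Language.mem_one] at hu
        subst hu
        exact traces_nil _
      · exact he e (by simp) u hu
  induction e using induction_on_lists generalizing w with
  | eps => simp_all [lang, Language.mem_one, atoms, Traces]
  | sym a =>
    rw [lang] at h
    obtain rfl := Set.mem_singleton_iff.1 h
    simp [atoms, traces_singleton]
  | cat e f he hf =>
    rw [lang, Language.mem_mul] at h
    obtain ⟨u, hu, v, hv, rfl⟩ := h
    exact traces_append.2 ⟨_, _, List.map_append, he hu, hf hv⟩
  | alt e f he hf =>
    rcases (Language.mem_add _ _ _).1 h with h | h
    · exact traces_append.2 ⟨_, [], by simp, he h, traces_nil _⟩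
    · exact traces_append.2 ⟨[], _, by simp, traces_nil _, hf h⟩
  | star e he =>
    refine traces_singleton.2 ⟨fun x hx => ?_, by simp⟩
    obtain ⟨a, ha, rfl⟩ := List.mem_map.1 hx
    exact mem_labels.2 (mem_symbols_of_mem h a ha)
  | opt e he =>
    rcases (Language.mem_add _ _ _).1 h with h | h
    · rw [Language.mem_one] at h
      subst h
      exact traces_nil _
    · exact he h
  | plus e he =>
    refine traces_singleton.2 ⟨fun x hx => ?_, by simp⟩
    obtain ⟨a, ha, rfl⟩ := List.mem_map.1 hx
    exact mem_labels.2 (mem_symbols_of_mem h a ha)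
  | hash es fs he hf =>
    obtain ⟨u, hu, v, hv, rfl⟩ := mem_langOptCat_of_mem_hash h
    exact traces_append.2 ⟨_, _, List.map_append, hl es (fun e h w hw => he e h hw) u hu,
      hl fs (fun e h w hw => hf e h hw) v hv⟩

theorem mem_labels_of_mem_atoms {e : RegEx (Fin n)} : ∀ s ∈ e.atoms, ∀ x ∈ s.2, x ∈ e.labels := by
  have hl : ∀ es : List (RegEx (Fin n)), (∀ e ∈ es, ∀ s ∈ e.atoms, ∀ x ∈ s.2, x ∈ e.labels) →
      ∀ s ∈ atomsList es, ∀ x ∈ s.2, x ∈ (symbolsList es).map Fin.val := by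
    intro es
    induction es with
    | nil => simp [atomsList]
    | cons e es ih =>
      intro he s hs x hx
      rw [symbolsList, List.map_append, List.mem_append]
      rcases List.mem_append.1 hs with hs | hs
      · exact Or.inl (he e (by simp) s hs x hx)
      · exact Or.inr (ih (fun f hf => he f (by simp [hf])) s hs x hx)
  induction e using induction_on_lists with
  | eps => simp [atoms]
  | sym a => simp [atoms, labels, symbols]
  | cat e f he hf | alt e f he hf =>
    intro s hs x hx
    rw [labels, symbols, List.map_append, List.mem_append]
    exact (List.mem_append.1 hs).imp (fun h => he s h x hx) (fun h => hf s h x hx)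
  | star e he | plus e he =>
    intro s hs x hx
    rw [atoms, List.mem_singleton] at hs
    subst hs
    exact hx
  | opt e he => exact he
  | hash es fs he hf =>
    intro s hs x hx
    rw [labels, symbols, List.map_append, List.mem_append]
    exact (List.mem_append.1 hs).imp (fun h => hl es he s h x hx) (fun h => hl fs hf s h x hx)

theorem traces_mem_labels {e : RegEx (Fin n)} {r : List ℕ} (h : Traces e.atoms r) :
    ∀ x ∈ r, x ∈ e.labels := by
  have hS : ∀ (S : List (Bool × List ℕ)) (r : List ℕ), Traces S r → ∀ x ∈ r, ∃ s ∈ S, x ∈ s.2 := by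
    intro S
    induction S with
    | nil => rintro r rfl; simp
    | cons s S ih =>
      rintro _ ⟨u, v, rfl, h1, -, h2⟩ x hx
      rcases List.mem_append.1 hx with hx | hx
      · exact ⟨s, by simp, h1 x hx⟩
      · obtain ⟨s, hs, hx⟩ := ih v h2 x hx
        exact ⟨s, by simp [hs], hx⟩
  intro x hx
  obtain ⟨s, hs, hx⟩ := hS _ _ h x hx
  exact mem_labels_of_mem_atoms s hs x hx

/-- No expression denotes the empty language, so that `e` has a word, and every symbol of `e`
occurs in a word. -/
theorem exists_mem_lang (e : RegEx (Fin n)) :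
    (∃ w, w ∈ e.lang) ∧ ∀ a ∈ e.symbols, ∃ w ∈ e.lang, a ∈ w := by
  have hcat : ∀ (L L' : Language (Fin n)) (s s' : List (Fin n)),
      ((∃ w, w ∈ L) ∧ ∀ a ∈ s, ∃ w ∈ L, a ∈ w) → ((∃ w, w ∈ L') ∧ ∀ a ∈ s', ∃ w ∈ L', a ∈ w) →
      ((∃ w, w ∈ L * L') ∧ ∀ a ∈ s ++ s', ∃ w ∈ L * L', a ∈ w) := by
    rintro L L' s s' ⟨⟨u, hu⟩, h1⟩ ⟨⟨v, hv⟩, h2⟩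
    refine ⟨⟨u ++ v, Language.append_mem_mul hu hv⟩, fun a ha => ?_⟩
    rcases List.mem_append.1 ha with ha | ha
    · obtain ⟨w, hw, ha⟩ := h1 a ha
      exact ⟨w ++ v, Language.append_mem_mul hw hv, by simp [ha]⟩
    · obtain ⟨w, hw, ha⟩ := h2 a ha
      exact ⟨u ++ w, Language.append_mem_mul hu hw, by simp [ha]⟩
  have hl : ∀ es : List (RegEx (Fin n)),
      (∀ e ∈ es, (∃ w, w ∈ e.lang) ∧ ∀ a ∈ e.symbols, ∃ w ∈ e.lang, a ∈ w) →
      (∃ w, w ∈ langCat es) ∧ ∀ a ∈ symbolsList es, ∃ w ∈ langCat es, a ∈ w := by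
    intro es
    induction es with
    | nil => exact fun _ => ⟨⟨[], Language.nil_mem_one⟩, by simp [symbolsList]⟩
    | cons e es ih =>
      exact fun he => hcat _ _ _ _ (he e (by simp)) (ih fun f hf => he f (by simp [hf]))
  have hs : ∀ (L : Language (Fin n)), ∀ w ∈ L, w ∈ KStar.kstar L := fun L w hw =>
    Language.mem_kstar.2 ⟨[w], by simp, by simpa using hw⟩
  induction e using induction_on_lists with
  | eps => exact ⟨⟨[], Language.nil_mem_one⟩, by simp [symbols]⟩
  | sym a => exact ⟨⟨[a], rfl⟩, fun b hb => ⟨[a], rfl, hb⟩⟩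
  | cat e f he hf => exact hcat _ _ _ _ he hf
  | alt e f he hf =>
    refine ⟨he.1.imp fun w hw => (Language.mem_add _ _ _).2 (Or.inl hw), fun a ha => ?_⟩
    rcases List.mem_append.1 ha with ha | ha
    · exact (he.2 a ha).imp fun w hw => ⟨(Language.mem_add _ _ _).2 (Or.inl hw.1), hw.2⟩
    · exact (hf.2 a ha).imp fun w hw => ⟨(Language.mem_add _ _ _).2 (Or.inr hw.1), hw.2⟩
  | star e he =>
    exact ⟨he.1.imp fun w hw => hs _ w hw, fun a ha => (he.2 a ha).imp fun w hw =>
      ⟨hs _ w hw.1, hw.2⟩⟩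
  | opt e he =>
    exact ⟨he.1.imp fun w hw => (Language.mem_add _ _ _).2 (Or.inr hw), fun a ha =>
      (he.2 a ha).imp fun w hw => ⟨(Language.mem_add _ _ _).2 (Or.inr hw.1), hw.2⟩⟩
  | plus e he =>
    have := hcat _ (KStar.kstar e.lang) _ [] he ⟨⟨[], Language.nil_mem_kstar _⟩, by simp⟩
    rw [List.append_nil] at this
    exact this
  | hash es fs he hf =>
    have h := hcat _ _ _ _ (hl es he) (hl fs hf)
    have hle : ∀ w ∈ langCat es * langCat fs, w ∈ (hash es fs).lang := by
      intro w hw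
      obtain ⟨u, hu, v, hv, rfl⟩ := Language.mem_mul.1 hw
      exact (Language.mem_add _ _ _).2
        (Or.inl (Language.append_mem_mul hu (langCat_le_langOptCat _ hv)))
    exact ⟨h.1.imp hle, fun a ha => (h.2 a ha).imp fun w hw => ⟨hle w hw.1, hw.2⟩⟩

/-- Every word over the symbols of `e` is a subword of a word of `e⁺`. -/
theorem exists_sublist_plus (e : RegEx (Fin n)) {r : List ℕ} (h : ∀ x ∈ r, x ∈ e.labels) :
    ∃ w ∈ (plus e).lang, r.Sublist (w.map Fin.val) := by
  have hstar : ∃ w ∈ KStar.kstar e.lang, r.Sublist (w.map Fin.val) := by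
    induction r with
    | nil => exact ⟨[], Language.nil_mem_kstar _, by simp⟩
    | cons x r ih =>
      obtain ⟨v, hv, hr⟩ := ih fun y hy => h y (by simp [hy])
      obtain ⟨a, ha, rfl⟩ := List.mem_map.1 (h x (by simp))
      obtain ⟨u, hu, hau⟩ := e.exists_mem_lang.2 a ha
      obtain ⟨L, rfl, hL⟩ := Language.mem_kstar.1 hv
      refine ⟨(u :: L).flatten, Language.mem_kstar.2 ⟨u :: L, rfl, by simpa using ⟨hu, hL⟩⟩, ?_⟩
      rw [List.flatten_cons, List.map_append]
      exact (List.singleton_sublist.2 (List.mem_map_of_mem hau)).append hr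
  obtain ⟨v, hv, hr⟩ := hstar
  obtain ⟨u, hu⟩ := e.exists_mem_lang.1
  exact ⟨u ++ v, Language.append_mem_mul hu hv, by
    rw [List.map_append]; exact hr.trans (List.sublist_append_right _ _)⟩

/-- A word that is made of words of the atoms of `e` is a subword of a word of `e`, unless it has
symbols from both sides of a disjunction. -/
theorem exists_sublist_of_traces {e : RegEx (Fin n)} {r : List ℕ} (h : Traces e.atoms r)
    (hc : ∀ x ∈ r, ∀ y ∈ r, e.conflict x y = false) :
    ∃ w ∈ e.lang, r.Sublist (w.map Fin.val) := by
  have hl : ∀ es : List (RegEx (Fin n)), (∀ e ∈ es, ∀ r, Traces e.atoms r →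
      (∀ x ∈ r, ∀ y ∈ r, e.conflict x y = false) → ∃ w ∈ e.lang, r.Sublist (w.map Fin.val)) →
      ∀ r, Traces (atomsList es) r → (∀ x ∈ r, ∀ y ∈ r, conflictList x y es = false) →
      ∃ w ∈ langCat es, r.Sublist (w.map Fin.val) := by
    intro es
    induction es with
    | nil => exact fun _ r hr _ => ⟨[], Language.nil_mem_one, by simp_all [atomsList, Traces]⟩
    | cons e es ih =>
      intro he r hr hc
      obtain ⟨u, v, rfl, hu, hv⟩ := traces_append.1 hr
      simp only [conflictList, Bool.or_eq_false_iff, List.mem_append] at hc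
      obtain ⟨w, hw, hw'⟩ := he e (by simp) u hu fun x hx y hy =>
        (hc x (Or.inl hx) y (Or.inl hy)).1
      obtain ⟨z, hz, hz'⟩ := ih (fun f hf => he f (by simp [hf])) v hv fun x hx y hy =>
        (hc x (Or.inr hx) y (Or.inr hy)).2
      exact ⟨w ++ z, Language.append_mem_mul hw hz, by rw [List.map_append]; exact hw'.append hz'⟩
  induction e using induction_on_lists generalizing r with
  | eps => exact ⟨[], Language.nil_mem_one, by simp_all [atoms, Traces]⟩
  | sym a =>
    obtain ⟨h1, h2⟩ := traces_singleton.1 h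
    refine ⟨[a], rfl, ?_⟩
    rcases r with _ | ⟨x, _ | ⟨y, r⟩⟩
    · simp
    · simpa using h1
    · simp at h2
  | cat e f he hf =>
    obtain ⟨u, v, rfl, hu, hv⟩ := traces_append.1 h
    simp only [conflict, Bool.or_eq_false_iff, List.mem_append] at hc
    obtain ⟨w, hw, hw'⟩ := he hu fun x hx y hy => (hc x (Or.inl hx) y (Or.inl hy)).1
    obtain ⟨z, hz, hz'⟩ := hf hv fun x hx y hy => (hc x (Or.inr hx) y (Or.inr hy)).2
    exact ⟨w ++ z, Language.append_mem_mul hw hz, by rw [List.map_append]; exact hw'.append hz'⟩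
  | alt e f he hf =>
    obtain ⟨u, v, rfl, hu, hv⟩ := traces_append.1 h
    simp only [conflict, Bool.or_eq_false_iff, List.mem_append] at hc
    -- one of the two parts is empty: otherwise they have symbols in conflict
    rcases u with _ | ⟨x, u⟩
    · obtain ⟨w, hw, hw'⟩ := hf hv fun x hx y hy => (hc x (Or.inr hx) y (Or.inr hy)).2.2
      exact ⟨w, (Language.mem_add _ _ _).2 (Or.inr hw), hw'⟩
    rcases v with _ | ⟨y, v⟩
    · obtain ⟨w, hw, hw'⟩ := he hu fun x hx y hy => (hc x (Or.inl hx) y (Or.inl hy)).2.1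
      exact ⟨w, (Language.mem_add _ _ _).2 (Or.inl hw), by simpa using hw'⟩
    have h1 := traces_mem_labels hu x (by simp)
    have h2 := traces_mem_labels hv y (by simp)
    have := (hc x (by simp) y (by simp)).1
    simp [h1, h2] at this
  | star e he =>
    obtain ⟨w, hw, hr⟩ := e.exists_sublist_plus (traces_singleton.1 h).1
    refine ⟨w, ?_, hr⟩
    obtain ⟨u, hu, v, hv, rfl⟩ := Language.mem_mul.1 hw
    obtain ⟨L, rfl, hL⟩ := Language.mem_kstar.1 hv
    exact Language.mem_kstar.2 ⟨u :: L, rfl, by simpa using ⟨hu, hL⟩⟩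
  | opt e he =>
    obtain ⟨w, hw, hr⟩ := he h hc
    exact ⟨w, (Language.mem_add _ _ _).2 (Or.inr hw), hr⟩
  | plus e he => exact e.exists_sublist_plus (traces_singleton.1 h).1
  | hash es fs he hf =>
    obtain ⟨u, v, rfl, hu, hv⟩ := traces_append.1 h
    simp only [conflict, Bool.or_eq_false_iff, List.mem_append] at hc
    obtain ⟨w, hw, hw'⟩ := hl es (fun e h r => he e h) u hu fun x hx y hy =>
      (hc x (Or.inl hx) y (Or.inl hy)).1
    obtain ⟨z, hz, hz'⟩ := hl fs (fun e h r => hf e h) v hv fun x hx y hy =>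
      (hc x (Or.inr hx) y (Or.inr hy)).2
    exact ⟨w ++ z, (Language.mem_add _ _ _).2
      (Or.inl (Language.append_mem_mul hw (langCat_le_langOptCat _ hz))), by
        rw [List.map_append]; exact hw'.append hz'⟩

/-- The atoms with the flag `false` are single outer symbols. -/
theorem eq_singleton_of_mem_atoms {e : RegEx (Fin n)} {s : List ℕ} (h : (false, s) ∈ e.atoms) :
    ∃ x ∈ e.outerLabels, s = [x] := by
  have hl : ∀ es : List (RegEx (Fin n)),
      (∀ e ∈ es, (false, s) ∈ e.atoms → ∃ x ∈ e.outerLabels, s = [x]) →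
      (false, s) ∈ atomsList es → ∃ x ∈ (outerSymbolsList es).map Fin.val, s = [x] := by
    intro es
    induction es with
    | nil => simp [atomsList]
    | cons e es ih =>
      intro he hs
      rw [outerSymbolsList, List.map_append]
      rcases List.mem_append.1 hs with hs | hs
      · obtain ⟨x, hx, rfl⟩ := he e (by simp) hs
        exact ⟨x, List.mem_append_left _ hx, rfl⟩
      · obtain ⟨x, hx, rfl⟩ := ih (fun f hf => he f (by simp [hf])) hs
        exact ⟨x, List.mem_append_right _ hx, rfl⟩
  induction e using induction_on_lists with
  | eps => simp [atoms] at h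
  | sym a => simpa [atoms, outerLabels, outerSymbols] using h
  | cat e f he hf | alt e f he hf =>
    rw [outerLabels, outerSymbols, List.map_append]
    rcases List.mem_append.1 h with h | h
    · obtain ⟨x, hx, rfl⟩ := he h
      exact ⟨x, List.mem_append_left _ hx, rfl⟩
    · obtain ⟨x, hx, rfl⟩ := hf h
      exact ⟨x, List.mem_append_right _ hx, rfl⟩
  | star e he | plus e he => simp [atoms] at h
  | opt e he => exact he h
  | hash es fs he hf =>
    rw [outerLabels, outerSymbols, List.map_append]
    rcases List.mem_append.1 h with h | h
    · obtain ⟨x, hx, rfl⟩ := hl es he h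
      exact ⟨x, List.mem_append_left _ hx, rfl⟩
    · obtain ⟨x, hx, rfl⟩ := hl fs hf h
      exact ⟨x, List.mem_append_right _ hx, rfl⟩

end RegEx

end XPathSat

/-! ### Symbols that appear once -/

namespace XPathSat

namespace RegEx

variable {n : ℕ}

theorem mem_symbols_of_mem_outerSymbols {e : RegEx (Fin n)} {a : Fin n}
    (h : a ∈ e.outerSymbols) : a ∈ e.symbols := by
  have hl : ∀ es : List (RegEx (Fin n)), (∀ e ∈ es, a ∈ e.outerSymbols → a ∈ e.symbols) →
      a ∈ outerSymbolsList es → a ∈ symbolsList es := by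
    intro es
    induction es with
    | nil => simp [outerSymbolsList]
    | cons e es ih =>
      intro he h
      exact List.mem_append.2 ((List.mem_append.1 h).imp (he e (by simp))
        (ih fun f hf => he f (by simp [hf])))
  induction e using induction_on_lists with
  | eps => exact h
  | sym b => exact h
  | cat e f he hf | alt e f he hf =>
    exact List.mem_append.2 ((List.mem_append.1 h).imp he hf)
  | star e he | plus e he => simp [outerSymbols] at h
  | opt e he => exact he h
  | hash es fs he hf => exact List.mem_append.2 ((List.mem_append.1 h).imp (hl es he) (hl fs hf))

theorem mem_symbolsList_of_mem_outerSymbolsList {es : List (RegEx (Fin n))} {a : Fin n}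
    (h : a ∈ outerSymbolsList es) : a ∈ symbolsList es :=
  (List.mem_append.1 (mem_symbols_of_mem_outerSymbols (e := hash es [])
    (List.mem_append_left _ h))).elim id (by simp [symbolsList])

theorem not_mem_right_of_count_le {a : Fin n} {s s' : List (Fin n)} (h : (s ++ s').count a ≤ 1)
    (ha : a ∈ s) : a ∉ s' := by
  intro ha'
  have h1 := List.count_pos_iff.2 ha
  have h2 := List.count_pos_iff.2 ha'
  rw [List.count_append] at h
  omega

theorem not_mem_left_of_count_le {a : Fin n} {s s' : List (Fin n)} (h : (s ++ s').count a ≤ 1)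
    (ha : a ∈ s') : a ∉ s := fun h' => not_mem_right_of_count_le h h' ha

theorem count_left_le {a : Fin n} {s s' : List (Fin n)} (h : (s ++ s').count a ≤ 1) :
    s.count a ≤ 1 := by
  rw [List.count_append] at h
  omega

theorem count_right_le {a : Fin n} {s s' : List (Fin n)} (h : (s ++ s').count a ≤ 1) :
    s'.count a ≤ 1 := by
  rw [List.count_append] at h
  omega

/-- An outer symbol that appears once in `e` appears at most once in the words of `e`. -/
theorem count_le_one {e : RegEx (Fin n)} {a : Fin n} (ha : a ∈ e.outerSymbols)
    (hc : e.symbols.count a ≤ 1) {w : List (Fin n)} (hw : w ∈ e.lang) : w.count a ≤ 1 := by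
  -- concatenation: `o`, `o'` and `s`, `s'` are the outer symbols and symbols of the two parts
  have happ : ∀ o o' s s' u v : List (Fin n), (a ∈ o → s.count a ≤ 1 → u.count a ≤ 1) →
      (a ∈ o' → s'.count a ≤ 1 → v.count a ≤ 1) → (a ∈ o → a ∈ s) → (a ∈ o' → a ∈ s') →
      (a ∈ u → a ∈ s) → (a ∈ v → a ∈ s') → a ∈ o ++ o' → (s ++ s').count a ≤ 1 →
      (u ++ v).count a ≤ 1 := by
    intro o o' s s' u v h1 h2 h3 h4 h5 h6 h h'
    rw [List.count_append]
    rcases List.mem_append.1 h with h | h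
    · rw [List.count_eq_zero.2 fun hv => not_mem_right_of_count_le h' (h3 h) (h6 hv)]
      exact h1 h (count_left_le h')
    · rw [List.count_eq_zero.2 fun hu => not_mem_left_of_count_le h' (h4 h) (h5 hu), zero_add]
      exact h2 h (count_right_le h')
  have hl : ∀ es : List (RegEx (Fin n)), (∀ e ∈ es, a ∈ e.outerSymbols → e.symbols.count a ≤ 1 →
      ∀ w ∈ e.lang, w.count a ≤ 1) → ∀ w ∈ langOptCat es,
      a ∈ outerSymbolsList es → (symbolsList es).count a ≤ 1 → w.count a ≤ 1 := by
    intro es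
    induction es with
    | nil => simp [outerSymbolsList]
    | cons e es ih =>
      intro he w hw
      obtain ⟨u, hu, v, hv, rfl⟩ := Language.mem_mul.1 hw
      have hv' := ih (fun f hf => he f (by simp [hf])) v hv
      refine happ _ _ _ _ _ _ (fun h h' => ?_) hv' mem_symbols_of_mem_outerSymbols
        mem_symbolsList_of_mem_outerSymbolsList ?_ (mem_symbols_of_mem_langOptCat hv a)
      · rcases (Language.mem_add _ _ _).1 hu with hu | hu
        · rw [Language.mem_one] at hu
          simp [hu]
        · exact he e (by simp) h h' u hu
      · rcases (Language.mem_add _ _ _).1 hu with hu | hu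
        · rw [Language.mem_one] at hu
          simp [hu]
        · exact mem_symbols_of_mem hu a
  induction e using induction_on_lists generalizing w with
  | eps => simp [outerSymbols] at ha
  | sym b =>
    rw [lang] at hw
    obtain rfl := Set.mem_singleton_iff.1 hw
    exact hc
  | cat e f he hf =>
    obtain ⟨u, hu, v, hv, rfl⟩ := Language.mem_mul.1 hw
    exact happ _ _ _ _ _ _ (fun h h' => he h h' hu) (fun h h' => hf h h' hv)
      mem_symbols_of_mem_outerSymbols mem_symbols_of_mem_outerSymbols
      (mem_symbols_of_mem hu a) (mem_symbols_of_mem hv a) ha hc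
  | alt e f he hf =>
    rcases (Language.mem_add _ _ _).1 hw with hw | hw
    · have := happ e.outerSymbols f.outerSymbols e.symbols f.symbols w []
        (fun h h' => he h h' hw) (by simp)
        mem_symbols_of_mem_outerSymbols mem_symbols_of_mem_outerSymbols
        (mem_symbols_of_mem hw a) (by simp) ha hc
      simpa using this
    · exact happ e.outerSymbols f.outerSymbols e.symbols f.symbols [] w
        (by simp) (fun h h' => hf h h' hw)
        mem_symbols_of_mem_outerSymbols mem_symbols_of_mem_outerSymbols
        (by simp) (mem_symbols_of_mem hw a) ha hc
  | star e he | plus e he => simp [outerSymbols] at ha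
  | opt e he =>
    rcases (Language.mem_add _ _ _).1 hw with hw | hw
    · rw [Language.mem_one] at hw
      simp [hw]
    · exact he ha hc hw
  | hash es fs he hf =>
    obtain ⟨u, hu, v, hv, rfl⟩ := mem_langOptCat_of_mem_hash hw
    exact happ _ _ _ _ _ _ (hl es (fun e h h1 h2 w => he e h h1 h2) u hu)
      (hl fs (fun e h h1 h2 w => hf e h h1 h2) v hv)
      mem_symbolsList_of_mem_outerSymbolsList mem_symbolsList_of_mem_outerSymbolsList
      (mem_symbols_of_mem_langOptCat hu a) (mem_symbols_of_mem_langOptCat hv a) ha hc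

theorem mem_symbols_of_conflict {e : RegEx (Fin n)} {a b : Fin n} (h : e.conflict a b = true) :
    a ∈ e.symbols ∧ b ∈ e.symbols := by
  have hl : ∀ es : List (RegEx (Fin n)),
      (∀ e ∈ es, e.conflict a b = true → a ∈ e.symbols ∧ b ∈ e.symbols) →
      conflictList a b es = true → a ∈ symbolsList es ∧ b ∈ symbolsList es := by
    intro es
    induction es with
    | nil => simp [conflictList]
    | cons e es ih =>
      intro he h
      simp only [conflictList, Bool.or_eq_true] at h
      simp only [symbolsList, List.mem_append]
      rcases h with h | h
      · have := he e (by simp) h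
        tauto
      · have := ih (fun f hf => he f (by simp [hf])) h
        tauto
  induction e using induction_on_lists with
  | eps | sym _ | star _ _ | plus _ _ => simp [conflict] at h
  | cat e f he hf =>
    simp only [conflict, Bool.or_eq_true] at h
    simp only [symbols, List.mem_append]
    tauto
  | alt e f he hf =>
    simp only [conflict, Bool.or_eq_true, Bool.and_eq_true, decide_eq_true_eq, mem_labels] at h
    simp only [symbols, List.mem_append]
    tauto
  | opt e he => exact he h
  | hash es fs he hf =>
    simp only [conflict, Bool.or_eq_true] at h
    have h1 := hl es he
    have h2 := hl fs hf
    simp only [symbols, List.mem_append]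
    tauto

theorem mem_symbolsList_of_conflictList {es : List (RegEx (Fin n))} {a b : Fin n}
    (h : conflictList a b es = true) : a ∈ symbolsList es ∧ b ∈ symbolsList es := by
  have := mem_symbols_of_conflict (e := hash es []) (a := a) (b := b) (by simp [conflict, h])
  simpa [symbols, symbolsList] using this

/-- Symbols in conflict that appear once in `e` do not appear in the same word of `e`. -/
theorem not_mem_and_mem_of_conflict {e : RegEx (Fin n)} {a b : Fin n}
    (h : e.conflict a b = true) (ha : e.symbols.count a ≤ 1) (hb : e.symbols.count b ≤ 1)
    {w : List (Fin n)} (hw : w ∈ e.lang) : ¬(a ∈ w ∧ b ∈ w) := by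
  -- concatenation: `c`, `c'` and `s`, `s'` are the conflicts and symbols of the two parts
  have happ : ∀ (c c' : Bool) (s s' u v : List (Fin n)),
      (c = true → s.count a ≤ 1 → s.count b ≤ 1 → ¬(a ∈ u ∧ b ∈ u)) →
      (c' = true → s'.count a ≤ 1 → s'.count b ≤ 1 → ¬(a ∈ v ∧ b ∈ v)) →
      (c = true → a ∈ s ∧ b ∈ s) → (c' = true → a ∈ s' ∧ b ∈ s') →
      (∀ x ∈ u, x ∈ s) → (∀ x ∈ v, x ∈ s') → (c || c') = true → (s ++ s').count a ≤ 1 →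
      (s ++ s').count b ≤ 1 → ¬(a ∈ u ++ v ∧ b ∈ u ++ v) := by
    intro c c' s s' u v h1 h2 h3 h4 h5 h6 h ha hb
    simp only [List.mem_append]
    rcases Bool.or_eq_true_iff.1 h with h | h
    · have := h1 h (count_left_le ha) (count_left_le hb)
      have := fun hv => not_mem_right_of_count_le ha (h3 h).1 (h6 a hv)
      have := fun hv => not_mem_right_of_count_le hb (h3 h).2 (h6 b hv)
      tauto
    · have := h2 h (count_right_le ha) (count_right_le hb)
      have := fun hu => not_mem_left_of_count_le ha (h4 h).1 (h5 a hu)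
      have := fun hu => not_mem_left_of_count_le hb (h4 h).2 (h5 b hu)
      tauto
  have hl : ∀ es : List (RegEx (Fin n)), (∀ e ∈ es, e.conflict a b = true →
      e.symbols.count a ≤ 1 → e.symbols.count b ≤ 1 → ∀ w ∈ e.lang, ¬(a ∈ w ∧ b ∈ w)) →
      ∀ w ∈ langOptCat es, conflictList a b es = true →
      (symbolsList es).count a ≤ 1 → (symbolsList es).count b ≤ 1 → ¬(a ∈ w ∧ b ∈ w) := by
    intro es
    induction es with
    | nil => simp [conflictList]
    | cons e es ih =>
      intro he w hw
      obtain ⟨u, hu, v, hv, rfl⟩ := Language.mem_mul.1 hw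
      have hv' := ih (fun f hf => he f (by simp [hf])) v hv
      refine happ _ _ _ _ _ _ (fun h h1 h2 => ?_) hv' mem_symbols_of_conflict
        mem_symbolsList_of_conflictList ?_ (mem_symbols_of_mem_langOptCat hv)
      · rcases (Language.mem_add _ _ _).1 hu with hu | hu
        · rw [Language.mem_one] at hu
          simp [hu]
        · exact he e (by simp) h h1 h2 u hu
      · rcases (Language.mem_add _ _ _).1 hu with hu | hu
        · rw [Language.mem_one] at hu
          simp [hu]
        · exact mem_symbols_of_mem hu
  induction e using induction_on_lists generalizing w with
  | eps | sym _ | star _ _ | plus _ _ => simp [conflict] at h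
  | cat e f he hf =>
    obtain ⟨u, hu, v, hv, rfl⟩ := Language.mem_mul.1 hw
    exact happ _ _ _ _ _ _ (fun h h1 h2 => he h h1 h2 hu) (fun h h1 h2 => hf h h1 h2 hv)
      mem_symbols_of_conflict mem_symbols_of_conflict
      (mem_symbols_of_mem hu) (mem_symbols_of_mem hv) h ha hb
  | alt e f he hf =>
    simp only [conflict, Bool.or_eq_true, Bool.and_eq_true, decide_eq_true_eq, mem_labels] at h
    simp only [symbols] at ha hb
    rcases h with ⟨h1, h2⟩ | h
    · rcases (Language.mem_add _ _ _).1 hw with hw | hw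
      · exact fun h => not_mem_left_of_count_le hb h2 (mem_symbols_of_mem hw b h.2)
      · exact fun h => not_mem_right_of_count_le ha h1 (mem_symbols_of_mem hw a h.1)
    · rw [← Bool.or_eq_true] at h
      rcases (Language.mem_add _ _ _).1 hw with hw | hw
      · have := happ _ _ e.symbols f.symbols w [] (fun h h1 h2 => he h h1 h2 hw) (by simp)
          mem_symbols_of_conflict mem_symbols_of_conflict
          (mem_symbols_of_mem hw) (by simp) h ha hb
        simpa using this
      · exact happ _ _ e.symbols f.symbols [] w (by simp) (fun h h1 h2 => hf h h1 h2 hw)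
          mem_symbols_of_conflict mem_symbols_of_conflict
          (by simp) (mem_symbols_of_mem hw) h ha hb
  | opt e he =>
    rcases (Language.mem_add _ _ _).1 hw with hw | hw
    · rw [Language.mem_one] at hw
      simp [hw]
    · exact he h ha hb hw
  | hash es fs he hf =>
    obtain ⟨u, hu, v, hv, rfl⟩ := mem_langOptCat_of_mem_hash hw
    exact happ _ _ _ _ _ _ (hl es (fun e h h1 h2 h3 w => he e h h1 h2 h3) u hu)
      (hl fs (fun e h h1 h2 h3 w => hf e h h1 h2 h3) v hv)
      mem_symbolsList_of_conflictList mem_symbolsList_of_conflictList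
      (mem_symbols_of_mem_langOptCat hu) (mem_symbols_of_mem_langOptCat hv) h ha hb

/-- There is no disjunction outside the scope of `*` and `+` in a `DC^{?+#}` expression. -/
theorem conflict_eq_false_of_isDC {e : RegEx (Fin n)} (h : e.IsDC) (a b : ℕ) :
    e.conflict a b = false := by
  have hl : ∀ es : List (RegEx (Fin n)), (∀ e ∈ es, e.IsDC → e.conflict a b = false) →
      IsDCList es → conflictList a b es = false := by
    intro es
    induction es with
    | nil => simp [conflictList]
    | cons e es ih =>
      intro he h
      simp [conflictList, he e (by simp) h.1, ih (fun f hf => he f (by simp [hf])) h.2]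
  induction e using induction_on_lists with
  | eps | sym _ | star _ _ | plus _ _ => rfl
  | cat e f he hf => simp [conflict, he h.1, hf h.2]
  | alt e f he hf => exact h.elim
  | opt e he => exact he h
  | hash es fs he hf => simp [conflict, hl es he h.1, hl fs hf h.2]

theorem exists_factor_of_conflict {e : RegEx (Fin n)} {a b : ℕ} (h : e.conflict a b = true) :
    ∃ f ∈ e.factors, f.conflict a b = true := by
  induction e using induction_on_lists with
  | cat e f he hf =>
    simp only [conflict, Bool.or_eq_true] at h
    rcases h with h | h
    · obtain ⟨g, hg, h⟩ := he h
      exact ⟨g, List.mem_append_left _ hg, h⟩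
    · obtain ⟨g, hg, h⟩ := hf h
      exact ⟨g, List.mem_append_right _ hg, h⟩
  | _ => exact ⟨_, List.mem_singleton_self _, h⟩

/-- In RW expressions, symbols in conflict do not appear in the same word. -/
theorem IsRW.not_mem_and_mem {e : RegEx (Fin n)} (he : e.IsRW) {a b : Fin n}
    (h : e.conflict a b = true) {w : List (Fin n)} (hw : w ∈ e.lang) : ¬(a ∈ w ∧ b ∈ w) := by
  obtain ⟨f, hf, hc⟩ := exists_factor_of_conflict h
  rcases he f hf with hdc | hu
  · rw [conflict_eq_false_of_isDC hdc] at hc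
    cases hc
  · obtain ⟨h1, h2⟩ := mem_symbols_of_conflict hc
    exact not_mem_and_mem_of_conflict h (hu a h1).le (hu b h2).le hw

end RegEx

end XPathSat

/-! ### Patterns in trees -/

namespace XPathSat

variable {n : ℕ}

namespace XmlTree

/-- The trees below the root. -/
def kids {α : Type} : XmlTree α → List (XmlTree α)
  | node _ ts => ts

/-- The root label as a number. -/
def rootNum (t : XmlTree (Fin n)) : ℕ := t.rootLabel

theorem subtree?_append {α : Type} (t : XmlTree α) (u v : List ℕ) :
    t.subtree? (u ++ v) = (t.subtree? u).bind fun s => s.subtree? v := by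
  induction u generalizing t with
  | nil => simp [show t.subtree? [] = some t by rcases t; simp [subtree?]]
  | cons i u ih =>
    rcases t with ⟨a, ts⟩
    simp only [List.cons_append, subtree?]
    cases ts[i]? <;> simp [ih]

theorem subtree?_singleton {α : Type} (t : XmlTree α) (i : ℕ) :
    t.subtree? [i] = t.kids[i]? := by
  rcases t with ⟨a, ts⟩
  simp only [subtree?, kids]
  cases ts[i]? with
  | none => rfl
  | some s => rcases s with ⟨b, ss⟩; simp

theorem subtree?_nil {α : Type} (t : XmlTree α) : t.subtree? [] = some t := by
  rcases t with ⟨a, ts⟩; simp [subtree?]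

end XmlTree

open XmlTree

/-- The words of the labels of the children are as required, at all nodes of the tree. -/
def DTD.Valid (D : DTD) (t : XmlTree (Fin D.numLabels)) : Prop :=
  ∀ w a ts, t.subtree? w = some (XmlTree.node a ts) →
    ts.map XmlTree.rootLabel ∈ (D.content a).lang

theorem DTD.Valid.subtree {D : DTD} {t s : XmlTree (Fin D.numLabels)} (h : D.Valid t) {u : List ℕ}
    (hs : t.subtree? u = some s) : D.Valid s := by
  intro w a ts hw
  refine h (u ++ w) a ts ?_
  rw [subtree?_append, hs]
  exact hw

theorem DTD.valid_node {D : DTD} {a : Fin D.numLabels} {ts : List (XmlTree (Fin D.numLabels))} :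
    D.Valid (node a ts) ↔ ts.map rootLabel ∈ (D.content a).lang ∧ ∀ t ∈ ts, D.Valid t := by
  constructor
  · refine fun h => ⟨h [] a ts (subtree?_nil _), fun t ht => ?_⟩
    obtain ⟨i, hi⟩ := List.mem_iff_getElem?.1 ht
    exact h.subtree (u := [i]) (by rw [subtree?_singleton]; exact hi)
  · rintro ⟨h1, h2⟩ w b ss hw
    rcases w with _ | ⟨i, w⟩
    · rw [subtree?_nil] at hw
      cases hw
      exact h1
    · simp only [subtree?] at hw
      obtain ⟨t, ht, hw⟩ := Option.bind_eq_some_iff.1 hw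
      exact h2 t (List.mem_of_getElem? ht) w b ss hw

namespace Pat

/-- The edges of a pattern node are satisfied at the node of the tree with address `w`. -/
def HoldsAtNode (t : XmlTree (Fin n)) : Pat → List ℕ → Prop
  | nil, _ => True
  | edge χ l E R, w => (∃ w', (t.subtree? w).isSome ∧ χ.Rel w w' ∧
      (t.label? w').map Fin.val = some l ∧ HoldsAtNode t E w') ∧ HoldsAtNode t R w

/-- The edges of a pattern node are satisfied at the root of the `i`-th tree of a list of sibling
trees. -/
def HoldsAt : Pat → List (XmlTree (Fin n)) → ℕ → Prop
  | nil, _, _ => True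
  | edge Axis.child l E R, h, i => (∃ t, h[i]? = some t ∧ ∃ j t', t.kids[j]? = some t' ∧
      t'.rootNum = l ∧ HoldsAt E t.kids j) ∧ HoldsAt R h i
  | edge Axis.followingSibling l E R, h, i => (∃ j t', i < j ∧ h[j]? = some t' ∧
      t'.rootNum = l ∧ HoldsAt E h j) ∧ HoldsAt R h i
  | edge Axis.precedingSibling l E R, h, i => (∃ j t', j < i ∧ h[j]? = some t' ∧
      t'.rootNum = l ∧ HoldsAt E h j) ∧ HoldsAt R h i

/-- The child edges of a pattern node are satisfied at the root of the tree. -/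
def HoldsBelow : Pat → XmlTree (Fin n) → Prop
  | nil, _ => True
  | edge Axis.child l E R, t => (∃ j t', t.kids[j]? = some t' ∧
      t'.rootNum = l ∧ HoldsAt E t.kids j) ∧ HoldsBelow R t
  | edge Axis.followingSibling _ _ R, t => HoldsBelow R t
  | edge Axis.precedingSibling _ _ R, t => HoldsBelow R t

theorem holdsAtNode_toPat {t : XmlTree (Fin n)} {p : XPath (Fin n)} {k r : Pat} {w : List ℕ} :
    HoldsAtNode t (p.toPat k r) w ↔ (∃ w', p.Holds t w w' ∧ HoldsAtNode t k w') ∧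
      HoldsAtNode t r w := by
  induction p generalizing k r w with
  | step χ l =>
    have hl : ∀ o : Option (Fin n), o.map Fin.val = some (l : ℕ) ↔ o = some l := by
      intro o
      cases o <;> simp [Fin.val_inj]
    simp only [XPath.toPat, HoldsAtNode, XPath.Holds, and_assoc, hl]
  | comp p q hp hq =>
    simp only [XPath.toPat, hp, hq, XPath.Holds, HoldsAtNode, and_true]
    refine and_congr_left' ⟨?_, ?_⟩
    · rintro ⟨w', h1, w'', h2, h3⟩
      exact ⟨w'', ⟨w', h1, h2⟩, h3⟩
    · rintro ⟨w'', ⟨w', h1, h2⟩, h3⟩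
      exact ⟨w', h1, w'', h2, h3⟩
  | filter p q hp hq =>
    simp only [XPath.toPat, hp, hq, XPath.Holds, HoldsAtNode, and_true, and_assoc]

theorem holdsAtNode_append_singleton {t s : XmlTree (Fin n)} {u : List ℕ} {i : ℕ} {E : Pat}
    (hs : t.subtree? u = some s) (hi : i < s.kids.length) :
    HoldsAtNode t E (u ++ [i]) ↔ HoldsAt E s.kids i := by
  have hsub : ∀ (t s : XmlTree (Fin n)) (u : List ℕ) (j : ℕ), t.subtree? u = some s →
      t.subtree? (u ++ [j]) = s.kids[j]? := by
    intro t s u j hs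
    rw [subtree?_append, hs]
    exact subtree?_singleton s j
  have hlab : ∀ (t s : XmlTree (Fin n)) (u : List ℕ) (j l : ℕ), t.subtree? u = some s →
      ((t.label? (u ++ [j])).map Fin.val = some l ↔
        ∃ t', s.kids[j]? = some t' ∧ t'.rootNum = l) := by
    intro t s u j l hs
    rw [label?, hsub t s u j hs]
    cases s.kids[j]? <;> simp [rootNum]
  have hlt : ∀ (s t' : XmlTree (Fin n)) (j : ℕ), s.kids[j]? = some t' → j < s.kids.length :=
    fun s t' j h => (List.getElem?_eq_some_iff.1 h).1
  induction E generalizing u i s with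
  | nil => simp [HoldsAtNode, HoldsAt]
  | edge χ l E R hE hR =>
    obtain ⟨t₁, ht₁⟩ : ∃ t₁, s.kids[i]? = some t₁ := ⟨_, List.getElem?_eq_getElem hi⟩
    have ht := (hsub t s u i hs).trans ht₁
    cases χ <;> rw [HoldsAtNode, HoldsAt] <;> refine and_congr ⟨?_, ?_⟩ (hR hs hi)
    · rintro ⟨_, -, ⟨j, rfl⟩, h2, h3⟩
      obtain ⟨t', h4, h5⟩ := (hlab t t₁ _ j l ht).1 h2
      exact ⟨t₁, ht₁, j, t', h4, h5, (hE ht (hlt _ _ _ h4)).1 h3⟩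
    · rintro ⟨t₂, ht₂, j, t', h4, h5, h6⟩
      obtain rfl : t₁ = t₂ := Option.some.inj (ht₁.symm.trans ht₂)
      exact ⟨_, by simp [ht], ⟨j, rfl⟩, (hlab t t₁ _ j l ht).2 ⟨t', h4, h5⟩,
        (hE ht (hlt _ _ _ h4)).2 h6⟩
    · rintro ⟨_, -, ⟨u', i', j, h1, rfl, hij⟩, h2, h3⟩
      obtain ⟨rfl, h0⟩ := List.append_inj' h1 rfl
      obtain rfl : i = i' := by simpa using h0
      obtain ⟨t', h4, h5⟩ := (hlab t s _ j l hs).1 h2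
      exact ⟨j, t', hij, h4, h5, (hE hs (hlt _ _ _ h4)).1 h3⟩
    · rintro ⟨j, t', hij, h4, h5, h6⟩
      exact ⟨_, by simp [ht], ⟨u, i, j, rfl, rfl, hij⟩, (hlab t s _ j l hs).2 ⟨t', h4, h5⟩,
        (hE hs (hlt _ _ _ h4)).2 h6⟩
    · rintro ⟨_, -, ⟨u', i', j, h1, rfl, hij⟩, h2, h3⟩
      obtain ⟨rfl, h0⟩ := List.append_inj' h1 rfl
      obtain rfl : i = i' := by simpa using h0
      obtain ⟨t', h4, h5⟩ := (hlab t s _ j l hs).1 h2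
      exact ⟨j, t', hij, h4, h5, (hE hs (hlt _ _ _ h4)).1 h3⟩
    · rintro ⟨j, t', hij, h4, h5, h6⟩
      exact ⟨_, by simp [ht], ⟨u, i, j, rfl, rfl, hij⟩, (hlab t s _ j l hs).2 ⟨t', h4, h5⟩,
        (hE hs (hlt _ _ _ h4)).2 h6⟩

/-- The root has no siblings. -/
theorem holdsAtNode_nil {t : XmlTree (Fin n)} {E : Pat} :
    HoldsAtNode t E [] ↔ E.siblings = [] ∧ E.HoldsBelow t := by
  induction E with
  | nil => simp [HoldsAtNode, siblings, HoldsBelow]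
  | edge χ l E R _ hR =>
    cases χ
    · rw [HoldsAtNode, HoldsBelow, hR, siblings]
      simp only [Axis.isChild, cond_true]
      rw [and_left_comm]
      refine and_congr_right' (and_congr_left' ⟨?_, ?_⟩)
      · rintro ⟨_, -, ⟨j, rfl⟩, h2, h3⟩
        rw [List.nil_append, label?, subtree?_singleton] at h2
        cases hj : t.kids[j]? with
        | none => simp [hj] at h2
        | some t' =>
          refine ⟨j, t', hj, by simpa [hj, rootNum] using h2, ?_⟩
          exact (holdsAtNode_append_singleton (subtree?_nil t)
            (List.getElem?_eq_some_iff.1 hj).1).1 h3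
      · rintro ⟨j, t', h4, h5, h6⟩
        refine ⟨_, by simp [subtree?_nil], ⟨j, rfl⟩, ?_,
          (holdsAtNode_append_singleton (subtree?_nil t)
            (List.getElem?_eq_some_iff.1 h4).1).2 h6⟩
        rw [List.nil_append, label?, subtree?_singleton, h4]
        simpa [rootNum] using h5
    all_goals
      rw [HoldsAtNode, siblings]
      simp [Axis.isChild, Axis.Rel]

end Pat

/-- There is a valid tree with root label `a` in which the child edges of `E` are satisfied at the
root. -/
def DTD.Realizes (D : DTD) (a : ℕ) (E : Pat) : Prop :=
  ∃ t : XmlTree (Fin D.numLabels), t.rootNum = a ∧ D.Valid t ∧ E.HoldsBelow t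

theorem satisfiable_iff {D : DTD} {p : XPath (Fin D.numLabels)} :
    p.Satisfiable D ↔ (p.toPat Pat.nil Pat.nil).siblings = [] ∧
      D.Realizes D.root (p.toPat Pat.nil Pat.nil) := by
  have h : ∀ t : XmlTree (Fin D.numLabels), (∃ w, p.Holds t [] w) ↔
      (p.toPat Pat.nil Pat.nil).siblings = [] ∧ (p.toPat Pat.nil Pat.nil).HoldsBelow t := by
    intro t
    rw [← Pat.holdsAtNode_nil, Pat.holdsAtNode_toPat]
    simp [Pat.HoldsAtNode]
  simp only [XPath.Satisfiable, h, DTD.Realizes, DTD.Conforms, rootNum, Fin.val_inj]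
  constructor
  · rintro ⟨t, ⟨h1, h2⟩, h3, h4⟩
    exact ⟨h3, t, h1, h2, h4⟩
  · rintro ⟨h3, t, h1, h2, h4⟩
    exact ⟨t, ⟨h1, h2⟩, h3, h4⟩

/-! ### Satisfied patterns pass the tests -/

namespace Pat

theorem holdsBelow_down {E : Pat} {t : XmlTree (Fin n)} : E.down.HoldsBelow t ↔ E.HoldsBelow t := by
  induction E with
  | nil => rfl
  | edge χ l E R _ hR => cases χ <;> simp [down, Axis.isChild, HoldsBelow, hR]

theorem holdsBelow_append {E E' : Pat} {t : XmlTree (Fin n)} :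
    (E.append E').HoldsBelow t ↔ E.HoldsBelow t ∧ E'.HoldsBelow t := by
  induction E with
  | nil => simp [append, HoldsBelow]
  | edge χ l E R _ hR => cases χ <;> simp [append, HoldsBelow, hR, and_assoc]

theorem HoldsAt.holdsBelow {E : Pat} {h : List (XmlTree (Fin n))} {i : ℕ} {t : XmlTree (Fin n)}
    (hE : E.HoldsAt h i) (ht : h[i]? = some t) : E.HoldsBelow t := by
  induction E with
  | nil => trivial
  | edge χ l E R _ hR =>
    cases χ <;> rw [HoldsAt] at hE <;> rw [HoldsBelow]
    · refine ⟨?_, hR hE.2⟩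
      obtain ⟨t', ht', h1⟩ := hE.1
      obtain rfl := Option.some.inj (ht.symm.trans ht')
      exact h1
    · exact hR hE.2
    · exact hR hE.2

theorem HoldsAt.exists_of_mem_siblings {E : Pat} {h : List (XmlTree (Fin n))} {i : ℕ}
    (hE : E.HoldsAt h i) : ∀ x ∈ E.siblings, ∃ (j : ℕ) (t : XmlTree (Fin n)), h[j]? = some t ∧
      t.rootNum = x.1 ∧ x.2.HoldsBelow t := by
  induction E generalizing i with
  | nil => simp [siblings]
  | edge χ l E R ihE ihR =>
    intro x hx
    rw [siblings] at hx
    cases χ <;> simp only [Axis.isChild, cond_true, cond_false] at hx <;> rw [HoldsAt] at hE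
    · exact ihR hE.2 x hx
    all_goals
      obtain ⟨⟨j, t, -, h1, h2, h3⟩, h4⟩ := hE
      rcases List.mem_cons.1 hx with rfl | hx
      · exact ⟨j, t, h1, h2, holdsBelow_down.2 (h3.holdsBelow h1)⟩
      · rcases List.mem_append.1 hx with hx | hx
        · exact ihE h3 x hx
        · exact ihR h4 x hx

theorem HoldsBelow.exists_of_mem_offspring {E : Pat} {t : XmlTree (Fin n)}
    (hE : E.HoldsBelow t) : ∀ x ∈ E.offspring, ∃ (j : ℕ) (s : XmlTree (Fin n)),
      t.kids[j]? = some s ∧ s.rootNum = x.1 ∧ x.2.HoldsBelow s := by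
  induction E with
  | nil => simp [offspring]
  | edge χ l E R ihE ihR =>
    intro x hx
    rw [offspring] at hx
    cases χ <;> simp only [Axis.isChild, cond_true, cond_false] at hx <;> rw [HoldsBelow] at hE
    · obtain ⟨⟨j, s, h1, h2, h3⟩, h4⟩ := hE
      rcases List.mem_cons.1 hx with rfl | hx
      · exact ⟨j, s, h1, h2, holdsBelow_down.2 (h3.holdsBelow h1)⟩
      · rcases List.mem_append.1 hx with hx | hx
        · exact h3.exists_of_mem_siblings x hx
        · exact ihR h4 x hx
    all_goals exact ihR hE x hx

end Pat

theorem fst_lt_of_mem_numberSlots {S : List (Bool × List ℕ)} {p : Slot} (hp : p ∈ numberSlots S) :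
    p.1 < S.length := by
  induction S with
  | nil => simp [numberSlots] at hp
  | cons s S ih =>
    rcases List.mem_cons.1 hp with rfl | hp
    · simp
    · exact (ih hp).trans (by simp)

/-- A word that is made of words of the atoms has its symbols at slots from left to right. -/
theorem exists_slots_of_traces {S : List (Bool × List ℕ)} {w : List ℕ} (h : Traces S w) :
    ∃ φ : ℕ → Slot, (∀ i x, w[i]? = some x → x ∈ (φ i).2.2 ∧ φ i ∈ numberSlots S) ∧
      ∀ i j, i < j → j < w.length → (φ i).before (φ j) = true := by
  induction S generalizing w with
  | nil =>
    rw [Traces] at h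
    subst h
    exact ⟨fun _ => (0, false, []), by simp, by simp⟩
  | cons s S ih =>
    obtain ⟨u, v, rfl, h1, h2, h3⟩ := h
    obtain ⟨φ, hφ1, hφ2⟩ := ih h3
    refine ⟨fun i => if i < u.length then (S.length, s) else φ (i - u.length), ?_, ?_⟩
    · intro i x hx
      by_cases hi : i < u.length
      · rw [List.getElem?_append_left hi] at hx
        simp only [if_pos hi]
        exact ⟨h1 x (List.mem_of_getElem? hx), by simp [numberSlots]⟩
      · rw [List.getElem?_append_right (by omega)] at hx
        simp only [if_neg hi]
        obtain ⟨h4, h5⟩ := hφ1 _ x hx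
        exact ⟨h4, by simp [numberSlots, h5]⟩
    · intro i j hij hj
      rw [List.length_append] at hj
      by_cases hi : i < u.length
      · simp only [if_pos hi]
        by_cases hj' : j < u.length
        · simp only [if_pos hj', Slot.before]
          cases hs : s.1 with
          | true => simp
          | false =>
            have := h2 hs
            omega
        · simp only [if_neg hj', Slot.before]
          have h4 : (φ (j - u.length)).1 < S.length :=
            fst_lt_of_mem_numberSlots (hφ1 _ _ (List.getElem?_eq_getElem (by omega))).2
          simp [h4]
      · simp only [if_neg hi, if_neg (show ¬j < u.length by omega)]
        exact hφ2 _ _ (by omega) (by omega)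

namespace Pat

variable {S : List Slot} {h : List (XmlTree (Fin n))} {φ : ℕ → Slot}

theorem HoldsAt.mem_feasible
    (h1 : ∀ i x, (h.map rootNum)[i]? = some x → x ∈ (φ i).2.2 ∧ φ i ∈ S)
    (h2 : ∀ i j, i < j → j < h.length → (φ i).before (φ j) = true) {E : Pat} {i : ℕ}
    (hi : i < h.length) (hE : E.HoldsAt h i) : φ i ∈ E.feasible S := by
  induction E generalizing i with
  | nil => exact (h1 i _ (List.getElem?_eq_getElem (by simpa using hi))).2
  | edge χ l E R ihE ihR =>
    cases χ <;> rw [HoldsAt] at hE <;>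
      simp only [feasible, Axis.isChild, Axis.isFollowing, cond_true, cond_false]
    · exact ihR hi hE.2
    all_goals
      obtain ⟨⟨j, t, h3, h4, h5, h6⟩, h7⟩ := hE
      have hj := (List.getElem?_eq_some_iff.1 h4).1
      have hl := (h1 j l (by simp [h4, h5])).1
      refine List.mem_filter.2 ⟨ihR hi h7, List.any_eq_true.2 ⟨φ j, ihE hj h6, ?_⟩⟩
    · simp [hl, h2 i j h3 hj]
    · simp [hl, h2 j i h3 hi]

theorem HoldsBelow.placeable {t : XmlTree (Fin n)}
    (h1 : ∀ i x, (t.kids.map rootNum)[i]? = some x → x ∈ (φ i).2.2 ∧ φ i ∈ S)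
    (h2 : ∀ i j, i < j → j < t.kids.length → (φ i).before (φ j) = true) {E : Pat}
    (hE : E.HoldsBelow t) : E.placeable S = true := by
  induction E with
  | nil => rfl
  | edge χ l E R ihE ihR =>
    cases χ <;> rw [HoldsBelow] at hE <;>
      simp only [Pat.placeable, Axis.isChild, cond_true, cond_false]
    · obtain ⟨⟨j, s, h4, h5, h6⟩, h7⟩ := hE
      have hl := (h1 j l (by simp [h4, h5])).1
      rw [Bool.and_eq_true, List.any_eq_true]
      exact ⟨⟨φ j, h6.mem_feasible h1 h2 (List.getElem?_eq_some_iff.1 h4).1, by simp [hl]⟩, ihR h7⟩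
    all_goals exact ihR hE

end Pat

end XPathSat

namespace XPathSat

open XmlTree

variable {n : ℕ}

/-- A property of pattern nodes that is preserved by merging holds after it. -/
theorem mergeNode_forall {o : List ℕ} {p : ℕ × Pat → Prop}
    (hp : ∀ l ∈ o, ∀ E E', p (l, E) → p (l, E') → p (l, E.append E')) {x : ℕ × Pat}
    {c : List (ℕ × Pat)} (hx : p x) (hc : ∀ y ∈ c, p y) : ∀ y ∈ mergeNode o x c, p y := by
  induction c with
  | nil => simpa [mergeNode] using hx
  | cons y c ih =>
    have hy := hc y (by simp)
    have hc := fun z hz => hc z (List.mem_cons_of_mem y hz)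
    rw [mergeNode]
    cases h : decide (x.1 = y.1) && decide (x.1 ∈ o) with
    | true =>
      simp only [Bool.and_eq_true, decide_eq_true_eq] at h
      obtain ⟨h1, h2⟩ := h
      exact List.forall_mem_cons.2 ⟨hp y.1 (h1 ▸ h2) x.2 y.2 (h1 ▸ hx) hy, hc⟩
    | false => exact List.forall_mem_cons.2 ⟨hy, ih hc⟩

theorem mergeNodes_forall {o : List ℕ} {p : ℕ × Pat → Prop}
    (hp : ∀ l ∈ o, ∀ E E', p (l, E) → p (l, E') → p (l, E.append E')) {g : List (ℕ × Pat)}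
    (hg : ∀ x ∈ g, p x) : ∀ x ∈ mergeNodes o g, p x := by
  induction g with
  | nil => simp [mergeNodes]
  | cons x g ih => exact mergeNode_forall hp (hg x (by simp)) (ih fun y hy => hg y (by simp [hy]))

theorem exists_mem_of_mem_mergeNodes {o : List ℕ} {g : List (ℕ × Pat)} :
    ∀ x ∈ mergeNodes o g, ∃ y ∈ g, y.1 = x.1 :=
  mergeNodes_forall (fun _ _ _ _ h _ => h) fun x hx => ⟨x, hx, rfl⟩

theorem eq_of_count_rootLabel_le_one {ts : List (XmlTree (Fin n))} {s s' : XmlTree (Fin n)}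
    (hs : s ∈ ts) (hs' : s' ∈ ts) (h : s.rootLabel = s'.rootLabel)
    (hc : (ts.map rootLabel).count s.rootLabel ≤ 1) : s = s' := by
  induction ts with
  | nil => simp at hs
  | cons t ts ih =>
    rw [List.map_cons, List.count_cons] at hc
    have hpos : ∀ u : XmlTree (Fin n), u ∈ ts → u.rootLabel = s.rootLabel →
        0 < (ts.map rootLabel).count s.rootLabel := fun u hu hus =>
      List.count_pos_iff.2 (List.mem_map.2 ⟨u, hu, hus⟩)
    rcases List.mem_cons.1 hs with rfl | hs₁
    · rcases List.mem_cons.1 hs' with rfl | hs'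
      · rfl
      · have := hpos s' hs' h.symm
        simp at hc
        omega
    · rcases List.mem_cons.1 hs' with rfl | hs'
      · have := hpos s hs₁ rfl
        simp [h] at hc
        rw [h] at this
        omega
      · exact ih hs₁ hs' (by omega)

/-- If the child edges of a pattern node are satisfied in some tree, then they pass the tests, and
the merged offspring can be realized. -/
theorem fits_of_realizes {D : DTD} {a : Fin D.numLabels} {E : Pat} (ha : (D.content a).IsMRW)
    (h : D.Realizes a E) : fits (D.content a) E = true ∧
      ∀ x ∈ mergeNodes (D.content a).outerLabels E.offspring, D.Realizes x.1 x.2 := by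
  obtain ⟨t, hta, hval, hE⟩ := h
  rcases t with ⟨a', ts⟩
  obtain rfl : a' = a := Fin.val_injective hta
  obtain ⟨hw, hts⟩ := DTD.valid_node.1 hval
  have hmap : ts.map rootNum = (ts.map rootLabel).map Fin.val := by
    rw [List.map_map]
    rfl
  have hoff := hE.exists_of_mem_offspring
  refine ⟨?_, ?_⟩
  · rw [fits, Bool.and_eq_true]
    constructor
    · obtain ⟨φ, h1, h2⟩ := exists_slots_of_traces (RegEx.traces_of_mem hw)
      rw [← hmap] at h1 h2
      simp only [List.length_map] at h2
      exact Pat.HoldsBelow.placeable (t := node a' ts) (φ := φ) h1 h2 hE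
    · rw [List.all_eq_true]
      intro x hx
      rw [List.all_eq_true]
      intro y hy
      obtain ⟨i, s, hs1, hs2, -⟩ := hoff x hx
      obtain ⟨j, s', hs1', hs2', -⟩ := hoff y hy
      rw [← hs2, ← hs2']
      by_contra hc
      rw [Bool.not_eq_true', Bool.not_eq_false] at hc
      exact ha.1.not_mem_and_mem hc hw ⟨List.mem_map_of_mem (List.mem_of_getElem? hs1),
        List.mem_map_of_mem (List.mem_of_getElem? hs1')⟩
  · -- `τ l` is a child with label `l`; it is the only one if `l` is an outer label
    let τ : ℕ → XmlTree (Fin D.numLabels) := fun l =>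
      if h : ∃ s ∈ ts, s.rootNum = l then h.choose else node a' ts
    have hτ : ∀ s ∈ ts, s.rootNum ∈ (D.content a').outerLabels → τ s.rootNum = s := by
      intro s hs ho
      have hex : ∃ s' ∈ ts, s'.rootNum = s.rootNum := ⟨s, hs, rfl⟩
      have h1 := hex.choose_spec
      simp only [τ, dif_pos hex]
      have ho' := RegEx.mem_outerLabels.1 ho
      refine (eq_of_count_rootLabel_le_one hs h1.1 (Fin.val_injective h1.2).symm ?_).symm
      exact RegEx.count_le_one ho' (ha.2 _ ho').le hw
    have hall := mergeNodes_forall (o := (D.content a').outerLabels)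
      (p := fun x => (x.1 ∈ (D.content a').outerLabels → x.2.HoldsBelow (τ x.1)) ∧
        (x.1 ∉ (D.content a').outerLabels → D.Realizes x.1 x.2))
      (fun l hl E E' h h' => ⟨fun ho => Pat.holdsBelow_append.2 ⟨h.1 ho, h'.1 ho⟩,
        fun ho => absurd hl ho⟩) (g := E.offspring) ?_
    · intro x hx
      by_cases ho : x.1 ∈ (D.content a').outerLabels
      · obtain ⟨z, hz, h⟩ := exists_mem_of_mem_mergeNodes x hx
        obtain ⟨j, s, hs1, hs2, -⟩ := hoff z hz
        have hs := List.mem_of_getElem? hs1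
        have hsx := hs2.trans h
        have h1 := (hall x hx).1 ho
        rw [← hsx] at ho h1
        rw [hτ s hs ho] at h1
        exact ⟨s, hsx, hts s hs, h1⟩
      · exact (hall x hx).2 ho
    · intro x hx
      obtain ⟨j, s, hs1, hs2, hs3⟩ := hoff x hx
      have hs := List.mem_of_getElem? hs1
      refine ⟨fun ho => ?_, fun _ => ⟨s, hs2, hts s hs, hs3⟩⟩
      rw [← hs2] at ho ⊢
      rwa [hτ s hs ho]

/-! ### Patterns that pass the tests can be satisfied -/

theorem mem_mergeNode_of_not_mem {o : List ℕ} {x y : ℕ × Pat} {c : List (ℕ × Pat)}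
    (hy : y.1 ∉ o) (h : y = x ∨ y ∈ c) : y ∈ mergeNode o x c := by
  induction c with
  | nil => simpa [mergeNode] using h
  | cons z c ih =>
    rw [mergeNode]
    cases hxz : decide (x.1 = z.1) && decide (x.1 ∈ o) with
    | true =>
      simp only [Bool.and_eq_true, decide_eq_true_eq] at hxz
      rcases h with rfl | h
      · exact absurd hxz.2 hy
      · rcases List.mem_cons.1 h with rfl | h
        · exact absurd (hxz.1 ▸ hxz.2) hy
        · exact List.mem_cons_of_mem _ h
    | false =>
      rw [cond_false, List.mem_cons]
      rcases h with rfl | h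
      · exact Or.inr (ih (Or.inl rfl))
      · exact (List.mem_cons.1 h).imp id fun h => ih (Or.inr h)

/-- The first node with label `l` absorbs a new node with that label. -/
theorem find?_mergeNode {o : List ℕ} {x : ℕ × Pat} {c : List (ℕ × Pat)} {l : ℕ} (hl : l ∈ o) :
    (mergeNode o x c).find? (fun y => decide (y.1 = l)) =
      if x.1 = l then
        some ((c.find? fun y => decide (y.1 = l)).elim x fun y => (y.1, x.2.append y.2))
      else c.find? fun y => decide (y.1 = l) := by
  induction c with
  | nil => by_cases hx : x.1 = l <;> simp [mergeNode, hx]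
  | cons z c ih =>
    rw [mergeNode]
    by_cases hxz : x.1 = z.1
    · by_cases ho : x.1 ∈ o
      · by_cases hx : x.1 = l
        · have hz : z.1 = l := hxz ▸ hx
          have ho' : l ∈ o := hl
          simp [hx, hz, ho']
        · have hz : ¬z.1 = l := hxz ▸ hx
          simp [hxz ▸ ho, hxz, hz]
      · have hx : ¬x.1 = l := fun h => ho (h ▸ hl)
        have hz : ¬z.1 = l := hxz ▸ hx
        simp [ho, hx, hz, ih]
    · simp only [hxz, decide_false, Bool.false_and, cond_false]
      by_cases hx : x.1 = l
      · have hz : ¬z.1 = l := fun h => hxz (hx.trans h.symm)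
        simp [hx, hz, ih]
      · by_cases hz : z.1 = l <;> simp [hx, hz, ih]

/-- The nodes with a label `l` in `o` are merged into one node. -/
theorem exists_mergeNodes {o : List ℕ} {g : List (ℕ × Pat)} {l : ℕ} (hl : l ∈ o)
    (hg : ∃ x ∈ g, x.1 = l) : ∃ y, (mergeNodes o g).find? (fun y => decide (y.1 = l)) = some y ∧
      ∀ t : XmlTree (Fin n), y.2.HoldsBelow t → ∀ x ∈ g, x.1 = l → x.2.HoldsBelow t := by
  induction g with
  | nil => simp at hg
  | cons x g ih =>
    rw [mergeNodes, find?_mergeNode hl]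
    by_cases hx : x.1 = l
    · rw [if_pos hx]
      refine ⟨_, rfl, fun t ht => ?_⟩
      by_cases hg' : ∃ x ∈ g, x.1 = l
      · obtain ⟨y, hy, hy'⟩ := ih hg'
        rw [hy] at ht
        obtain ⟨h1, h2⟩ := Pat.holdsBelow_append.1 ht
        intro z hz hzl
        rcases List.mem_cons.1 hz with rfl | hz
        · exact h1
        · exact hy' t h2 z hz hzl
      · intro z hz hzl
        rcases List.mem_cons.1 hz with rfl | hz
        · cases hf : (mergeNodes o g).find? fun y => decide (y.1 = l) with
          | none => rwa [hf] at ht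
          | some y =>
            rw [hf] at ht
            exact (Pat.holdsBelow_append.1 ht).1
        · exact absurd ⟨z, hz, hzl⟩ hg'
    · rw [if_neg hx]
      obtain ⟨y, hy, hy'⟩ := ih (by
        obtain ⟨z, hz, hzl⟩ := hg
        rcases List.mem_cons.1 hz with rfl | hz
        · exact absurd hzl hx
        · exact ⟨z, hz, hzl⟩)
      refine ⟨y, hy, fun t ht z hz hzl => ?_⟩
      rcases List.mem_cons.1 hz with rfl | hz
      · exact absurd hzl hx
      · exact hy' t ht z hz hzl

/-- Trees for the pattern nodes in `g`, where nodes with the same label in `o` get the same tree. -/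
theorem exists_trees {D : DTD} {o : List ℕ} {g : List (ℕ × Pat)}
    (h : ∀ x ∈ mergeNodes o g, D.Realizes x.1 x.2) :
    ∃ τ : ℕ × Pat → XmlTree (Fin D.numLabels),
      (∀ x ∈ g, (τ x).rootNum = x.1 ∧ D.Valid (τ x) ∧ x.2.HoldsBelow (τ x)) ∧
      ∀ x ∈ g, ∀ y ∈ g, x.1 = y.1 → x.1 ∈ o → τ x = τ y := by
  have ho : ∀ l ∈ o, (∃ x ∈ g, x.1 = l) → ∃ t : XmlTree (Fin D.numLabels), t.rootNum = l ∧
      D.Valid t ∧ ∀ x ∈ g, x.1 = l → x.2.HoldsBelow t := by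
    intro l hl hg
    obtain ⟨y, hy, hy'⟩ := exists_mergeNodes (n := D.numLabels) hl hg
    obtain ⟨t, h1, h2, h3⟩ := h y (List.mem_of_find?_eq_some hy)
    have hyl : y.1 = l := by simpa using List.find?_some hy
    exact ⟨t, h1.trans hyl, h2, hy' t h3⟩
  have ho' : ∀ x ∈ g, x.1 ∉ o → D.Realizes x.1 x.2 := by
    intro x hx hxo
    refine h x ?_
    clear h ho
    induction g with
    | nil => simp at hx
    | cons y g ih => exact mem_mergeNode_of_not_mem hxo ((List.mem_cons.1 hx).imp id ih)
  classical
  have hchoose : ∀ x : ℕ × Pat, ∃ t : XmlTree (Fin D.numLabels), x ∈ g →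
      (if hx : x.1 ∈ o ∧ ∃ y ∈ g, y.1 = x.1 then t = (ho x.1 hx.1 hx.2).choose
        else t.rootNum = x.1 ∧ D.Valid t ∧ x.2.HoldsBelow t) := by
    intro x
    by_cases hx : x.1 ∈ o ∧ ∃ y ∈ g, y.1 = x.1
    · exact ⟨(ho x.1 hx.1 hx.2).choose, fun _ => by rw [dif_pos hx]⟩
    · by_cases hxg : x ∈ g
      · obtain ⟨t, ht⟩ := ho' x hxg fun h => hx ⟨h, x, hxg, rfl⟩
        exact ⟨t, fun _ => by rw [dif_neg hx]; exact ht⟩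
      · exact ⟨node D.root [], fun h => absurd h hxg⟩
  choose τ hτ using hchoose
  refine ⟨τ, fun x hx => ?_, fun x hx y hy hxy hxo => ?_⟩
  · have h1 := hτ x hx
    by_cases hxo : x.1 ∈ o ∧ ∃ y ∈ g, y.1 = x.1
    · rw [dif_pos hxo] at h1
      have h2 := (ho x.1 hxo.1 hxo.2).choose_spec
      rw [← h1] at h2
      exact ⟨h2.1, h2.2.1, h2.2.2 x hx rfl⟩
    · rwa [dif_neg hxo] at h1
  · have h1 := hτ x hx
    have h2 := hτ y hy
    rw [dif_pos ⟨hxo, x, hx, rfl⟩] at h1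
    rw [dif_pos ⟨hxy ▸ hxo, y, hy, rfl⟩] at h2
    rw [h1, h2]
    congr 1
    simp only [hxy]

end XPathSat

namespace XPathSat

open XmlTree

variable {n : ℕ}

/-- A tree together with its slot and its height, by which the trees at the same slot are
ordered. -/
abbrev Entry (n : ℕ) : Type := (Slot × ℤ) × XmlTree (Fin n)

/-- The position of an entry in the order of siblings, which is lexicographic. The sign is there
because the numbers of slots decrease from left to right. -/
def slotKey (k : Slot × ℤ) : ℤ ×ₗ ℤ := toLex (-(k.1.1 : ℤ), k.2)

theorem slotKey_lt {k k' : Slot × ℤ} :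
    slotKey k < slotKey k' ↔ k'.1.1 < k.1.1 ∨ (k.1.1 = k'.1.1 ∧ k.2 < k'.2) := by
  simp [slotKey, Prod.Lex.toLex_lt_toLex]

theorem snd_mem_of_mem_numberSlots {S : List (Bool × List ℕ)} {p : Slot}
    (hp : p ∈ numberSlots S) : p.2 ∈ S := by
  induction S with
  | nil => simp [numberSlots] at hp
  | cons s S ih =>
    rcases List.mem_cons.1 hp with rfl | hp
    · simp
    · exact List.mem_cons_of_mem _ (ih hp)

theorem numberSlots_injective {S : List (Bool × List ℕ)} {p q : Slot} (hp : p ∈ numberSlots S)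
    (hq : q ∈ numberSlots S) (h : p.1 = q.1) : p = q := by
  induction S with
  | nil => simp [numberSlots] at hp
  | cons s S ih =>
    rcases List.mem_cons.1 hp with rfl | hp' <;> rcases List.mem_cons.1 hq with rfl | hq'
    · rfl
    · have := fst_lt_of_mem_numberSlots hq'
      simp only at h
      omega
    · have := fst_lt_of_mem_numberSlots hp'
      simp only at h
      omega
    · exact ih hp' hq'

/-- The converse of `exists_slots_of_traces`. -/
theorem traces_of_pairwise_before {S : List (Bool × List ℕ)} {L : List (Slot × ℕ)}
    (h1 : ∀ e ∈ L, e.1 ∈ numberSlots S ∧ e.2 ∈ e.1.2.2)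
    (h2 : L.Pairwise fun e e' => e.1.before e'.1 = true) : Traces S (L.map Prod.snd) := by
  induction S generalizing L with
  | nil =>
    rcases L with _ | ⟨e, L⟩
    · rfl
    · have := (h1 e (by simp)).1
      simp [numberSlots] at this
  | cons s S ihS =>
    induction L with
    | nil => exact traces_nil _
    | cons e L ih =>
      obtain ⟨h3, h4⟩ := List.pairwise_cons.1 h2
      obtain ⟨h5, h6⟩ := h1 e (by simp)
      have h7 := fun e' he' => h1 e' (List.mem_cons_of_mem e he')
      have hbefore : ∀ e' ∈ L, e'.1.1 < e.1.1 ∨ e'.1.1 = e.1.1 ∧ e.1.2.1 = true := by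
        intro e' he'
        have := h3 e' he'
        simp only [Slot.before, Bool.or_eq_true, Bool.and_eq_true, decide_eq_true_eq] at this
        exact this.imp id fun h => ⟨h.1.symm, h.2⟩
      have hlater : ∀ e' ∈ L, e'.1.1 < S.length → e'.1 ∈ numberSlots S := by
        intro e' he' hlt
        rcases List.mem_cons.1 (h7 e' he').1 with h | h
        · simp [h] at hlt
        · exact h
      rcases List.mem_cons.1 h5 with h5 | h5
      · rw [h5] at h6 hbefore
        cases hs : s.1 with
        | true =>
          obtain ⟨u, v, huv, h8, -, h9⟩ := ih h7 h4
          refine ⟨e.2 :: u, v, by simp [huv], List.forall_mem_cons.2 ⟨h6, h8⟩, by simp [hs], h9⟩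
        | false =>
          refine ⟨[e.2], L.map Prod.snd, rfl, by simpa using h6, by simp, ihS ?_ h4⟩
          intro e' he'
          refine ⟨hlater e' he' ?_, (h7 e' he').2⟩
          have := hbefore e' he'
          simpa [hs] using this
      · have h8 := fst_lt_of_mem_numberSlots h5
        refine ⟨[], (e :: L).map Prod.snd, rfl, by simp, by simp, ihS ?_ h2⟩
        refine List.forall_mem_cons.2 ⟨⟨h5, h6⟩, fun e' he' => ⟨hlater e' he' ?_, (h7 e' he').2⟩⟩
        have := hbefore e' he'
        omega

namespace Pat

/-- The sibling edges of a pattern node with position `k` are satisfied by entries in `X`. -/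
def HoldsIn (X : List (Entry n)) : Pat → Slot × ℤ → Prop
  | nil, _ => True
  | edge Axis.child _ _ R, k => HoldsIn X R k
  | edge Axis.followingSibling l E R, k => (∃ k' t, (k', t) ∈ X ∧ t.rootNum = l ∧
      E.HoldsBelow t ∧ slotKey k < slotKey k' ∧ HoldsIn X E k') ∧ HoldsIn X R k
  | edge Axis.precedingSibling l E R, k => (∃ k' t, (k', t) ∈ X ∧ t.rootNum = l ∧
      E.HoldsBelow t ∧ slotKey k' < slotKey k ∧ HoldsIn X E k') ∧ HoldsIn X R k

/-- The child edges of a pattern node are satisfied by entries in `X`. -/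
def HoldsBelowIn (X : List (Entry n)) : Pat → Prop
  | nil => True
  | edge Axis.child l E R => (∃ k t, (k, t) ∈ X ∧ t.rootNum = l ∧
      E.HoldsBelow t ∧ HoldsIn X E k) ∧ HoldsBelowIn X R
  | edge Axis.followingSibling _ _ R => HoldsBelowIn X R
  | edge Axis.precedingSibling _ _ R => HoldsBelowIn X R

theorem HoldsIn.mono {X Y : List (Entry n)} (h : X ⊆ Y) {E : Pat} {k : Slot × ℤ}
    (hE : E.HoldsIn X k) : E.HoldsIn Y k := by
  induction E generalizing k with
  | nil => trivial
  | edge χ l E R ihE ihR =>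
    cases χ <;> rw [HoldsIn] at hE ⊢
    · exact ihR hE
    all_goals
      obtain ⟨⟨k', t, h1, h2, h3, h4, h5⟩, h6⟩ := hE
      exact ⟨⟨k', t, h h1, h2, h3, h4, ihE h5⟩, ihR h6⟩

theorem HoldsBelowIn.mono {X Y : List (Entry n)} (h : X ⊆ Y) {E : Pat}
    (hE : E.HoldsBelowIn X) : E.HoldsBelowIn Y := by
  induction E with
  | nil => trivial
  | edge χ l E R ihE ihR =>
    cases χ <;> rw [HoldsBelowIn] at hE ⊢
    · obtain ⟨⟨k', t, h1, h2, h3, h5⟩, h6⟩ := hE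
      exact ⟨⟨k', t, h h1, h2, h3, h5.mono h⟩, ihR h6⟩
    all_goals exact ihR hE

theorem feasible_subset {S : List Slot} {E : Pat} : E.feasible S ⊆ S := by
  induction E with
  | nil => exact fun _ h => h
  | edge χ l E R _ ihR =>
    rw [feasible]
    cases χ.isChild
    · exact fun p hp => ihR (List.mem_of_mem_filter hp)
    · exact ihR

end Pat

/-- The entry has the tree `τ x` of a node `x` in `g` and a slot for its label. The height is `0` at
slots for at most one tree. -/
def Entry.Fits (S : List (Bool × List ℕ)) (g : List (ℕ × Pat)) (τ : ℕ × Pat → XmlTree (Fin n))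
    (e : Entry n) : Prop :=
  e.1.1 ∈ numberSlots S ∧ (e.1.1.2.1 = false → e.1.2 = 0) ∧
    ∃ x ∈ g, e.2 = τ x ∧ x.1 ∈ e.1.1.2.2

variable {S : List (Bool × List ℕ)} {τ : ℕ × Pat → XmlTree (Fin n)}

theorem Entry.Fits.mono {g g' : List (ℕ × Pat)} (h : g ⊆ g') {e : Entry n}
    (he : Entry.Fits S g τ e) : Entry.Fits S g' τ e := by
  obtain ⟨h1, h2, x, h3, h4⟩ := he
  exact ⟨h1, h2, x, h h3, h4⟩

/-- At a feasible slot and any height, a pattern node can be completed by entries for its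
siblings. Heights increase along edges between entries at the same slot. -/
theorem Pat.exists_entries {E : Pat} {k : Slot × ℤ}
    (hτ : ∀ x ∈ E.siblings, (τ x).rootNum = x.1 ∧ x.2.HoldsBelow (τ x))
    (hk : k.1 ∈ E.feasible (numberSlots S)) :
    ∃ X : List (Entry n), (∀ e ∈ X, Entry.Fits S E.siblings τ e) ∧ E.HoldsIn X k := by
  induction E generalizing k with
  | nil => exact ⟨[], by simp, trivial⟩
  | edge χ l E R ihE ihR =>
    have hslot := Pat.feasible_subset hk
    rw [feasible] at hk
    rw [siblings] at hτ ⊢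
    have key : χ.isChild = false → ∃ X : List (Entry n), (∀ e ∈ X, Entry.Fits S
        ((l, E.down) :: (E.siblings ++ R.siblings)) τ e) ∧ HoldsIn X R k ∧
        ∃ k' t, (k', t) ∈ X ∧ t.rootNum = l ∧ E.HoldsBelow t ∧
          (bif χ.isFollowing then slotKey k < slotKey k' else slotKey k' < slotKey k) ∧
          HoldsIn X E k' := by
      intro hχ
      rw [hχ, cond_false] at hk hτ
      obtain ⟨hk, hq⟩ := List.mem_filter.1 hk
      obtain ⟨q, hq, hlq⟩ := List.any_eq_true.1 hq
      rw [Bool.and_eq_true, decide_eq_true_eq] at hlq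
      obtain ⟨hlq, hbefore⟩ := hlq
      have hq' := Pat.feasible_subset hq
      let z : ℤ := bif q.2.1 then (bif χ.isFollowing then k.2 + 1 else k.2 - 1) else 0
      obtain ⟨X₁, hX₁, hE⟩ := ihE (k := (q, z)) (fun x hx => hτ x (by simp [hx])) hq
      obtain ⟨X₂, hX₂, hR⟩ := ihR (fun x hx => hτ x (by simp [hx])) hk
      have hsub₁ : X₁ ⊆ ((q, z), τ (l, E.down)) :: (X₁ ++ X₂) := fun e he => by simp [he]
      have hsub₂ : X₂ ⊆ ((q, z), τ (l, E.down)) :: (X₁ ++ X₂) := fun e he => by simp [he]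
      obtain ⟨h1, h2⟩ := hτ (l, E.down) (by simp)
      refine ⟨((q, z), τ (l, E.down)) :: (X₁ ++ X₂), ?_, hR.mono hsub₂, (q, z), _,
        by simp, h1, holdsBelow_down.1 h2, ?_, hE.mono hsub₁⟩
      · refine List.forall_mem_cons.2 ⟨⟨hq', fun h => by simp [z, show q.2.1 = false from h],
          _, by simp, rfl, hlq⟩, fun e he => ?_⟩
        rcases List.mem_append.1 he with he | he
        · exact (hX₁ e he).mono fun x hx => by simp [hx]
        · exact (hX₂ e he).mono fun x hx => by simp [hx]
      · cases hf : χ.isFollowing with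
        | true =>
          rw [hf, cond_true] at hbefore
          simp only [Slot.before, Bool.or_eq_true, Bool.and_eq_true, decide_eq_true_eq] at hbefore
          rw [cond_true, slotKey_lt]
          refine hbefore.imp id fun h => ⟨h.1, ?_⟩
          rw [numberSlots_injective hslot hq' h.1] at h
          simp [z, h.2, hf]
        | false =>
          rw [hf, cond_false] at hbefore
          simp only [Slot.before, Bool.or_eq_true, Bool.and_eq_true, decide_eq_true_eq] at hbefore
          rw [cond_false, slotKey_lt]
          refine hbefore.imp id fun h => ⟨h.1, ?_⟩
          simp [z, h.2, hf]
    cases χ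
    · exact ihR hτ hk
    · obtain ⟨X, h1, h2, h3⟩ := key rfl
      exact ⟨X, h1, h3, h2⟩
    · obtain ⟨X, h1, h2, h3⟩ := key rfl
      exact ⟨X, h1, h3, h2⟩

theorem Pat.exists_entries_below {E : Pat}
    (hτ : ∀ x ∈ E.offspring, (τ x).rootNum = x.1 ∧ x.2.HoldsBelow (τ x))
    (hE : E.placeable (numberSlots S) = true) :
    ∃ X : List (Entry n), (∀ e ∈ X, Entry.Fits S E.offspring τ e) ∧ E.HoldsBelowIn X := by
  induction E with
  | nil => exact ⟨[], by simp, trivial⟩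
  | edge χ l E R ihE ihR =>
    rw [placeable] at hE
    rw [offspring] at hτ ⊢
    cases χ <;> simp only [Axis.isChild, cond_true, cond_false] at hE hτ ⊢
    · rw [Bool.and_eq_true, List.any_eq_true] at hE
      obtain ⟨⟨q, hq, hlq⟩, hR⟩ := hE
      rw [decide_eq_true_eq] at hlq
      have hq' := Pat.feasible_subset hq
      obtain ⟨X₁, hX₁, hE⟩ := exists_entries (τ := τ) (k := (q, 0))
        (fun x hx => hτ x (by simp [hx])) hq
      obtain ⟨X₂, hX₂, hR⟩ := ihR (fun x hx => hτ x (by simp [hx])) hR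
      have hsub₁ : X₁ ⊆ ((q, 0), τ (l, E.down)) :: (X₁ ++ X₂) := fun e he => by simp [he]
      have hsub₂ : X₂ ⊆ ((q, 0), τ (l, E.down)) :: (X₁ ++ X₂) := fun e he => by simp [he]
      obtain ⟨h1, h2⟩ := hτ (l, E.down) (by simp)
      refine ⟨((q, 0), τ (l, E.down)) :: (X₁ ++ X₂), ?_,
        ⟨(q, 0), _, by simp, h1, holdsBelow_down.1 h2, hE.mono hsub₁⟩, hR.mono hsub₂⟩
      refine List.forall_mem_cons.2 ⟨⟨hq', fun _ => rfl, _, by simp, rfl, hlq⟩, fun e he => ?_⟩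
      rcases List.mem_append.1 he with he | he
      · exact (hX₁ e he).mono fun x hx => by simp [hx]
      · exact (hX₂ e he).mono fun x hx => by simp [hx]
    all_goals exact ihR hτ hE

/-- If the labels of the trees `ts` form a subword of `w`, then `ts` can be completed to a list of
trees with the labels `w`. -/
theorem exists_completion {D : DTD} (hD : ∀ b, ∃ t, t.rootLabel = b ∧ D.Valid t)
    {ts : List (XmlTree (Fin D.numLabels))} {w : List (Fin D.numLabels)}
    (hts : ∀ t ∈ ts, D.Valid t) (h : (ts.map rootNum).Sublist (w.map Fin.val)) :
    ∃ hs : List (XmlTree (Fin D.numLabels)), hs.map rootLabel = w ∧ ts.Sublist hs ∧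
      ∀ t ∈ hs, D.Valid t := by
  induction w generalizing ts with
  | nil =>
    obtain rfl : ts = [] := by simpa using h
    exact ⟨[], rfl, List.Sublist.refl _, by simp⟩
  | cons b w ih =>
    rcases List.sublist_cons_iff.1 h with h' | ⟨r, hr, h'⟩
    · obtain ⟨t, rfl, ht⟩ := hD b
      obtain ⟨hs, rfl, h1, h2⟩ := ih hts h'
      exact ⟨t :: hs, rfl, h1.cons t, List.forall_mem_cons.2 ⟨ht, h2⟩⟩
    · rcases ts with _ | ⟨t, ts⟩
      · simp at hr
      · obtain ⟨hb, rfl⟩ := List.cons.inj hr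
        obtain rfl : t.rootLabel = b := Fin.val_injective hb
        obtain ⟨ht, hts⟩ := List.forall_mem_cons.1 hts
        obtain ⟨hs, rfl, h1, h2⟩ := ih hts h'
        exact ⟨t :: hs, rfl, h1.cons_cons t, List.forall_mem_cons.2 ⟨ht, h2⟩⟩

/-- Edges that are satisfied by the entries of a sorted list are satisfied in every list that
contains their trees in this order. -/
theorem Pat.HoldsIn.holdsAt {L : List (Entry n)} {hs : List (XmlTree (Fin n))} {f : ℕ → ℕ}
    (hL : L.Pairwise fun e e' => slotKey e.1 ≤ slotKey e'.1)
    (hf : StrictMono f) (hLf : ∀ i e, L[i]? = some e → hs[f i]? = some e.2) {E : Pat}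
    {k : Slot × ℤ} {t : XmlTree (Fin n)} {i : ℕ} (hi : L[i]? = some (k, t)) (ht : E.HoldsBelow t)
    (hE : E.HoldsIn L k) : E.HoldsAt hs (f i) := by
  have hlt : ∀ (i j : ℕ) (e e' : Entry n), L[i]? = some e → L[j]? = some e' →
      slotKey e.1 < slotKey e'.1 → i < j := by
    intro i j e e' hi hj h
    obtain ⟨hi', rfl⟩ := List.getElem?_eq_some_iff.1 hi
    obtain ⟨hj', rfl⟩ := List.getElem?_eq_some_iff.1 hj
    by_contra hij
    rcases (not_lt.1 hij).lt_or_eq with hij | rfl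
    · exact (List.pairwise_iff_getElem.1 hL j i hj' hi' hij).not_gt h
    · exact lt_irrefl _ h
  induction E generalizing k t i with
  | nil => trivial
  | edge χ l E R ihE ihR =>
    cases χ <;> rw [HoldsIn] at hE <;> rw [HoldsBelow] at ht <;> rw [HoldsAt]
    · exact ⟨⟨t, hLf i _ hi, ht.1⟩, ihR hi ht.2 hE⟩
    all_goals
      obtain ⟨⟨k', t', h1, h2, h3, h4, h5⟩, h6⟩ := hE
      obtain ⟨j, hj⟩ := List.mem_iff_getElem?.1 h1
      refine ⟨⟨f j, t', hf ?_, hLf j _ hj, h2, ihE hj h3 h5⟩, ihR hi ht h6⟩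
    · exact hlt i j _ _ hi hj h4
    · exact hlt j i _ _ hj hi h4

theorem Pat.HoldsBelowIn.holdsBelow {L : List (Entry n)} {a : Fin n} {hs : List (XmlTree (Fin n))}
    {f : ℕ → ℕ} (hL : L.Pairwise fun e e' => slotKey e.1 ≤ slotKey e'.1)
    (hf : StrictMono f) (hLf : ∀ i e, L[i]? = some e → hs[f i]? = some e.2) {E : Pat}
    (hE : E.HoldsBelowIn L) : E.HoldsBelow (node a hs) := by
  induction E with
  | nil => trivial
  | edge χ l E R ihE ihR =>
    cases χ <;> rw [HoldsBelowIn] at hE <;> rw [HoldsBelow]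
    · obtain ⟨⟨k, t, h1, h2, h3, h4⟩, h5⟩ := hE
      obtain ⟨i, hi⟩ := List.mem_iff_getElem?.1 h1
      exact ⟨⟨f i, t, hLf i _ hi, h2, h4.holdsAt hL hf hLf hi h3⟩, ihR h5⟩
    all_goals exact ihR hE

/-- The trees for the offspring are arranged by their slots and heights, and the list is completed
to a list of children. -/
theorem realizes_of_fits {D : DTD} (hD : ∀ b, ∃ t, t.rootLabel = b ∧ D.Valid t)
    {a : Fin D.numLabels} {E : Pat} (hfits : fits (D.content a) E = true)
    (h : ∀ x ∈ mergeNodes (D.content a).outerLabels E.offspring, D.Realizes x.1 x.2) :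
    D.Realizes a E := by
  classical
  obtain ⟨τ, hτ1, hτ2⟩ := exists_trees h
  rw [fits, Bool.and_eq_true] at hfits
  obtain ⟨hplace, hconf⟩ := hfits
  obtain ⟨X, hX, hEX⟩ := Pat.exists_entries_below (τ := τ)
    (fun x hx => ⟨(hτ1 x hx).1, (hτ1 x hx).2.2⟩) hplace
  let L := X.dedup.insertionSort fun e e' => slotKey e.1 ≤ slotKey e'.1
  have hperm : L.Perm X.dedup := List.perm_insertionSort _ _
  have hmem : ∀ e, e ∈ L ↔ e ∈ X := fun e => hperm.mem_iff.trans List.mem_dedup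
  have hLX : ∀ e ∈ L, Entry.Fits (D.content a).atoms E.offspring τ e :=
    fun e he => hX e ((hmem e).1 he)
  have hnodup : L.Nodup := hperm.nodup_iff.2 (List.nodup_dedup X)
  have hsorted : L.Pairwise fun e e' => slotKey e.1 ≤ slotKey e'.1 := by
    have : Std.Total fun e e' : Entry D.numLabels => slotKey e.1 ≤ slotKey e'.1 :=
      ⟨fun _ _ => le_total _ _⟩
    have : IsTrans (Entry D.numLabels) fun e e' => slotKey e.1 ≤ slotKey e'.1 :=
      ⟨fun _ _ _ => le_trans⟩
    exact List.pairwise_insertionSort _ _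
  have htree : ∀ e ∈ L, e.2.rootNum ∈ e.1.1.2.2 ∧ D.Valid e.2 ∧
      ∃ x ∈ E.offspring, e.2 = τ x ∧ e.2.rootNum = x.1 := by
    intro e he
    obtain ⟨-, -, x, hx, hex, hxl⟩ := hLX e he
    obtain ⟨h1, h2, -⟩ := hτ1 x hx
    rw [hex]
    exact ⟨by rwa [h1], h2, x, hx, rfl, h1⟩
  -- at a slot for at most one tree, all entries coincide
  have huniq : ∀ e ∈ L, ∀ e' ∈ L, e.1.1 = e'.1.1 → e.1.1.2.1 = false → e = e' := by
    intro e he e' he' hee hs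
    obtain ⟨h1, h2, -⟩ := hLX e he
    obtain ⟨-, h2', -⟩ := hLX e' he'
    obtain ⟨h3, -, x, hx, hex, hxl⟩ := htree e he
    obtain ⟨h3', -, x', hx', hex', hxl'⟩ := htree e' he'
    have h4 : (false, e.1.1.2.2) ∈ (D.content a).atoms := by
      rw [← hs]
      exact snd_mem_of_mem_numberSlots h1
    obtain ⟨y, hy, hy'⟩ := RegEx.eq_singleton_of_mem_atoms h4
    rw [← hee] at h3'
    rw [hy', List.mem_singleton] at h3 h3'
    have h5 : x.1 = y := hxl ▸ h3
    have h5' : x'.1 = y := hxl' ▸ h3'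
    have h6 : e.2 = e'.2 := by
      rw [hex, hex']
      exact hτ2 x hx x' hx' (h5.trans h5'.symm) (h5 ▸ hy)
    exact Prod.ext (Prod.ext hee ((h2 hs).trans (h2' (hee ▸ hs)).symm)) h6
  have htraces : Traces (D.content a).atoms (L.map fun e => e.2.rootNum) := by
    have := traces_of_pairwise_before (S := (D.content a).atoms)
      (L := L.map fun e => (e.1.1, e.2.rootNum)) ?_ ?_
    · rwa [List.map_map] at this
    · intro x hx
      obtain ⟨e, he, rfl⟩ := List.mem_map.1 hx
      exact ⟨(hLX e he).1, (htree e he).1⟩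
    · rw [List.pairwise_map]
      refine List.Pairwise.imp_of_mem ?_ (hsorted.and hnodup)
      rintro e e' he he' ⟨hle, hne⟩
      rw [← not_lt, slotKey_lt] at hle
      simp only [Slot.before, Bool.or_eq_true, Bool.and_eq_true, decide_eq_true_eq]
      by_cases h1 : e'.1.1.1 < e.1.1.1
      · exact Or.inl h1
      · refine Or.inr ⟨by omega, ?_⟩
        by_contra hs
        exact hne (huniq e he e' he'
          (numberSlots_injective (hLX e he).1 (hLX e' he').1 (by omega)) (by simpa using hs))
  obtain ⟨w, hw, hsub⟩ := RegEx.exists_sublist_of_traces htraces (by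
    intro x hx y hy
    obtain ⟨e, he, rfl⟩ := List.mem_map.1 hx
    obtain ⟨e', he', rfl⟩ := List.mem_map.1 hy
    obtain ⟨-, -, x, hx, -, hx'⟩ := htree e he
    obtain ⟨-, -, y, hy, -, hy'⟩ := htree e' he'
    have := List.all_eq_true.1 (List.all_eq_true.1 hconf x hx) y hy
    simpa [hx', hy'] using this)
  obtain ⟨hs, rfl, h1, h2⟩ := exists_completion hD (ts := L.map Prod.snd)
    (fun t ht => by
      obtain ⟨e, he, rfl⟩ := List.mem_map.1 ht
      exact (htree e he).2.1) (by rwa [List.map_map])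
  obtain ⟨f, hf⟩ := List.sublist_iff_exists_orderEmbedding_getElem?_eq.1 h1
  refine ⟨node a hs, rfl, DTD.valid_node.2 ⟨hw, h2⟩,
    (hEX.mono fun e he => (hmem e).2 he).holdsBelow hsorted f.strictMono fun i e hi => ?_⟩
  rw [← hf, List.getElem?_map, hi]
  rfl

end XPathSat

/-! ### Correctness of the decision procedure -/

namespace XPathSat

open XmlTree

theorem Pat.exists_slot_of_mem_feasible {S : List Slot} {p : Slot} {E : Pat}
    (hp : p ∈ E.feasible S) : ∀ x ∈ E.siblings, ∃ q ∈ S, x.1 ∈ q.2.2 := by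
  induction E generalizing p with
  | nil => simp [siblings]
  | edge χ l E R ihE ihR =>
    rw [feasible] at hp
    rw [siblings]
    cases h : χ.isChild <;> rw [h] at hp
    · obtain ⟨hp, hq⟩ := List.mem_filter.1 hp
      obtain ⟨q, hq, hlq⟩ := List.any_eq_true.1 hq
      rw [Bool.and_eq_true, decide_eq_true_eq] at hlq
      refine List.forall_mem_cons.2 ⟨⟨q, feasible_subset hq, hlq.1⟩, fun x hx => ?_⟩
      exact (List.mem_append.1 hx).elim (ihE hq x) (ihR hp x)
    · exact ihR hp

theorem Pat.exists_slot_of_placeable {S : List Slot} {E : Pat} (hE : E.placeable S = true) :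
    ∀ x ∈ E.offspring, ∃ q ∈ S, x.1 ∈ q.2.2 := by
  induction E with
  | nil => simp [offspring]
  | edge χ l E R ihE ihR =>
    rw [placeable] at hE
    rw [offspring]
    cases h : χ.isChild <;> rw [h] at hE
    · exact ihR hE
    · rw [cond_true, Bool.and_eq_true, List.any_eq_true] at hE
      obtain ⟨⟨q, hq, hlq⟩, hR⟩ := hE
      refine List.forall_mem_cons.2 ⟨⟨q, feasible_subset hq, by simpa using hlq⟩, fun x hx => ?_⟩
      exact (List.mem_append.1 hx).elim (exists_slot_of_mem_feasible hq x) (ihR hR x)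

/-- The search reaches labels of the DTD only. -/
theorem lt_of_fits {n : ℕ} {e : RegEx (Fin n)} {E : Pat} (hE : fits e E = true) :
    ∀ x ∈ mergeNodes e.outerLabels E.offspring, x.1 < n := by
  intro x hx
  obtain ⟨y, hy, hyx⟩ := exists_mem_of_mem_mergeNodes x hx
  rw [fits, Bool.and_eq_true] at hE
  obtain ⟨q, hq, hq'⟩ := Pat.exists_slot_of_placeable hE.1 y hy
  have := RegEx.mem_labels_of_mem_atoms _ (snd_mem_of_mem_numberSlots hq) _ hq'
  obtain ⟨a, -, ha⟩ := List.mem_map.1 this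
  rw [← hyx, ← ha]
  exact a.isLt

theorem getD_contents (I : SatInput) (a : Fin I.dtd.numLabels) :
    I.contents.getD a default = ⟨I.dtd.numLabels, I.dtd.content a⟩ := by
  simp [SatInput.contents, List.getD_eq_getElem?_getD]

theorem search_eq_true_iff (I : SatInput) (hI : I.dtd.IsMRW)
    (hD : ∀ b, ∃ t, t.rootLabel = b ∧ I.dtd.Valid t) (W : List (ℕ × Pat))
    (hW : ∀ x ∈ W, x.1 < I.dtd.numLabels) :
    search I.contents W = true ↔ ∀ x ∈ W, I.dtd.Realizes x.1 x.2 := by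
  induction hm : sz W using Nat.strong_induction_on generalizing W with
  | _ m ih =>
  subst hm
  rcases W with _ | ⟨⟨a, E⟩, W⟩
  · simp [search]
  · obtain ⟨ha, hW'⟩ := List.forall_mem_cons.1 hW
    lift a to Fin I.dtd.numLabels using ha
    rw [search, getD_contents, Bool.and_eq_true, List.forall_mem_cons]
    have hlt : sz (mergeNodes (I.dtd.content a).outerLabels E.offspring ++ W) <
        sz (((a : ℕ), E) :: W) := by
      have h1 := sz_mergeNodes_le (I.dtd.content a).outerLabels E.offspring
      have h2 := E.sz_offspring_le
      have h3 := sz_append (mergeNodes (I.dtd.content a).outerLabels E.offspring) W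
      have h4 := sz_cons ((a : ℕ), E) W
      have h5 := sz_pair (a : ℕ) E
      omega
    have key : fits (I.dtd.content a) E = true →
        (search I.contents (mergeNodes (I.dtd.content a).outerLabels E.offspring ++ W) = true ↔
          ∀ x ∈ mergeNodes (I.dtd.content a).outerLabels E.offspring ++ W,
            I.dtd.Realizes x.1 x.2) := fun hE =>
      ih _ hlt _ (fun x hx => (List.mem_append.1 hx).elim (lt_of_fits hE x) (hW' x)) rfl
    constructor
    · rintro ⟨hE, h⟩
      obtain ⟨h1, h2⟩ := List.forall_mem_append.1 ((key hE).1 h)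
      exact ⟨realizes_of_fits hD hE h1, h2⟩
    · rintro ⟨h1, h2⟩
      obtain ⟨hE, h3⟩ := fits_of_realizes (hI a) h1
      exact ⟨hE, (key hE).2 (List.forall_mem_append.2 ⟨h3, h2⟩)⟩

theorem DTD.NoUselessSymbols.exists_valid {D : DTD} (h : D.NoUselessSymbols) (b : Fin D.numLabels) :
    ∃ t, t.rootLabel = b ∧ D.Valid t := by
  obtain ⟨t, ht, w, hw⟩ := h b
  obtain ⟨s, hs, rfl⟩ := Option.map_eq_some_iff.1 hw
  exact ⟨s, rfl, DTD.Valid.subtree ht.2 hs⟩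

theorem SatInput.decide_eq_true_iff (I : SatInput) (h1 : I.dtd.IsMRW)
    (h2 : I.dtd.NoUselessSymbols) : I.decide = true ↔ I.query.Satisfiable I.dtd := by
  rw [SatInput.decide, Bool.and_eq_true, search_eq_true_iff I h1 h2.exists_valid _ (by simp),
    satisfiable_iff, List.isEmpty_iff]
  simp [pat]

/-! ### Sizes of instances -/

theorem XPath.size_encode_le {n : ℕ} (p : XPath (Fin n)) :
    p.encode.size + 8 ≤ (2 * n + 20) * p.size := by
  induction p with
  | step χ l =>
    have h : (Data.ofNat (l : ℕ)).size = 2 * l + 1 := sz_nat l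
    have := l.isLt
    cases χ <;> simp [encode, Axis.encode, size, Data.size, Data.ofNat, h] <;> omega
  | comp p q hp hq | filter p q hp hq =>
    simp only [encode, size, Data.size, Data.ofNat, mul_add]
    omega

theorem RegEx.size_pos {n : ℕ} (e : RegEx (Fin n)) : 0 < e.size := by
  cases e <;> simp [size]

theorem size_ofList_ofFn {n : ℕ} (f : Fin n → Data) :
    (Data.ofList (List.ofFn f)).size = ∑ i, ((f i).size + 1) + 1 := by
  induction n with
  | zero => simp [Data.ofList, Data.size]
  | succ n ih =>
    rw [List.ofFn_succ, Data.ofList, Data.size, ih, Fin.sum_univ_succ]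
    omega

theorem DTD.numLabels_le_size (D : DTD) : D.numLabels ≤ D.size := by
  have := Finset.sum_le_sum fun (a : Fin D.numLabels) (_ : a ∈ Finset.univ) =>
    Nat.succ_le_of_lt (D.content a).size_pos
  simpa [DTD.size] using this

theorem SatInput.sz_le (I : SatInput) : sz I ≤ (2 * I.size + 20) * (2 * I.size + 1) := by
  have h1 := I.dtd.numLabels_le_size
  have h2 := I.query.size_encode_le
  have h3 : (Data.ofNat (I.dtd.root : ℕ)).size = 2 * I.dtd.root + 1 := sz_nat _
  have h4 := I.dtd.root.isLt
  have h5 : ∑ a, ((I.dtd.content a).encode.size + 1) ≤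
      (2 * I.dtd.numLabels + 20) * I.dtd.size := by
    rw [DTD.size, Finset.mul_sum]
    exact Finset.sum_le_sum fun a _ => (I.dtd.content a).size_encode_le
  have h6 : sz I = (Data.ofNat (I.dtd.root : ℕ)).size +
      (∑ a, ((I.dtd.content a).encode.size + 1) + 1) + 1 + I.query.encode.size + 1 := by
    rw [← size_ofList_ofFn]
    rfl
  have h7 : I.size = I.dtd.size + I.query.size := rfl
  rw [h6, h3, h7]
  nlinarith

end XPathSat

/-- Satisfiability of XPath expressions with the axes `↓`, `→⁺`, `←⁺` and qualifiers without
disjunction under MRW-DTDs (without useless symbols) is decidable in polynomial time. -/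
theorem mainTheorem2 :
    XPathSat.PolyTimeDecidable XPathSat.SatInput.encode XPathSat.SatInput.size
      (fun I => I.dtd.IsMRW ∧ I.dtd.NoUselessSymbols)
      (fun I => I.query.Satisfiable I.dtd) := by
  obtain ⟨q, -, P, hP⟩ := XPathSat.SatInput.polyTime_decide
  refine ⟨P, q.comp ((2 * Polynomial.X + 20) * (2 * Polynomial.X + 1)), fun I hI => ?_⟩
  obtain ⟨t, ht, h⟩ := hP I
  refine ⟨_, t, h, ht.trans ?_, ?_⟩
  · rw [Polynomial.eval_comp]
    refine XPathSat.eval_mono q (I.sz_le.trans ?_)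
    simp
  · change _ ↔ I.query.Satisfiable I.dtd
    rw [← I.decide_eq_true_iff hI.1 hI.2]
    cases I.decide with
    | false => exact iff_of_false (fun h => h rfl) (by simp)
    | true => exact iff_of_true (fun h => nomatch h) rfl
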